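/- \textbf{Setting.} Let $(w_k)_{k\ge0}$ be a sequence of non-negative real numbers with $w_0>0$ and $w_k>0$ for some $k\ge2$. Let $\Phi(t)=\sum_{k\ge0}w_kt^k\in[0,\infty]$ for $0\le t\le\infty$, and let $\rho\in[0,\infty]$ be the radius of convergence of this series. Let $$\Psi(t)=\frac{t\Phi'(t)}{\Phi(t)}=\frac{\sum_k kw_kt^k}{\sum_k w_kt^k}\in[0,\infty]$$ for $0\le t\le\rho$ with $\Phi(t)<\infty$; if $\Phi(\rho)=\infty$, let $\Psi(\rho)=\lim_{t\uparrow\rho}\Psi(t)$. Let $\nu=\Psi(\rho)\in[0,\infty]$. An ordered rooted tree $T$ (possibly infinite, possibly with nodes of infinite outdegree, the children of such a node being ordered as $1,2,\dots$) is regarded as a subtree of the Ulam–Harris tree, whose nodes are the finite strings of positive integers, and is identified with its outdegrees $d_T(v)\in\{0,1,2,\dots,\infty\}$, where $v$ ranges over all finite strings and $d_T(v)=0$ if $v\notin T$. The space of these trees has the topology of pointwise convergence of outdegrees, where $\{0,1,2,\dots,\infty\}$ is the one-point compactification of the discrete space $\{0,1,2,\dots\}$. For a finite tree $T$ let $w(T)=\prod_{v\in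 T}w_{d_T(v)}$, and let $Z_n=\sum_{|T|=n}w(T)$, the sum being over all ordered rooted trees with $n$ nodes. For $n$ with $Z_n>0$, the simply generated random tree $\mathcal T_n$ has the distribution $P(\mathcal T_n=T)=w(T)/Z_n$ for $|T|=n$. For a probability distribution $(\pi_k)_{k\ge0}$ with mean $\mu\le1$, the modified Galton–Watson tree $\hat{\mathcal T}$ is constructed as follows. Nodes are normal or special, and the root is special. All nodes reproduce independently. A normal node has $k$ children with probability $\pi_k$, all of them normal. A special node has $k$ children with probability $k\pi_k$ for $k<\infty$, and infinitely many children with probability $1-\mu$; if the number of children is finite, one of them, chosen uniformly at random, is special and the others are normal, and if it is infinite, all children are normal. The special nodes form a path starting at the root, called the spine. \textbf{Theorem.} If $\nu\ge1$, there is a unique $\tau\in[0,\rho]$ with $\Psi(\tau)=1$; if $\nu<1$, let $\tau=\rho$. In both cases $0\le\tau<\infty$ and $0<\Phi(\tau)<\infty$. Let $\pi_k=\tau^kw_k/\Phi(\tau)$ for $k\ge0$. Then $(\pi_k)_{k\ge0}$ is a probability distribution, with mean $\mu=\Psi(\tau)=\min(\nu,1)\le1$ and variance $\sigma^2=\tau\Psi'(\tau)\le\infty$.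 (Here, if $\tau=\rho$, then $\Psi'(\rho)$ denotes $\lim_{s\uparrow\rho}\Psi'(s)\in[0,\infty]$; if $\tau=\rho=0$, the product $\tau\Psi'(\tau)$ is read as $0$.) Let $\hat{\mathcal T}$ be the modified Galton–Watson tree for $(\pi_k)$. Then $\mathcal T_n\to\hat{\mathcal T}$ in distribution as $n\to\infty$ through the integers $n$ with $Z_n>0$, in the topology above. Furthermore, if $\nu\ge1$, then $\mu=1$, and almost surely $\hat{\mathcal T}$ is locally finite and its spine is an infinite path. If $\nu<1$, then $\mu=\nu<1$, and almost surely the spine of $\hat{\mathcal T}$ is a finite path whose last node has infinite outdegree, and this is the only node of $\hat{\mathcal T}$ with infinite outdegree. -/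

import Mathlib

open MeasureTheory Filter Topology Set
open scoped ENNReal NNReal

namespace SimplyGenerated

noncomputable section

/-! ### Weight sequences and their generating functions -/

/-- The generating function `Φ(t) = ∑ w_k t^k` for `t ∈ [0, ∞]`, with values in `[0, ∞]`. -/
def Phi (w : ℕ → ℝ≥0) (t : ℝ≥0∞) : ℝ≥0∞ :=
  ∑' k : ℕ, (w k : ℝ≥0∞) * t ^ k

/-- The radius of convergence `ρ ∈ [0, ∞]` of the power series `∑ w_k z^k`. -/
def rho (w : ℕ → ℝ≥0) : ℝ≥0∞ :=
  (FormalMultilinearSeries.ofScalars ℝ fun k => (w k : ℝ)).radius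

/-- The quotient `t Φ'(t) / Φ(t) = (∑ k w_k t^k) / (∑ w_k t^k)`, meaningful when `Φ(t) < ∞`. -/
def psiQuot (w : ℕ → ℝ≥0) (t : ℝ≥0∞) : ℝ≥0∞ :=
  (∑' k : ℕ, (k : ℝ≥0∞) * (w k : ℝ≥0∞) * t ^ k) / Phi w t

/-- The function `Ψ` on `[0, ρ]`: it is `t Φ'(t) / Φ(t)` where `Φ(t) < ∞` (this covers `[0, ρ)`),
and if `Φ(ρ) = ∞` then `Ψ(ρ)` is the limit from the left. (Values at `t > ρ` are not used.) -/
def Psi (w : ℕ → ℝ≥0) (t : ℝ≥0∞) : ℝ≥0∞ :=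
  open Classical in
  if Phi w t < ∞ then psiQuot w t else limUnder (𝓝[<] t) (psiQuot w)

/-- `ν = Ψ(ρ)`. -/
def nu (w : ℕ → ℝ≥0) : ℝ≥0∞ := Psi w (rho w)

/-- The defining property of `τ`: if `ν ≥ 1` then `τ ∈ [0, ρ]` and `Ψ(τ) = 1`;
if `ν < 1` then `τ = ρ`. -/
def IsTau (w : ℕ → ℝ≥0) (τ : ℝ≥0∞) : Prop :=
  (1 ≤ nu w → τ ≤ rho w ∧ Psi w τ = 1) ∧ (nu w < 1 → τ = rho w)

/-- `Ψ` as a real function of a real variable. -/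
def psiReal (w : ℕ → ℝ≥0) (x : ℝ) : ℝ := (Psi w (ENNReal.ofReal x)).toReal

/-- `D ∈ [0, ∞]` is the value `Ψ'(t)`, `t ∈ [0, ρ]`: for `t < ρ` it is the (at `t = 0` one-sided)
derivative, and at `t = ρ` it is by definition the limit of `Ψ'(s)` as `s ↑ ρ`.
(If `ρ = 0`, then `Ψ'(ρ)` is arbitrary; it occurs only in the product `ρ Ψ'(ρ) = 0`.) -/
def IsPsiDeriv (w : ℕ → ℝ≥0) (t D : ℝ≥0∞) : Prop :=
  (t < rho w → D < ∞ ∧ HasDerivWithinAt (psiReal w) D.toReal (Ici 0) t.toReal) ∧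
  (t = rho w →
    (∀ s < t, DifferentiableWithinAt ℝ (psiReal w) (Ici 0) s.toReal) ∧
    Tendsto (fun s : ℝ≥0∞ => ENNReal.ofReal (derivWithin (psiReal w) (Ici 0) s.toReal))
      (𝓝[<] t) (𝓝 D))

/-! ### Probability distributions on the nonnegative integers -/

/-- The mean in `[0, ∞]` of a probability distribution on `{0, 1, 2, …}`. -/
def mean (p : PMF ℕ) : ℝ≥0∞ := ∑' k : ℕ, (k : ℝ≥0∞) * p k

/-- The variance in `[0, ∞]` of a probability distribution on `{0, 1, 2, …}` with finite mean. -/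
def variance (p : PMF ℕ) : ℝ≥0∞ :=
  ∑' k : ℕ, ENNReal.ofReal (((k : ℝ) - (mean p).toReal) ^ 2) * p k

/-! ### Ordered rooted trees in Ulam–Harris coding -/

/-- An ordered rooted tree, possibly infinite and possibly with nodes of infinite outdegree, as
a subtree of the Ulam–Harris tree. Nodes of the Ulam–Harris tree are finite strings, the root is
`[]`, and the children of `v` are `v ++ [0], v ++ [1], …` (children are numbered from `0`). A tree
is given by its outdegrees, which are `0` outside the tree. -/
@[ext]
structure Tree where
  deg : List ℕ → ℕ∞
  deg_eq_zero : ∀ (v : List ℕ) (i : ℕ), deg v ≤ i → deg (v ++ [i]) = 0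

/-- The node set of a tree: every step on the path from the root leads to an existing child. -/
def Tree.nodes (T : Tree) : Set (List ℕ) :=
  {v | ∀ (u : List ℕ) (i : ℕ), u ++ [i] <+: v → (i : ℕ∞) < T.deg u}

/-- The space of trees carries the topology of pointwise convergence of outdegrees, where `ℕ∞` is
the one-point compactification of the discrete space `ℕ`. -/
instance : TopologicalSpace Tree := TopologicalSpace.induced Tree.deg inferInstance

instance : MeasurableSpace Tree := borel Tree

instance : BorelSpace Tree := ⟨rfl⟩

/-- The ordered rooted trees with `n` nodes. -/
abbrev TreeOfSize (n : ℕ) : Type := {T : Tree // T.nodes.encard = n}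

/-- The weight `w(T) = ∏_{v ∈ T} w_{d(v)}` of a finite tree. -/
def weight (w : ℕ → ℝ≥0) (T : Tree) : ℝ≥0 :=
  ∏ᶠ v ∈ T.nodes, w (T.deg v).toNat

/-- The partition function `Z_n`. -/
def partitionFn (w : ℕ → ℝ≥0) (n : ℕ) : ℝ≥0∞ :=
  ∑' T : TreeOfSize n, (weight w T.1 : ℝ≥0∞)

/-! There are finitely many trees of a given size. -/

theorem Tree.mem_nodes_of_prefix {T : Tree} {u v : List ℕ} (h : u <+: v) (hv : v ∈ T.nodes) :
    u ∈ T.nodes :=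
  fun a i ha => hv a i (ha.trans h)

theorem Tree.append_mem_nodes {T : Tree} {v : List ℕ} {i : ℕ} :
    v ++ [i] ∈ T.nodes ↔ v ∈ T.nodes ∧ (i : ℕ∞) < T.deg v := by
  constructor
  · intro h
    exact ⟨Tree.mem_nodes_of_prefix (List.prefix_append _ _) h, h v i (List.prefix_refl _)⟩
  · rintro ⟨h, hi⟩ u j hu
    rcases List.prefix_concat_iff.1 hu with h1 | h1
    · have h2 := List.append_inj' h1 rfl
      obtain ⟨rfl, h3⟩ := h2
      simp only [List.cons.injEq, and_true] at h3
      exact h3 ▸ hi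
    · exact h u j h1

theorem Tree.nil_mem_nodes (T : Tree) : [] ∈ T.nodes := by
  intro u i h
  simp at h

theorem Tree.deg_eq_zero_of_notMem (T : Tree) (v : List ℕ) (hv : v ∉ T.nodes) : T.deg v = 0 := by
  induction v using List.reverseRecOn with
  | nil => exact absurd T.nil_mem_nodes hv
  | append_singleton v i ih =>
    apply T.deg_eq_zero
    by_cases h : v ∈ T.nodes
    · by_contra hlt
      exact hv (Tree.append_mem_nodes.2 ⟨h, not_le.1 hlt⟩)
    · simp [ih h]

theorem Tree.nodes_injective : Function.Injective Tree.nodes := by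
  intro T T' h
  ext1
  funext v
  by_cases hv : v ∈ T.nodes
  · have hv' : v ∈ T'.nodes := h ▸ hv
    have key : ∀ i : ℕ, (i : ℕ∞) < T.deg v ↔ (i : ℕ∞) < T'.deg v := by
      intro i
      have h1 := @Tree.append_mem_nodes T v i
      have h2 := @Tree.append_mem_nodes T' v i
      rw [h] at h1
      rw [h1] at h2
      simpa [hv, hv'] using h2
    refine le_antisymm ?_ ?_
    · refine ENat.forall_natCast_le_iff_le.1 fun m hm => ?_
      rcases m with _ | m
      · simp
      · have : (m : ℕ∞) < T.deg v := lt_of_lt_of_le (by exact_mod_cast Nat.lt_succ_self m) hm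
        have := (key m).1 this
        exact_mod_cast Order.add_one_le_of_lt this
    · refine ENat.forall_natCast_le_iff_le.1 fun m hm => ?_
      rcases m with _ | m
      · simp
      · have : (m : ℕ∞) < T'.deg v := lt_of_lt_of_le (by exact_mod_cast Nat.lt_succ_self m) hm
        have := (key m).2 this
        exact_mod_cast Order.add_one_le_of_lt this
  · have hv' : v ∉ T'.nodes := h ▸ hv
    rw [T.deg_eq_zero_of_notMem v hv, T'.deg_eq_zero_of_notMem v hv']

theorem Tree.nodes_subset_of_encard {T : Tree} {n : ℕ} (h : T.nodes.encard = n) :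
    T.nodes ⊆ {v | v.length < n ∧ ∀ x ∈ v, x < n} := by
  intro v hv
  constructor
  · have hsub : (fun k => v.take k) '' (Set.Iic v.length) ⊆ T.nodes := by
      rintro _ ⟨k, -, rfl⟩
      exact Tree.mem_nodes_of_prefix (List.take_prefix k v) hv
    have hinj : Set.InjOn (fun k => v.take k) (Set.Iic v.length) := by
      intro a ha b hb hab
      have := congrArg List.length hab
      simp only [List.length_take] at this
      simp only [Set.mem_Iic] at ha hb
      omega
    have h1 := Set.encard_le_encard hsub
    rw [hinj.encard_image, h, ← Finset.coe_Iic, Set.encard_coe_eq_coe_finsetCard] at h1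
    simp only [Nat.card_Iic] at h1
    have h2 : v.length + 1 ≤ n := by exact_mod_cast h1
    omega
  · intro x hx
    obtain ⟨s, t, rfl⟩ := List.append_of_mem hx
    have h0 : s ++ [x] ∈ T.nodes :=
      Tree.mem_nodes_of_prefix ⟨t, by simp⟩ hv
    have h0' := Tree.append_mem_nodes.1 h0
    have hsub : (fun k => s ++ [k]) '' (Set.Iic x) ⊆ T.nodes := by
      rintro _ ⟨k, hk, rfl⟩
      exact Tree.append_mem_nodes.2 ⟨h0'.1, lt_of_le_of_lt (by exact_mod_cast hk) h0'.2⟩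
    have hinj : Set.InjOn (fun k => s ++ [k]) (Set.Iic x) := by
      intro a _ b _ hab
      simpa using hab
    have h1 := Set.encard_le_encard hsub
    rw [hinj.encard_image, h, ← Finset.coe_Iic, Set.encard_coe_eq_coe_finsetCard] at h1
    simp only [Nat.card_Iic] at h1
    have h2 : x + 1 ≤ n := by exact_mod_cast h1
    omega

instance (n : ℕ) : Finite (TreeOfSize n) := by
  have hbox : Set.Finite {v : List ℕ | v.length < n ∧ ∀ x ∈ v, x < n} := by
    refine ((List.finite_length_lt (Fin n) n).image (List.map Fin.val)).subset ?_
    rintro v ⟨h1, h2⟩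
    exact ⟨v.pmap (fun x hx => ⟨x, hx⟩) h2, by simpa using h1, by simp [List.map_pmap]⟩
  have hfin := hbox.finite_subsets
  have : Finite {s : Set (List ℕ) | s ⊆ {v : List ℕ | v.length < n ∧ ∀ x ∈ v, x < n}} := hfin
  refine Finite.of_injective
    (fun T : TreeOfSize n =>
      (⟨T.1.nodes, Tree.nodes_subset_of_encard T.2⟩ :
        {s : Set (List ℕ) | s ⊆ {v : List ℕ | v.length < n ∧ ∀ x ∈ v, x < n}})) ?_
  intro T T' h
  exact Subtype.ext (Tree.nodes_injective (congrArg Subtype.val h))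

theorem partitionFn_ne_top (w : ℕ → ℝ≥0) (n : ℕ) : partitionFn w n ≠ ∞ := by
  have := Fintype.ofFinite (TreeOfSize n)
  rw [partitionFn, tsum_fintype]
  exact ENNReal.sum_ne_top.2 fun T _ => ENNReal.coe_ne_top

/-- The law of the simply generated random tree `T_n`: a tree of size `n` is chosen with
probability `w(T) / Z_n`. It is defined for those `n` with `Z_n > 0`. -/
def simplyGeneratedTree (w : ℕ → ℝ≥0) (n : {n : ℕ // partitionFn w n ≠ 0}) :
    PMF (TreeOfSize n) :=
  PMF.normalize (fun T : TreeOfSize n => (weight w T.1 : ℝ≥0∞)) n.2 (partitionFn_ne_top w n)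

/-! ### The modified Galton–Watson tree -/

/-- The probability mass function of the offspring `ξ̂ ∈ {1, 2, …, ∞}` of a special node:
`P(ξ̂ = k) = k π_k` for finite `k`, and `P(ξ̂ = ∞) = 1 - μ`. -/
def sizeBiasedMass (p : PMF ℕ) : ℕ∞ → ℝ≥0∞ :=
  ENat.recTopCoe (C := fun _ => ℝ≥0∞) (1 - mean p) fun k : ℕ => (k : ℝ≥0∞) * p k

theorem hasSum_sizeBiasedMass (p : PMF ℕ) (h : mean p ≤ 1) : HasSum (sizeBiasedMass p) 1 := by
  have h1 : HasSum (sizeBiasedMass p ∘ (Equiv.optionEquivSumPUnit.{0} ℕ).symm)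
      (mean p + (1 - mean p)) := by
    refine HasSum.sum (M := ℝ≥0∞) ?_ ?_
    · exact (ENNReal.summable (f := fun k : ℕ => (k : ℝ≥0∞) * p k)).hasSum
    · have h2 := hasSum_fintype fun _ : PUnit.{1} => 1 - mean p
      simp only [Finset.univ_unique, Finset.sum_singleton] at h2
      exact h2
  rw [add_tsub_cancel_of_le h] at h1
  exact (Equiv.hasSum_iff (Equiv.optionEquivSumPUnit.{0} ℕ).symm).1 h1

/-- The distribution of the offspring `ξ̂` of a special node, for mean `μ ≤ 1`. -/
def sizeBiased (p : PMF ℕ) (h : mean p ≤ 1) : PMF ℕ∞ :=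
  ⟨sizeBiasedMass p, hasSum_sizeBiasedMass p h⟩

/-- A uniformly random child (numbered from `0`) of a node with `k` children, `0 < k < ∞`.
In the other cases the value is not used. -/
def uniformChild (k : ℕ∞) : PMF ℕ :=
  if h : k.toNat = 0 then PMF.pure 0
  else PMF.uniformOfFinset (Finset.range k.toNat) (Finset.nonempty_range_iff.2 h)

/-- The joint law of the number of children of a special node and of its special child. -/
def specialOffspring (p : PMF ℕ) (h : mean p ≤ 1) : PMF (ℕ∞ × ℕ) :=
  (sizeBiased p h).bind fun k => (uniformChild k).map fun j => (k, j)

/-- The random choices for the modified Galton–Watson tree: at each potential node `v`, a number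
`ξ_v` of children to be used if `v` is normal, and a number `ξ̂_v` of children together with the
position of the special child to be used if `v` is special. -/
abbrev Choices : Type := List ℕ → ℕ × (ℕ∞ × ℕ)

/-- The choices at different nodes are independent; `ξ_v` has law `(π_k)` and the choices at a
special node are those of `specialOffspring`. -/
def choiceMeasure (p : PMF ℕ) (h : mean p ≤ 1) : Measure Choices :=
  Measure.infinitePi fun _ : List ℕ => p.toMeasure.prod (specialOffspring p h).toMeasure

instance (p : PMF ℕ) (h : mean p ≤ 1) : IsProbabilityMeasure (choiceMeasure p h) := by
  unfold choiceMeasure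
  infer_instance

/-- The spine, i.e. the set of special nodes: the root is special, and a node is special
if each step on the path to it from the root leads from a node with finitely many
children to the chosen special child of that node. -/
def spine (ω : Choices) : Set (List ℕ) :=
  {v | ∀ (u : List ℕ) (i : ℕ), u ++ [i] <+: v →
    (ω u).2.1 ≠ ⊤ ∧ (i : ℕ∞) < (ω u).2.1 ∧ i = (ω u).2.2}

/-- The number of children that `v` gets if it belongs to the tree. -/
def offspring (ω : Choices) (v : List ℕ) : ℕ∞ :=
  open Classical in if v ∈ spine ω then (ω v).2.1 else ((ω v).1 : ℕ∞)

/-- The tree in which every node `v` has `f v` children: `v` is present if each step on the path to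
it from the root leads to an existing child. -/
def treeOfOffspring (f : List ℕ → ℕ∞) : Tree where
  deg v := open Classical in
    if ∀ (u : List ℕ) (i : ℕ), u ++ [i] <+: v → (i : ℕ∞) < f u then f v else 0
  deg_eq_zero v i h := by
    classical
    rw [if_neg]
    intro hv
    rw [if_pos fun u j hu => hv u j (hu.trans (List.prefix_append _ _))] at h
    exact absurd (hv v i (List.prefix_refl _)) (not_lt.2 h)

/-- The modified Galton–Watson tree `T̂`, as a function of the random choices. -/
def modifiedGW (ω : Choices) : Tree := treeOfOffspring (offspring ω)

end

end SimplyGenerated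

/-! The total weight of ordered forests with r trees and m nodes satisfies the Otter–Dwass formula m
· forest(r, m) = r · [x^(m-r)] Φ(x)^m (`mul_forest`); in particular n Z_n = [x^(n-1)] Φ(x)^n.
Prescribing the outdegrees d(u) on a finite top part S that leaves r open positions amounts to
choosing a forest of r trees on the remaining n - |S| nodes (`setWeight_cyl`). Hence the probability
of this event is, up to a factor n / (n - |S|), r times the probability that |S| given entries have
the values d(u) in a random sequence of length n with sum n - 1. In the modified Galton–Watson tree
the spine leaves S through exactly one of the r open positions, and each choice has probability ∏
π_{d(u)} because kπ_k · 1/k = π_k (`choiceMeasure_cyl`). So the entries of the random sequence have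
to become independent with law π.

This is proved without a local limit theorem. The point τ minimizes Φ(z)/z, and the generating
function y of trees satisfies xΦ(y(x)) ≤ y(x), so the Z_n cannot grow more slowly than (Φ(τ)/τ)^n;
supermultiplicativity turns this into a lower bound for all large n with Z_n > 0
(`exists_pow_le_forest`, `nearMaximal_of_forest_ne_zero`). Thus [x^(n-1)] Φ^n is within a factor
e^{o(n)} of its trivial upper bound at τ. Multiplying the weight w_k by e^λ then bounds the
exponential moment of the number of entries k, and Jensen's inequality, with λ of both signs, forces
its mean to be π_k n + o(n) (`tendsto_entryProb_of_exp_moment`). By exchangeability this is the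
limit law of one entry; near-maximality survives the removal of an entry, so several entries follow
by telescoping. If ρ = 0 there is no such τ > 0; there, any M entries equal to k ≥ 1 can be replaced
by heavier entries with the same sum, gaining more than any exponential in M, so almost all entries
are 0.

For ν < 1 the cylinders do not suffice, since the outdegree of one node may tend to infinity. The
event that this outdegree is at least K is evaluated by a finite formula in which the mean entry
(tending to 1) appears; the deficit 1 - μ is exactly the probability of an infinite outdegree
(`sum_mul_forest_shift`, `choiceMeasure_geCyl_eq_ofReal`). As the limit tree has at most one node of
infinite outdegree, these two kinds of events determine weak convergence
(`le_liminf_of_tendsto_cyl`). The claims on τ and the variance come from xΨ'(x) being the variance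
of the tilted law, and the spine is finite for μ < 1 because it reaches level m with probability at
most μ^m. -/

namespace SimplyGenerated

noncomputable section

/-! ### Power coefficients and weights of forests -/

/-- The coefficient of `x ^ s` in `(∑ v_k x ^ k) ^ n`, i.e. the total weight of the sequences of
length `n` with sum `s`. -/
def powCoeff (v : ℕ → ℝ) (n s : ℕ) : ℝ := PowerSeries.coeff s (PowerSeries.mk v ^ n)

/-- The total weight of the ordered forests of `r` trees with `m` nodes. -/
def forest (v : ℕ → ℝ) : ℕ → ℕ → ℝ
  | 0, 0 => 1
  | 0, _ + 1 => 0
  | _ + 1, 0 => 0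
  | r + 1, m + 1 => ∑ k ∈ Finset.range (m + 1), v k * forest v (r + k) m

theorem powCoeff_zero (v : ℕ → ℝ) (s : ℕ) : powCoeff v 0 s = if s = 0 then 1 else 0 := by
  simp [powCoeff, PowerSeries.coeff_one]

theorem powCoeff_succ (v : ℕ → ℝ) (n s : ℕ) :
    powCoeff v (n + 1) s = ∑ k ∈ Finset.range (s + 1), v k * powCoeff v n (s - k) := by
  rw [powCoeff, pow_succ', PowerSeries.coeff_mul,
    Finset.Nat.sum_antidiagonal_eq_sum_range_succ (fun i j =>
      PowerSeries.coeff i (PowerSeries.mk v) * PowerSeries.coeff j (PowerSeries.mk v ^ n))]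
  simp [powCoeff]

theorem powCoeff_add (v : ℕ → ℝ) (n n' s : ℕ) :
    powCoeff v (n + n') s = ∑ k ∈ Finset.range (s + 1), powCoeff v n k * powCoeff v n' (s - k) := by
  rw [powCoeff, pow_add, PowerSeries.coeff_mul,
    Finset.Nat.sum_antidiagonal_eq_sum_range_succ (fun i j =>
      PowerSeries.coeff i (PowerSeries.mk v ^ n) * PowerSeries.coeff j (PowerSeries.mk v ^ n'))]
  rfl

theorem powCoeff_nonneg {v : ℕ → ℝ} (hv : ∀ k, 0 ≤ v k) (n s : ℕ) : 0 ≤ powCoeff v n s := by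
  induction n generalizing s with
  | zero => rw [powCoeff_zero]; split_ifs <;> norm_num
  | succ n ih =>
    rw [powCoeff_succ]
    exact Finset.sum_nonneg fun k _ => mul_nonneg (hv k) (ih _)

theorem powCoeff_mul_le {v : ℕ → ℝ} (hv : ∀ k, 0 ≤ v k) (n n' s s' : ℕ) :
    powCoeff v n s * powCoeff v n' s' ≤ powCoeff v (n + n') (s + s') := by
  rw [powCoeff_add]
  have h := Finset.single_le_sum
    (f := fun k => powCoeff v n k * powCoeff v n' (s + s' - k)) (s := Finset.range (s + s' + 1))
    (fun k _ => mul_nonneg (powCoeff_nonneg hv _ _) (powCoeff_nonneg hv _ _))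
    (Finset.mem_range.2 (by omega : s < s + s' + 1))
  simpa using h

theorem powCoeff_one (v : ℕ → ℝ) (s : ℕ) : powCoeff v 1 s = v s := by
  simp [powCoeff]

theorem pow_le_powCoeff {v : ℕ → ℝ} (hv : ∀ k, 0 ≤ v k) {n s : ℕ} (q : ℕ) :
    powCoeff v n s ^ q ≤ powCoeff v (q * n) (q * s) := by
  induction q with
  | zero => simp [powCoeff_zero]
  | succ q ih =>
    rw [pow_succ, Nat.succ_mul, Nat.succ_mul]
    exact (mul_le_mul_of_nonneg_right ih (powCoeff_nonneg hv _ _)).trans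
      (powCoeff_mul_le hv _ _ _ _)

theorem mul_powCoeff_le {v : ℕ → ℝ} (hv : ∀ k, 0 ≤ v k) (n s k : ℕ) :
    v k * powCoeff v n s ≤ powCoeff v (n + 1) (s + k) := by
  have := powCoeff_mul_le hv 1 n k s
  rwa [powCoeff_one, add_comm 1, add_comm k] at this

/-- Exchangeability: in a random sequence of length n + 1 with sum s each entry has mean s/(n + 1).
Analytically this is the coefficient of (F^(n+1))' = (n + 1) F^n F'. -/
theorem sum_mul_powCoeff (v : ℕ → ℝ) (n s : ℕ) :
    (n + 1 : ℝ) * ∑ k ∈ Finset.range (s + 1), k * (v k * powCoeff v n (s - k)) =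
      s * powCoeff v (n + 1) s := by
  rcases s with _ | t
  · simp
  · have h := PowerSeries.coeff_derivative (PowerSeries.mk v ^ (n + 1)) t
    rw [PowerSeries.derivative_pow, Nat.add_sub_cancel] at h
    have h2 : PowerSeries.coeff t (((n + 1 : ℕ) : PowerSeries ℝ) * PowerSeries.mk v ^ n *
        PowerSeries.derivative ℝ (PowerSeries.mk v)) =
        (n + 1 : ℝ) * PowerSeries.coeff t (PowerSeries.derivative ℝ (PowerSeries.mk v) *
          PowerSeries.mk v ^ n) := by
      rw [← PowerSeries.coeff_C_mul]
      congr 1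
      rw [mul_comm (PowerSeries.derivative ℝ (PowerSeries.mk v)), ← mul_assoc]
      congr 2
      simp
    rw [h2, PowerSeries.coeff_mul,
      Finset.Nat.sum_antidiagonal_eq_sum_range_succ (fun i j =>
        PowerSeries.coeff i (PowerSeries.derivative ℝ (PowerSeries.mk v)) *
          PowerSeries.coeff j (PowerSeries.mk v ^ n))] at h
    rw [Finset.sum_range_succ']
    simp only [PowerSeries.coeff_derivative, PowerSeries.coeff_mk] at h
    push_cast
    rw [mul_comm ((t : ℝ) + 1), powCoeff.eq_1 v (n + 1), ← h]
    congr 1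
    simp only [zero_mul, add_zero]
    refine Finset.sum_congr rfl fun i _ => ?_
    rw [powCoeff]
    ring

theorem forest_eq_zero (v : ℕ → ℝ) {r m : ℕ} (h : m < r) : forest v r m = 0 := by
  induction m generalizing r with
  | zero =>
    obtain ⟨r, rfl⟩ := Nat.exists_eq_succ_of_ne_zero h.ne'
    simp [forest]
  | succ m ih =>
    obtain ⟨r, rfl⟩ := Nat.exists_eq_succ_of_ne_zero (Nat.ne_zero_of_lt h)
    rw [Nat.succ_eq_add_one, forest]
    exact Finset.sum_eq_zero fun k _ => by rw [ih (by omega), mul_zero]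

theorem forest_nonneg {v : ℕ → ℝ} (hv : ∀ k, 0 ≤ v k) (r m : ℕ) : 0 ≤ forest v r m := by
  induction m generalizing r with
  | zero => rcases r with _ | r <;> simp [forest]
  | succ m ih =>
    rcases r with _ | r
    · simp [forest]
    · rw [forest]
      exact Finset.sum_nonneg fun k _ => mul_nonneg (hv k) (ih _)

/-- The number of forests in terms of the number of sequences. -/
theorem mul_forest (v : ℕ → ℝ) {r m : ℕ} (h : r ≤ m) :
    m * forest v r m = r * powCoeff v m (m - r) := by
  induction m generalizing r with
  | zero => simp [Nat.le_zero.1 h]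
  | succ m ih =>
    rcases r with _ | r
    · simp [forest]
    rw [Nat.add_sub_add_right]
    have hr : r ≤ m := by omega
    rw [forest]
    rcases Nat.eq_zero_or_pos m with rfl | hm
    · obtain rfl : r = 0 := by omega
      simp [forest, powCoeff_one]
    have h1 : ∑ k ∈ Finset.range (m + 1), v k * forest v (r + k) m =
        ∑ k ∈ Finset.range (m - r + 1), v k * forest v (r + k) m := by
      refine (Finset.sum_subset (Finset.range_mono (by omega)) fun k _ hk => ?_).symm
      rw [forest_eq_zero, mul_zero]
      simp only [Finset.mem_range] at hk
      omega
    rw [h1]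
    -- The induction hypothesis brings in the factor r + k. The part r sums to a coefficient of the
    -- next power, and the part k is the mean of an entry, known from `sum_mul_powCoeff`.
    have h2 : (m : ℝ) * ∑ k ∈ Finset.range (m - r + 1), v k * forest v (r + k) m =
        r * powCoeff v (m + 1) (m - r) +
          ∑ k ∈ Finset.range (m - r + 1), k * (v k * powCoeff v m (m - r - k)) := by
      rw [powCoeff_succ, Finset.mul_sum, Finset.mul_sum, ← Finset.sum_add_distrib]
      refine Finset.sum_congr rfl fun k hk => ?_
      have hk' : r + k ≤ m := by
        simp only [Finset.mem_range] at hk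
        omega
      have := ih hk'
      rw [Nat.sub_sub, mul_left_comm, this]
      push_cast
      ring
    have h3 := sum_mul_powCoeff v m (m - r)
    have hm' : (m : ℝ) ≠ 0 := by positivity
    rw [Nat.cast_sub hr] at h3
    apply mul_left_cancel₀ hm'
    push_cast
    linear_combination ((m : ℝ) + 1) * h2 + h3

theorem mul_forest_one (v : ℕ → ℝ) {n : ℕ} (hn : 0 < n) :
    n * forest v 1 n = powCoeff v n (n - 1) := by
  simpa using mul_forest v (r := 1) (m := n) hn

theorem forest_add (v : ℕ → ℝ) (r s m : ℕ) :
    forest v (r + s) m =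
      ∑ p ∈ Finset.HasAntidiagonal.antidiagonal m, forest v r p.1 * forest v s p.2 := by
  induction m generalizing r with
  | zero =>
    rcases r with _ | r
    · simp [forest]
    · rw [show r + 1 + s = (r + s) + 1 by ring]
      simp [forest]
  | succ m ih =>
    rw [Finset.Nat.antidiagonal_succ, Finset.sum_cons, Finset.sum_map]
    rcases r with _ | r
    · simp [forest]
    · rw [show r + 1 + s = (r + s) + 1 by ring, forest]
      simp only [Function.Embedding.prodMap, Function.Embedding.coeFn_mk, Prod.map, forest]
      have h1 : ∀ k, forest v (r + s + k) m =
          ∑ p ∈ Finset.HasAntidiagonal.antidiagonal m, forest v (r + k) p.1 * forest v s p.2 := by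
        intro k
        rw [← ih, add_right_comm]
      simp only [h1, zero_mul, zero_add, Finset.mul_sum, Finset.sum_mul]
      rw [Finset.sum_comm]
      refine Finset.sum_congr rfl fun p hp => ?_
      simp only [Function.Embedding.refl_apply]
      rw [← Finset.sum_subset (Finset.range_mono (by
        have := Finset.HasAntidiagonal.mem_antidiagonal.1 hp; omega : p.1 + 1 ≤ m + 1))]
      · exact Finset.sum_congr rfl fun k _ => by ring
      · intro k _ hk
        simp only [Finset.mem_range] at hk
        rw [forest_eq_zero v (by omega : p.1 < r + k)]
        ring

/-- Replacing the last leaf by a tree. -/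
theorem forest_mul_forest_le {v : ℕ → ℝ} (hv : ∀ k, 0 ≤ v k) (r m n : ℕ) :
    forest v (r + 1) (m + 1) * forest v 1 (n + 1) ≤ v 0 * forest v (r + 1) (m + n + 1) := by
  induction m generalizing r with
  | zero =>
    rcases r with _ | r
    · simp [forest]
    · rw [forest_eq_zero v (by omega : 0 + 1 < r + 1 + 1), zero_mul]
      exact mul_nonneg (hv 0) (forest_nonneg hv _ _)
  | succ m ih =>
    rw [forest, forest.eq_4 v r, Finset.sum_mul, Finset.mul_sum]
    refine (Finset.sum_le_sum (g := fun k => v 0 * (v k * forest v (r + k) (m + 1 + n))) ?_).trans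
      (Finset.sum_le_sum_of_subset_of_nonneg (Finset.range_mono (by omega)) fun k _ _ =>
        mul_nonneg (hv 0) (mul_nonneg (hv k) (forest_nonneg hv _ _)))
    intro k _
    rcases hk : r + k with _ | q
    · simp only [forest, mul_zero, zero_mul]
      exact mul_nonneg (hv 0) (mul_nonneg (hv k) (forest_nonneg hv _ _))
    · have := mul_le_mul_of_nonneg_left (ih q) (hv k)
      rw [show m + 1 + n = m + n + 1 by ring]
      linarith

/-! ### Ratio limits for power coefficients -/

theorem sum_mul_add_pow {R : Type*} [CommSemiring R] (x y : R) (n : ℕ) :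
    ∑ j ∈ Finset.range (n + 2), (j : R) * (x ^ j * y ^ (n + 1 - j) * ((n + 1).choose j : R)) =
      (n + 1 : R) * (x * (x + y) ^ n) := by
  rw [Finset.sum_range_succ', add_pow, Finset.mul_sum, Finset.mul_sum]
  simp only [Nat.cast_zero, zero_mul, add_zero]
  refine Finset.sum_congr rfl fun j _ => ?_
  have h : ((n : R) + 1) * (n.choose j : R) = ((n + 1).choose (j + 1) : R) * ((j : R) + 1) := by
    exact_mod_cast congrArg (Nat.cast (R := R)) (Nat.add_one_mul_choose_eq n j)
  rw [Nat.add_sub_add_right]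
  push_cast
  calc ((j : R) + 1) * (x ^ (j + 1) * y ^ (n - j) * ((n + 1).choose (j + 1) : R))
      = x ^ (j + 1) * y ^ (n - j) * (((n + 1).choose (j + 1) : R) * ((j : R) + 1)) := by ring
    _ = _ := by rw [← h]; ring

theorem mk_update (v : ℕ → ℝ) (k : ℕ) (c : ℝ) :
    PowerSeries.mk (Function.update v k c) =
      PowerSeries.monomial k c + PowerSeries.mk (Function.update v k 0) := by
  ext j
  rw [map_add, PowerSeries.coeff_mk, PowerSeries.coeff_mk, PowerSeries.coeff_monomial]
  by_cases h : j = k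
  · subst h; simp
  · simp [h]

theorem coeff_monomial_mul (k s : ℕ) (c : ℝ) (f : PowerSeries ℝ) :
    PowerSeries.coeff s (PowerSeries.monomial k c * f) =
      if k ≤ s then c * PowerSeries.coeff (s - k) f else 0 := by
  have : PowerSeries.monomial k c = PowerSeries.C c * PowerSeries.X ^ k := by
    ext i
    rw [PowerSeries.coeff_C_mul, PowerSeries.coeff_monomial, PowerSeries.coeff_X_pow]
    split_ifs <;> simp
  rw [this, mul_assoc, PowerSeries.coeff_C_mul, PowerSeries.coeff_X_pow_mul']
  split_ifs <;> simp

theorem coeff_monomial_pow_mul_nonneg {v : ℕ → ℝ} (hv : ∀ k, 0 ≤ v k) (n s k j : ℕ) :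
    0 ≤ PowerSeries.coeff s (PowerSeries.monomial k (v k) ^ j *
      PowerSeries.mk (Function.update v k 0) ^ (n - j) * (n.choose j : PowerSeries ℝ)) := by
  rw [mul_comm, ← map_natCast (PowerSeries.C (R := ℝ)),
    PowerSeries.coeff_C_mul, PowerSeries.monomial_pow, coeff_monomial_mul]
  refine mul_nonneg (by positivity) ?_
  split_ifs
  · exact mul_nonneg (pow_nonneg (hv k) _) (powCoeff_nonneg (fun i => by
      rcases eq_or_ne i k with rfl | h
      · simp
      · simpa [h] using hv i) _ _)
  · exact le_rfl

/-- A tangent line bound: the exponential moment of the number of entries `k` in a random sequence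
is bounded below in terms of its mean. -/
theorem powCoeff_mul_exp_le {v : ℕ → ℝ} (hv : ∀ k, 0 ≤ v k) {n s k : ℕ} (hk : k ≤ s)
    (hpos : 0 < powCoeff v (n + 1) s) (lam : ℝ) :
    powCoeff v (n + 1) s *
        Real.exp (lam * ((n + 1) * (v k * powCoeff v n (s - k) / powCoeff v (n + 1) s))) ≤
      powCoeff (Function.update v k (Real.exp lam * v k)) (n + 1) s := by
  -- The number `b j` is the total weight of the sequences with exactly j entries equal to k.
  set b : ℕ → ℝ := fun j => PowerSeries.coeff s (PowerSeries.monomial k (v k) ^ j *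
      PowerSeries.mk (Function.update v k 0) ^ (n + 1 - j) *
        ((n + 1).choose j : PowerSeries ℝ)) with hb
  have hb0 : ∀ j, 0 ≤ b j := fun j => coeff_monomial_pow_mul_nonneg hv (n + 1) s k j
  have hf : ∀ θ : ℝ, powCoeff (Function.update v k (θ * v k)) (n + 1) s =
      ∑ j ∈ Finset.range (n + 2), θ ^ j * b j := by
    intro θ
    rw [powCoeff, mk_update, add_pow, map_sum]
    refine Finset.sum_congr rfl fun j _ => ?_
    have : PowerSeries.monomial (R := ℝ) k (θ * v k) =
        PowerSeries.C θ * PowerSeries.monomial k (v k) := by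
      ext i
      rw [PowerSeries.coeff_C_mul, PowerSeries.coeff_monomial, PowerSeries.coeff_monomial]
      split_ifs <;> simp
    rw [this, mul_pow, mul_assoc, mul_assoc, ← map_pow, PowerSeries.coeff_C_mul, ← mul_assoc]
  have hf1 : powCoeff v (n + 1) s = ∑ j ∈ Finset.range (n + 2), b j := by
    have := hf 1
    simpa using this
  have hmean : ∑ j ∈ Finset.range (n + 2), j * b j =
      (n + 1) * (v k * powCoeff v n (s - k)) := by
    have h1 := congrArg (PowerSeries.coeff (R := ℝ) s) (sum_mul_add_pow
      (PowerSeries.monomial k (v k)) (PowerSeries.mk (Function.update v k 0)) n)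
    rw [← mk_update, Function.update_eq_self, map_sum] at h1
    rw [show ((n : PowerSeries ℝ) + 1) = PowerSeries.C ((n : ℝ) + 1) by simp,
      PowerSeries.coeff_C_mul, coeff_monomial_mul, if_pos hk] at h1
    rw [powCoeff, ← h1]
    refine Finset.sum_congr rfl fun j _ => ?_
    rw [← map_natCast (PowerSeries.C (R := ℝ)) j, PowerSeries.coeff_C_mul]
  set X : ℝ := (n + 1) * (v k * powCoeff v n (s - k) / powCoeff v (n + 1) s) with hX
  have hX' : X * powCoeff v (n + 1) s = ∑ j ∈ Finset.range (n + 2), j * b j := by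
    rw [hmean, hX]
    field_simp
  rw [hf]
  -- Jensen's inequality through the tangent of the exponential at X: since X is the mean of j under
  -- the weights b, the linear term drops out after summation.
  have key : ∀ j ∈ Finset.range (n + 2),
      Real.exp (lam * X) * (1 + lam * (j - X)) * b j ≤ Real.exp lam ^ j * b j := by
    intro j _
    refine mul_le_mul_of_nonneg_right ?_ (hb0 j)
    rw [← Real.exp_nat_mul]
    calc Real.exp (lam * X) * (1 + lam * (j - X))
        ≤ Real.exp (lam * X) * Real.exp (lam * (j - X)) := by
          refine mul_le_mul_of_nonneg_left ?_ (Real.exp_pos _).le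
          linarith [Real.add_one_le_exp (lam * (j - X))]
      _ = _ := by rw [← Real.exp_add]; congr 1; ring
  refine le_trans (le_of_eq ?_) (Finset.sum_le_sum key)
  have : ∀ j : ℕ, Real.exp (lam * X) * (1 + lam * (j - X)) * b j =
      Real.exp (lam * X) * (1 - lam * X) * b j + Real.exp (lam * X) * lam * (j * b j) := by
    intro j; ring
  simp only [this]
  rw [Finset.sum_add_distrib, ← Finset.mul_sum, ← Finset.mul_sum, ← hf1, ← hX']
  ring

/-- A single coefficient of a series with non-negative terms is at most the value of the series;
this is the trivial upper bound against which near-maximality is measured. -/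
theorem powCoeff_mul_pow_le {v : ℕ → ℝ} (hv : ∀ k, 0 ≤ v k) {t : ℝ} (ht : 0 ≤ t)
    (hs : Summable fun k => v k * t ^ k) (n s : ℕ) :
    powCoeff v n s * t ^ s ≤ (∑' k, v k * t ^ k) ^ n := by
  induction n generalizing s with
  | zero =>
    rw [powCoeff_zero]
    split_ifs with h
    · simp [h]
    · simp
  | succ n ih =>
    rw [powCoeff_succ, Finset.sum_mul, pow_succ']
    have h0 : 0 ≤ (∑' k, v k * t ^ k) ^ n :=
      pow_nonneg (tsum_nonneg fun k => mul_nonneg (hv k) (pow_nonneg ht _)) _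
    calc ∑ k ∈ Finset.range (s + 1), v k * powCoeff v n (s - k) * t ^ s
        ≤ ∑ k ∈ Finset.range (s + 1), v k * t ^ k * (∑' k, v k * t ^ k) ^ n := by
          refine Finset.sum_le_sum fun k hk => ?_
          have hk' : k ≤ s := by simp only [Finset.mem_range] at hk; omega
          calc v k * powCoeff v n (s - k) * t ^ s
              = v k * t ^ k * (powCoeff v n (s - k) * t ^ (s - k)) := by
                rw [← Nat.add_sub_cancel' hk', pow_add]
                simp only [Nat.add_sub_cancel_left]
                ring
            _ ≤ _ := mul_le_mul_of_nonneg_left (ih _) (mul_nonneg (hv k) (pow_nonneg ht _))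
      _ = (∑ k ∈ Finset.range (s + 1), v k * t ^ k) * (∑' k, v k * t ^ k) ^ n := by
          rw [Finset.sum_mul]
      _ ≤ _ := mul_le_mul_of_nonneg_right
          (hs.sum_le_tsum _ fun k _ => mul_nonneg (hv k) (pow_nonneg ht _)) h0

/-- The probability that the first entry is `k` in a random sequence of length `n` with sum `s`. -/
def entryProb (v : ℕ → ℝ) (k n s : ℕ) : ℝ := v k * powCoeff v (n - 1) (s - k) / powCoeff v n s

/-- By `powCoeff_mul_exp_le` and the hypothesis, the probability q of an entry k satisfies λq ≤
p(e^λ - 1) + η. For small λ > 0 this bounds q from above, and for small λ < 0 from below. Only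
exponential precision of the moment is needed, as the number of entries has already been divided by
n. -/
theorem tendsto_entryProb_of_exp_moment {ι : Type*} {l : Filter ι} {v : ℕ → ℝ} (hv : ∀ k, 0 ≤ v k)
    {k : ℕ} {n s : ι → ℕ} {p : ℝ} (hp1 : p ≤ 1)
    (hn : Tendsto n l atTop) (hs : Tendsto s l atTop) (hpos : ∀ᶠ i in l, 0 < powCoeff v (n i) (s i))
    (H : ∀ lam : ℝ, ∀ η > 0, ∀ᶠ i in l,
      powCoeff (Function.update v k (Real.exp lam * v k)) (n i) (s i) ≤
        powCoeff v (n i) (s i) * Real.exp (n i * (p * (Real.exp lam - 1) + η))) :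
    Tendsto (fun i => entryProb v k (n i) (s i)) l (𝓝 p) := by
  have main : ∀ lam : ℝ, lam ≠ 0 → |lam| ≤ 1 → ∀ᶠ i in l,
      lam * entryProb v k (n i) (s i) ≤ lam * p + 2 * lam ^ 2 := by
    intro lam h0 h1
    -- The error η = λ² is of the same order as e^λ - 1 - λ, so that both vanish relative to λ.
    filter_upwards [H lam (lam ^ 2) (by positivity), hpos, hs.eventually_ge_atTop k,
      hn.eventually_ge_atTop 1] with i hi hpi hki hni
    obtain ⟨m, hm⟩ : ∃ m, n i = m + 1 := ⟨n i - 1, by omega⟩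
    rw [hm] at hi hpi
    have h2 := (powCoeff_mul_exp_le hv hki hpi lam).trans hi
    have h3 := Real.exp_le_exp.1 (le_of_mul_le_mul_left h2 hpi)
    rw [entryProb, hm, Nat.add_sub_cancel]
    push_cast at h3
    have hm0 : (0 : ℝ) < m + 1 := by positivity
    have h4 := Real.abs_exp_sub_one_sub_id_le h1
    have h5 : Real.exp lam - 1 - lam ≤ lam ^ 2 := (le_abs_self _).trans h4
    have h6 : 0 ≤ Real.exp lam - 1 - lam := by linarith [Real.add_one_le_exp lam]
    have h7 : p * (Real.exp lam - 1 - lam) ≤ lam ^ 2 := by nlinarith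
    rw [mul_left_comm] at h3
    have h8 := le_of_mul_le_mul_left h3 hm0
    nlinarith
  rw [Metric.tendsto_nhds]
  intro ε hε
  set d := min (ε / 3) 1 with hd
  have hd0 : 0 < d := by positivity
  have hd1 : d ≤ 1 := min_le_right _ _
  have hd3 : d ≤ ε / 3 := min_le_left _ _
  filter_upwards [main d hd0.ne' (by rwa [abs_of_pos hd0]),
    main (-d) (by linarith) (by rwa [abs_neg, abs_of_pos hd0])] with i h1 h2
  rw [Real.dist_eq, abs_lt]
  constructor <;> nlinarith

/-- Along `(n, s)`, the power coefficients are subexponentially close to their upper bound at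
`t`. -/
structure NearMaximal {ι : Type*} (l : Filter ι) (v : ℕ → ℝ) (t : ℝ) (n s : ι → ℕ) : Prop where
  tendsto_length : Tendsto n l atTop
  tendsto_sum : Tendsto s l atTop
  lower : ∀ η > 0, ∀ᶠ i in l, Real.exp (-(η * n i)) * (∑' k, v k * t ^ k) ^ n i ≤
    powCoeff v (n i) (s i) * t ^ s i

theorem NearMaximal.pos {ι : Type*} {l : Filter ι} {v : ℕ → ℝ} {t : ℝ} (ht : 0 < t)
    (hPhi : 0 < ∑' k, v k * t ^ k) {n s : ι → ℕ} (h : NearMaximal l v t n s) :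
    ∀ᶠ i in l, 0 < powCoeff v (n i) (s i) := by
  filter_upwards [h.lower 1 one_pos] with i hi
  exact pos_of_mul_pos_left ((mul_pos (Real.exp_pos _) (pow_pos hPhi _)).trans_le hi)
    (pow_nonneg ht.le _)

/-- The upper bound at t for the modified weights, divided by the near-maximal lower bound for the
original ones, controls the exponential moment: the value Z of the series changes to Z(1 + p(e^λ -
1)) with p = v_k t^k / Z, which is at most Z exp(p(e^λ - 1)). -/
theorem NearMaximal.tendsto_entryProb {ι : Type*} {l : Filter ι} {v : ℕ → ℝ} (hv : ∀ k, 0 ≤ v k)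
    {t : ℝ} (ht : 0 < t) (hsum : Summable fun k => v k * t ^ k)
    (hPhi : 0 < ∑' k, v k * t ^ k) {n s : ι → ℕ} (h : NearMaximal l v t n s) (k : ℕ) :
    Tendsto (fun i => entryProb v k (n i) (s i)) l (𝓝 (v k * t ^ k / ∑' k, v k * t ^ k)) := by
  set Z := ∑' k, v k * t ^ k with hZ
  refine tendsto_entryProb_of_exp_moment hv ?_ h.tendsto_length h.tendsto_sum (h.pos ht hPhi) ?_
  · rw [div_le_one hPhi]
    exact hsum.le_tsum k fun j _ => mul_nonneg (hv j) (by positivity)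
  · intro lam η hη
    filter_upwards [h.lower η hη] with i hi
    have hv' : ∀ j, 0 ≤ Function.update v k (Real.exp lam * v k) j := by
      intro j
      rcases eq_or_ne j k with rfl | h
      · simpa using mul_nonneg (Real.exp_pos _).le (hv _)
      · simpa [h] using hv j
    have hsum' : HasSum (fun j => Function.update v k (Real.exp lam * v k) j * t ^ j)
        (Real.exp lam * v k * t ^ k - v k * t ^ k + Z) := by
      have := hsum.hasSum.update k (Real.exp lam * v k * t ^ k)
      convert! this using 1
      ext j
      rcases eq_or_ne j k with rfl | h
      · simp
      · simp [h]
    have h1 := powCoeff_mul_pow_le hv' ht.le hsum'.summable (n i) (s i)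
    rw [hsum'.tsum_eq] at h1
    have h2 : Real.exp lam * v k * t ^ k - v k * t ^ k + Z ≤
        Z * Real.exp (v k * t ^ k / Z * (Real.exp lam - 1)) := by
      have := Real.add_one_le_exp (v k * t ^ k / Z * (Real.exp lam - 1))
      have h3 := mul_le_mul_of_nonneg_left this hPhi.le
      refine le_trans (le_of_eq ?_) h3
      field_simp
    have h0 : 0 ≤ Real.exp lam * v k * t ^ k - v k * t ^ k + Z := by
      rw [← hsum'.tsum_eq]
      exact tsum_nonneg fun j => mul_nonneg (hv' j) (by positivity)
    have h4 := h1.trans (pow_le_pow_left₀ h0 h2 (n i))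
    rw [mul_pow, ← Real.exp_nat_mul] at h4
    have h5 : Z ^ n i ≤ powCoeff v (n i) (s i) * t ^ s i * Real.exp (η * n i) := by
      calc Z ^ n i = Real.exp (-(η * n i)) * Z ^ n i * Real.exp (η * n i) := by
            rw [mul_right_comm, ← Real.exp_add]; simp
        _ ≤ _ := mul_le_mul_of_nonneg_right hi (Real.exp_pos _).le
    have h6 := h4.trans (mul_le_mul_of_nonneg_right h5 (Real.exp_pos _).le)
    have hts : 0 < t ^ s i := by positivity
    refine le_of_mul_le_mul_right (h6.trans (le_of_eq ?_)) hts
    rw [mul_add, Real.exp_add, mul_comm η]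
    ring

/-- An entry k has a positive limiting probability, so removing it costs only a bounded factor,
which subexponential precision ignores. -/
theorem NearMaximal.step {ι : Type*} {l : Filter ι} {v : ℕ → ℝ} (hv : ∀ k, 0 ≤ v k)
    {t : ℝ} (ht : 0 < t) (hsum : Summable fun k => v k * t ^ k)
    (hPhi : 0 < ∑' k, v k * t ^ k) {n s : ι → ℕ} (h : NearMaximal l v t n s) {k : ℕ}
    (hk : 0 < v k) : NearMaximal l v t (fun i => n i - 1) (fun i => s i - k) := by
  have hlim := h.tendsto_entryProb hv ht hsum hPhi k
  set Z := ∑' k, v k * t ^ k with hZ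
  have hp : 0 < v k * t ^ k / Z := by positivity
  refine ⟨(tendsto_sub_atTop_nat 1).comp h.tendsto_length,
    (tendsto_sub_atTop_nat k).comp h.tendsto_sum, fun η hη => ?_⟩
  -- Passing from η/2 to η yields an exponential gain, which pays for the factor 2 lost by bounding
  -- the probability of an entry k below by half its limit.
  have hexp : ∀ᶠ i in l, 2 ≤ Real.exp (η * (n i - 1 : ℕ) - η / 2 * n i) := by
    have h1 : Tendsto (fun i => (n i : ℝ)) l atTop :=
      tendsto_natCast_atTop_atTop.comp h.tendsto_length
    filter_upwards [h1.eventually_ge_atTop ((1 + η) / (η / 2)), h.tendsto_length.eventually_ge_atTop 1]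
      with i hi hi1
    rw [div_le_iff₀ (by positivity)] at hi
    push_cast [Nat.cast_sub hi1]
    have := Real.add_one_le_exp (η * (n i - 1) - η / 2 * n i)
    linarith
  filter_upwards [h.lower (η / 2) (by positivity), hlim.eventually (lt_mem_nhds (half_lt_self hp)),
    h.pos ht hPhi, h.tendsto_sum.eventually_ge_atTop k, h.tendsto_length.eventually_ge_atTop 1, hexp]
    with i h1 h2 h3 h4 h5 h6
  rw [entryProb, lt_div_iff₀ h3] at h2
  obtain ⟨m, hm⟩ : ∃ m, n i = m + 1 := ⟨n i - 1, by omega⟩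
  obtain ⟨q, hq⟩ : ∃ q, s i = q + k := ⟨s i - k, by omega⟩
  simp only [hm, hq, Nat.add_sub_cancel] at *
  have hc : 0 < v k * t ^ k := by positivity
  have h7 : v k * t ^ k / Z / 2 * (Real.exp (-(η / 2 * (m + 1 : ℕ))) * Z ^ (m + 1)) ≤
      v k * t ^ k * (powCoeff v m q * t ^ q) := by
    calc _ ≤ v k * t ^ k / Z / 2 * (powCoeff v (m + 1) (q + k) * t ^ (q + k)) :=
          mul_le_mul_of_nonneg_left h1 (by positivity)
      _ = v k * t ^ k / Z / 2 * powCoeff v (m + 1) (q + k) * t ^ (q + k) := by ring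
      _ ≤ v k * powCoeff v m q * t ^ (q + k) := mul_le_mul_of_nonneg_right h2.le (by positivity)
      _ = _ := by rw [pow_add]; ring
  have h8 : v k * t ^ k / Z / 2 * (Real.exp (-(η / 2 * (m + 1 : ℕ))) * Z ^ (m + 1)) =
      v k * t ^ k * (Real.exp (-(η / 2 * (m + 1 : ℕ))) / 2 * Z ^ m) := by
    field_simp
    ring
  rw [h8] at h7
  refine le_trans ?_ (le_of_mul_le_mul_left h7 hc)
  refine mul_le_mul_of_nonneg_right ?_ (by positivity)
  rw [le_div_iff₀ two_pos]
  calc Real.exp (-(η * m)) * 2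
      ≤ Real.exp (-(η * m)) * Real.exp (η * m - η / 2 * (m + 1 : ℕ)) :=
        mul_le_mul_of_nonneg_left h6 (Real.exp_pos _).le
    _ = _ := by rw [← Real.exp_add]; congr 1; ring

/-! ### Weights with zero radius of convergence -/

theorem powCoeff_mono {v v' : ℕ → ℝ} (hv : ∀ k, 0 ≤ v k) (h : ∀ k, v k ≤ v' k) (n s : ℕ) :
    powCoeff v n s ≤ powCoeff v' n s := by
  induction n generalizing s with
  | zero => simp [powCoeff_zero]
  | succ n ih =>
    rw [powCoeff_succ, powCoeff_succ]
    exact Finset.sum_le_sum fun k _ => mul_le_mul (h k) (ih _) (powCoeff_nonneg hv _ _)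
      ((hv k).trans (h k))

/-- With M₀ such that v_{M₀} is huge, k entries M₀ and M₀ - k zeros form a block with M₀ entries and
sum M₀k. Its weight is at least B^{M₀}. Such blocks are repeated, and the fewer than M₀ remaining
entries are taken equal to k. -/
theorem exists_mul_pow_le_powCoeff {v : ℕ → ℝ} (hv : ∀ k, 0 ≤ v k) (hv0 : 0 < v 0)
    (hrad : ∀ B : ℝ, ∃ᶠ M in atTop, B ^ M ≤ v M) {k : ℕ} (hk : 1 ≤ k) (hvk : 0 < v k) {B : ℝ}
    (hB : 0 < B) : ∃ c > 0, ∀ M, c * B ^ M ≤ powCoeff v M (M * k) := by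
  set a := min (v 0) 1 with ha
  have ha0 : 0 < a := lt_min hv0 one_pos
  -- The choice C ≥ B/a compensates for the weights of the zeros. The choice C ≥ 1 gives v_{M₀} ≥ 1,
  -- so that v_{M₀}^k may be bounded below by v_{M₀}.
  set C := max (B / a) 1 with hC
  obtain ⟨M0, hM0, hM0k⟩ := ((hrad C).and_eventually (eventually_ge_atTop (k + 1))).exists
  have hblock : B ^ M0 ≤ powCoeff v M0 (M0 * k) := by
    have h1 := powCoeff_mul_le hv (k * 1) ((M0 - k) * 1) (k * M0) ((M0 - k) * 0)
    have h2 := pow_le_powCoeff hv (n := 1) (s := M0) k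
    have h3 := pow_le_powCoeff hv (n := 1) (s := 0) (M0 - k)
    rw [powCoeff_one] at h2 h3
    have h4 : k * 1 + (M0 - k) * 1 = M0 := by omega
    have h5 : k * M0 + (M0 - k) * 0 = M0 * k := by rw [mul_zero, add_zero, mul_comm]
    rw [h4, h5] at h1
    refine le_trans ?_ h1
    have hC1 : 1 ≤ C := le_max_right _ _
    have hCB : B ≤ C * a := by
      rw [← div_le_iff₀ ha0]; exact le_max_left _ _
    calc B ^ M0 ≤ (C * a) ^ M0 := pow_le_pow_left₀ hB.le hCB _
      _ = C ^ M0 * a ^ M0 := mul_pow _ _ _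
      _ ≤ v M0 ^ k * v 0 ^ (M0 - k) := by
          refine mul_le_mul ?_ ?_ (by positivity) (pow_nonneg (hv _) _)
          · have h6 : 1 ≤ v M0 := (one_le_pow₀ hC1).trans hM0
            exact hM0.trans (le_self_pow₀ h6 (by omega))
          · calc a ^ M0 ≤ a ^ (M0 - k) :=
                  pow_le_pow_of_le_one ha0.le (min_le_right _ _) (Nat.sub_le _ _)
              _ ≤ _ := pow_le_pow_left₀ ha0.le (min_le_left _ _) _
      _ ≤ _ := mul_le_mul h2 h3 (pow_nonneg hv0.le _) (powCoeff_nonneg hv _ _)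
  refine ⟨min 1 (v k / B) ^ M0, by positivity, fun M => ?_⟩
  have h1 := powCoeff_mul_le hv (M / M0 * M0) (M % M0 * 1) (M / M0 * (M0 * k)) (M % M0 * k)
  have h2 := pow_le_powCoeff hv (n := M0) (s := M0 * k) (M / M0)
  have h3 := pow_le_powCoeff hv (n := 1) (s := k) (M % M0)
  rw [powCoeff_one] at h3
  have h4 : M / M0 * M0 + M % M0 * 1 = M := by rw [mul_one]; exact Nat.div_add_mod' M M0
  have h5 : M / M0 * (M0 * k) + M % M0 * k = M * k := by
    rw [← mul_assoc, ← add_mul, Nat.div_add_mod']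
  rw [h4, h5] at h1
  refine le_trans ?_ (le_trans (mul_le_mul ((pow_le_pow_left₀ (by positivity) hblock _).trans h2) h3
    (by positivity) (powCoeff_nonneg hv _ _)) h1)
  have h6 : min 1 (v k / B) ^ M0 ≤ (v k / B) ^ (M % M0) :=
    (pow_le_pow_of_le_one (by positivity) (min_le_left _ _)
      (Nat.mod_lt M (by omega : M0 > 0)).le).trans
      (pow_le_pow_left₀ (by positivity) (min_le_right _ _) _)
  calc min 1 (v k / B) ^ M0 * B ^ M ≤ (v k / B) ^ (M % M0) * B ^ M :=
        mul_le_mul_of_nonneg_right h6 (by positivity)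
    _ = (B ^ M0) ^ (M / M0) * v k ^ (M % M0) := by
        conv_lhs => rw [← Nat.div_add_mod M M0, pow_add, pow_mul, Nat.div_add_mod]
        rw [div_pow]
        field_simp

/-- Expanding the product marks M of the entries k with weight δv_k each. Replacing the marked
entries by all sequences of length M with sum Mk gains at least cB^M, so the expansion is dominated
by (1 + δv_k/B)^n / c times the original coefficient. -/
theorem powCoeff_update_le {v : ℕ → ℝ} (hv : ∀ k, 0 ≤ v k) {k : ℕ} {B c δ : ℝ} (hB : 0 < B)
    (hc : 0 < c) (hδ : 0 ≤ δ) (h : ∀ M, c * B ^ M ≤ powCoeff v M (M * k)) (n s : ℕ) :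
    powCoeff (Function.update v k ((1 + δ) * v k)) n s ≤
      powCoeff v n s * (Real.exp (n * (δ * v k / B)) / c) := by
  have h1 : PowerSeries.mk (Function.update v k ((1 + δ) * v k)) =
      PowerSeries.monomial k (δ * v k) + PowerSeries.mk v := by
    rw [mk_update]
    conv_rhs => rw [← Function.update_eq_self k v, mk_update, ← add_assoc, ← map_add]
    rw [Function.update_self]
    congr 2
    ring
  rw [powCoeff, h1, add_pow, map_sum]
  have h2 : ∀ M ∈ Finset.range (n + 1), PowerSeries.coeff s
      (PowerSeries.monomial k (δ * v k) ^ M * PowerSeries.mk v ^ (n - M) *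
        (n.choose M : PowerSeries ℝ)) ≤
      powCoeff v n s / c * ((δ * v k / B) ^ M * 1 ^ (n - M) * (n.choose M : ℝ)) := by
    intro M hM
    have hMn : M ≤ n := by simp only [Finset.mem_range] at hM; omega
    rw [mul_comm, ← map_natCast (PowerSeries.C (R := ℝ)), PowerSeries.coeff_C_mul,
      PowerSeries.monomial_pow, coeff_monomial_mul, one_pow, mul_one,
      mul_comm _ (n.choose M : ℝ), mul_left_comm]
    refine mul_le_mul_of_nonneg_left ?_ (by positivity)
    split_ifs with hs
    · have h3 := (mul_le_mul_of_nonneg_right (h M) (powCoeff_nonneg hv (n - M) (s - M * k))).trans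
        (powCoeff_mul_le hv _ _ _ _)
      rw [Nat.add_sub_cancel' hMn, Nat.add_sub_cancel' hs] at h3
      have h4 : (δ * v k) ^ M * powCoeff v (n - M) (s - M * k) =
          (c * B ^ M * powCoeff v (n - M) (s - M * k)) / c * (δ * v k / B) ^ M := by
        rw [div_pow]
        field_simp
      change (δ * v k) ^ M * powCoeff v (n - M) (s - M * k) ≤ _
      rw [h4]
      have := hv k
      gcongr
    · have := hv k
      have := powCoeff_nonneg hv n s
      positivity
  refine (Finset.sum_le_sum h2).trans ?_
  rw [← Finset.mul_sum, ← add_pow, div_mul_eq_mul_div, mul_div_assoc]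
  refine mul_le_mul_of_nonneg_left ?_ (powCoeff_nonneg hv _ _)
  refine div_le_div_of_nonneg_right ?_ hc.le
  rw [Real.exp_nat_mul]
  have := hv k
  exact pow_le_pow_left₀ (by positivity) (Real.add_one_le_exp _) _

/-- Sequences of pairs `(n, s)` with `s ≤ n + O(1)` used for weights with zero radius of
convergence. -/
structure SubcriticalPairs {ι : Type*} (l : Filter ι) (v : ℕ → ℝ) (n s : ι → ℕ) : Prop where
  tendsto_length : Tendsto n l atTop
  tendsto_sum : Tendsto s l atTop
  le : ∃ C, ∀ᶠ i in l, s i ≤ n i + C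
  pos : ∀ᶠ i in l, 0 < powCoeff v (n i) (s i)

theorem entryProb_nonneg {v : ℕ → ℝ} (hv : ∀ k, 0 ≤ v k) (k n s : ℕ) : 0 ≤ entryProb v k n s :=
  div_nonneg (mul_nonneg (hv _) (powCoeff_nonneg hv _ _)) (powCoeff_nonneg hv _ _)

theorem sum_entryProb {v : ℕ → ℝ} {n s : ℕ} (hn : 1 ≤ n) (h : 0 < powCoeff v n s) :
    ∑ k ∈ Finset.range (s + 1), entryProb v k n s = 1 := by
  obtain ⟨m, rfl⟩ : ∃ m, n = m + 1 := ⟨n - 1, by omega⟩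
  simp only [entryProb]
  rw [← Finset.sum_div, Nat.add_sub_cancel, ← powCoeff_succ, div_self h.ne']

theorem sum_mul_entryProb {v : ℕ → ℝ} {n s : ℕ} (hn : 1 ≤ n) (h : 0 < powCoeff v n s) :
    ∑ k ∈ Finset.range (s + 1), k * entryProb v k n s = s / n := by
  obtain ⟨m, rfl⟩ : ∃ m, n = m + 1 := ⟨n - 1, by omega⟩
  simp only [entryProb, Nat.add_sub_cancel]
  have h1 := sum_mul_powCoeff v m s
  simp_rw [← mul_div_assoc]
  rw [← Finset.sum_div, div_eq_div_iff h.ne' (by positivity)]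
  push_cast
  linarith

/-- The exponential moment of the number of entries k is subexponential: for λ ≤ 0 trivially, and
for λ ≥ 0 by `powCoeff_update_le` with B large compared with 1/η. -/
theorem SubcriticalPairs.tendsto_entryProb_succ {ι : Type*} {l : Filter ι} {v : ℕ → ℝ}
    (hv : ∀ k, 0 ≤ v k) (hv0 : 0 < v 0) (hrad : ∀ B : ℝ, ∃ᶠ M in atTop, B ^ M ≤ v M)
    {n s : ι → ℕ} (h : SubcriticalPairs l v n s) {k : ℕ} (hk : 1 ≤ k) :
    Tendsto (fun i => entryProb v k (n i) (s i)) l (𝓝 0) := by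
  rcases (hv k).eq_or_lt with hvk | hvk
  · simp [entryProb, ← hvk, tendsto_const_nhds]
  refine tendsto_entryProb_of_exp_moment hv zero_le_one h.tendsto_length h.tendsto_sum h.pos ?_
  intro lam η hη
  simp only [zero_mul, zero_add]
  rcases le_total lam 0 with hl | hl
  · refine Eventually.of_forall fun i => ?_
    calc _ ≤ powCoeff v (n i) (s i) * 1 := by
          rw [mul_one]
          refine powCoeff_mono (fun j => ?_) (fun j => ?_) _ _ <;> rcases eq_or_ne j k with rfl | hj
          · simp only [Function.update_self]; positivity
          · simpa [hj] using hv j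
          · simp only [Function.update_self]
            exact mul_le_of_le_one_left hvk.le (Real.exp_le_one_iff.2 hl)
          · simp [hj]
      _ ≤ _ := mul_le_mul_of_nonneg_left (Real.one_le_exp (by positivity)) (powCoeff_nonneg hv _ _)
  · set δ := Real.exp lam - 1 with hδ
    have hδ0 : 0 ≤ δ := by linarith [Real.one_le_exp hl]
    set B := (δ + 1) * v k / (η / 2) with hB
    have hB0 : 0 < B := by positivity
    obtain ⟨c, hc, hcB⟩ := exists_mul_pow_le_powCoeff hv hv0 hrad hk hvk hB0
    have h1 : Tendsto (fun i => (n i : ℝ)) l atTop :=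
      tendsto_natCast_atTop_atTop.comp h.tendsto_length
    filter_upwards [h1.eventually_ge_atTop (1 / c / (η / 2))] with i hi
    have h2 := powCoeff_update_le hv hB0 hc hδ0 hcB (n i) (s i)
    rw [hδ, add_sub_cancel] at h2
    refine h2.trans (mul_le_mul_of_nonneg_left ?_ (powCoeff_nonneg hv _ _))
    rw [← hδ]
    have h3 : δ * v k / B ≤ η / 2 := by
      rw [div_le_iff₀ hB0, hB]
      field_simp
      linarith
    have h4 : 1 / c ≤ Real.exp (n i * (η / 2)) := by
      rw [div_le_iff₀ (by positivity)] at hi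
      linarith [Real.add_one_le_exp (n i * (η / 2))]
    calc Real.exp (n i * (δ * v k / B)) / c = Real.exp (n i * (δ * v k / B)) * (1 / c) := by ring
      _ ≤ Real.exp (n i * (η / 2)) * Real.exp (n i * (η / 2)) := by gcongr
      _ = _ := by rw [← Real.exp_add]; congr 1; ring

/-- Values from 1 to K - 1 have vanishing probability. Values from K on have probability at most (1
+ C)/K by Markov's inequality, since the mean entry s/n is bounded. -/
theorem SubcriticalPairs.tendsto_entryProb_zero {ι : Type*} {l : Filter ι} {v : ℕ → ℝ}
    (hv : ∀ k, 0 ≤ v k) (hv0 : 0 < v 0) (hrad : ∀ B : ℝ, ∃ᶠ M in atTop, B ^ M ≤ v M)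
    {n s : ι → ℕ} (h : SubcriticalPairs l v n s) :
    Tendsto (fun i => entryProb v 0 (n i) (s i)) l (𝓝 1) := by
  obtain ⟨C, hC⟩ := h.le
  rw [Metric.tendsto_nhds]
  intro ε hε
  obtain ⟨K, hK⟩ := exists_nat_gt ((1 + C : ℝ) / (ε / 2))
  have hK0 : (0 : ℝ) < K := lt_of_le_of_lt (by positivity) hK
  have hK1 : 1 ≤ K := by exact_mod_cast hK0
  have hsmall : Tendsto (fun i => ∑ k ∈ Finset.Ico 1 K, entryProb v k (n i) (s i)) l (𝓝 0) := by
    rw [← Finset.sum_const_zero (s := Finset.Ico 1 K)]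
    refine tendsto_finsetSum _ fun k hk => h.tendsto_entryProb_succ hv hv0 hrad ?_
    exact (Finset.mem_Ico.1 hk).1
  filter_upwards [hsmall.eventually (gt_mem_nhds (half_pos hε)), hC, h.pos,
    h.tendsto_length.eventually_ge_atTop 1, h.tendsto_sum.eventually_ge_atTop K] with i h1 h2 h3 h4 h5
  have h6 := sum_entryProb h4 h3
  have h7 := sum_mul_entryProb h4 h3
  have hq := fun k => entryProb_nonneg hv k (n i) (s i)
  rw [Finset.range_eq_Ico, ← Finset.sum_Ico_consecutive _ (Nat.zero_le K) (by omega : K ≤ s i + 1),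
    Finset.sum_eq_sum_Ico_succ_bot (by omega : 0 < K)] at h6
  have h8 : K * ∑ k ∈ Finset.Ico K (s i + 1), entryProb v k (n i) (s i) ≤ s i / n i := by
    rw [← h7, Finset.mul_sum]
    refine le_trans (Finset.sum_le_sum (g := fun k : ℕ => (k : ℝ) * entryProb v k (n i) (s i)) ?_)
      (Finset.sum_le_sum_of_subset_of_nonneg ?_ fun k _ _ => mul_nonneg (by positivity) (hq k))
    · intro k hk
      exact mul_le_mul_of_nonneg_right (by exact_mod_cast (Finset.mem_Ico.1 hk).1) (hq k)
    · intro k hk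
      exact Finset.mem_range.2 (Finset.mem_Ico.1 hk).2
  have h9 : (s i : ℝ) / n i ≤ 1 + C := by
    have : (1 : ℝ) ≤ n i := by exact_mod_cast h4
    rw [div_le_iff₀ (by linarith)]
    have : (s i : ℝ) ≤ n i + C := by exact_mod_cast h2
    nlinarith [(Nat.cast_nonneg C : (0 : ℝ) ≤ C)]
  rw [div_lt_iff₀ (by positivity)] at hK
  have h10 : ∑ k ∈ Finset.Ico K (s i + 1), entryProb v k (n i) (s i) < ε / 2 := by
    by_contra hcon
    rw [not_lt] at hcon
    nlinarith
  have h11 : 0 ≤ ∑ k ∈ Finset.Ico K (s i + 1), entryProb v k (n i) (s i) :=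
    Finset.sum_nonneg fun k _ => hq k
  have h12 : 0 ≤ ∑ k ∈ Finset.Ico 1 K, entryProb v k (n i) (s i) :=
    Finset.sum_nonneg fun k _ => hq k
  rw [Real.dist_eq, abs_lt]
  constructor <;> linarith

theorem SubcriticalPairs.step {ι : Type*} {l : Filter ι} {v : ℕ → ℝ}
    (hv : ∀ k, 0 ≤ v k) (hv0 : 0 < v 0) (hrad : ∀ B : ℝ, ∃ᶠ M in atTop, B ^ M ≤ v M)
    {n s : ι → ℕ} (h : SubcriticalPairs l v n s) :
    SubcriticalPairs l v (fun i => n i - 1) (fun i => s i - 0) := by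
  refine ⟨(tendsto_sub_atTop_nat 1).comp h.tendsto_length, h.tendsto_sum, ?_, ?_⟩
  · obtain ⟨C, hC⟩ := h.le
    exact ⟨C + 1, hC.mono fun i hi => by omega⟩
  · filter_upwards [(h.tendsto_entryProb_zero hv hv0 hrad).eventually (lt_mem_nhds one_pos), h.pos]
      with i h1 h2
    rw [entryProb, lt_div_iff₀ h2, zero_mul] at h1
    exact pos_of_mul_pos_right h1 hv0.le

/-! ### Telescoping -/

theorem prod_mul_powCoeff_le {α : Type*} {v : ℕ → ℝ} (hv : ∀ k, 0 ≤ v k) (S : Finset α) (d : α → ℕ)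
    (n s : ℕ) :
    (∏ u ∈ S, v (d u)) * powCoeff v n s ≤ powCoeff v (n + S.card) (s + ∑ u ∈ S, d u) := by
  classical
  induction S using Finset.induction_on with
  | empty => simp
  | insert a S ha ih =>
    rw [Finset.prod_insert ha, Finset.sum_insert ha, Finset.card_insert_of_notMem ha, mul_assoc]
    refine (mul_le_mul_of_nonneg_left ih (hv _)).trans ((mul_powCoeff_le hv _ _ _).trans ?_)
    rw [add_assoc, add_assoc, add_comm (d a)]

/-- If one-step ratios converge along a class of sequences stable under steps of positive
probability, then the ratios for several steps converge to the product. -/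
theorem tendsto_prod_powCoeff {α ι : Type*} {l : Filter ι} {v : ℕ → ℝ} (hv : ∀ k, 0 ≤ v k)
    {p : ℕ → ℝ} (hp : ∀ k, 0 ≤ p k)
    (H : (ι → ℕ) → (ι → ℕ) → Prop) (hlen : ∀ {n s}, H n s → Tendsto n l atTop)
    (hsum : ∀ {n s}, H n s → Tendsto s l atTop)
    (hpos : ∀ {n s}, H n s → ∀ᶠ i in l, 0 < powCoeff v (n i) (s i))
    (hlim : ∀ {n s}, H n s → ∀ k, Tendsto (fun i => entryProb v k (n i) (s i)) l (𝓝 (p k)))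
    (hstep : ∀ {n s}, H n s → ∀ k, 0 < p k → H (fun i => n i - 1) (fun i => s i - k))
    (S : Finset α) (d : α → ℕ) {n s : ι → ℕ} (h : H n s) :
    Tendsto (fun i => (∏ u ∈ S, v (d u)) * powCoeff v (n i - S.card) (s i - ∑ u ∈ S, d u) /
      powCoeff v (n i) (s i)) l (𝓝 (∏ u ∈ S, p (d u))) := by
  classical
  induction S using Finset.induction_on generalizing n s with
  | empty =>
    simp only [Finset.prod_empty, Finset.card_empty, Finset.sum_empty, one_mul, Nat.sub_zero]
    refine tendsto_const_nhds.congr' ?_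
    filter_upwards [hpos h] with i hi
    rw [div_self hi.ne']
  | insert a S ha ih =>
    rw [Finset.prod_insert ha, Finset.sum_insert ha, Finset.card_insert_of_notMem ha,
      Finset.prod_insert ha]
    -- If the limiting probability is zero, the class need not be stable under this step. Then the
    -- whole ratio is at most the first entry probability, which tends to 0.
    rcases (hp (d a)).eq_or_lt with h0 | h0
    · rw [← h0, zero_mul]
      have hl := hlim h (d a)
      rw [← h0] at hl
      refine tendsto_of_tendsto_of_tendsto_of_le_of_le' tendsto_const_nhds hl
        (Eventually.of_forall fun i => ?_) ?_
      · exact div_nonneg (mul_nonneg (mul_nonneg (hv _) (Finset.prod_nonneg fun u _ => hv _))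
          (powCoeff_nonneg hv _ _)) (powCoeff_nonneg hv _ _)
      · filter_upwards [hpos h, (hlen h).eventually_ge_atTop (S.card + 1),
          (hsum h).eventually_ge_atTop (d a + ∑ u ∈ S, d u)] with i h1 h2 h3
        rw [entryProb]
        refine div_le_div_of_nonneg_right ?_ h1.le
        rw [mul_assoc]
        refine mul_le_mul_of_nonneg_left ((prod_mul_powCoeff_le hv S d _ _).trans ?_) (hv _)
        refine le_of_eq ?_
        congr 1 <;> omega
    · have h' := hstep h (d a) h0
      refine ((hlim h (d a)).mul (ih h')).congr' ?_
      filter_upwards [hpos h'] with i hi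
      rw [entryProb, add_comm S.card 1, ← Nat.sub_sub, ← Nat.sub_sub]
      field_simp

/-! ### Growth of the partition function -/

/-- Fekete's argument for a sequence with zeros. Fix n₀ with a nearly optimal growth rate. In each
residue class modulo n₀ that contains some a_b ≠ 0, one has a_{n₀q+b} ≥ a_{n₀}^q a_b, and the
constant is absorbed by half of η. -/
theorem eventually_exp_mul_pow_le_of_supermultiplicative {a : ℕ → ℝ} (ha : ∀ n, 0 ≤ a n)
    (hmul : ∀ m n, a m * a n ≤ a (m + n)) {R : ℝ} (hR : 0 < R)
    (hsup : ∀ η > 0, ∃ n ≥ 1, (Real.exp (-η) * R) ^ n ≤ a n) {η : ℝ} (hη : 0 < η) :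
    ∀ᶠ n : ℕ in atTop, a n ≠ 0 → Real.exp (-(η * n)) * R ^ n ≤ a n := by
  obtain ⟨n0, hn0, h0⟩ := hsup (η / 2) (half_pos hη)
  set r := Real.exp (-(η / 2)) * R with hr
  have hr0 : 0 < r := by positivity
  have hpow : ∀ (q b : ℕ), a n0 ^ q * a b ≤ a (n0 * q + b) := by
    intro q b
    induction q with
    | zero => simp
    | succ q ih =>
      rw [pow_succ', mul_assoc, show n0 * (q + 1) + b = n0 + (n0 * q + b) by ring]
      exact (mul_le_mul_of_nonneg_left ih (ha _)).trans (hmul _ _)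
  have hclass : ∀ i ∈ Finset.range n0,
      ∀ᶠ n : ℕ in atTop, n % n0 = i → a n ≠ 0 → Real.exp (-(η * n)) * R ^ n ≤ a n := by
    intro i _
    by_cases hb : ∃ b, b % n0 = i ∧ a b ≠ 0
    · obtain ⟨b, hbi, hab⟩ := hb
      have hab' : 0 < a b := (ha b).lt_of_ne' hab
      have hc : 0 < a b / r ^ b := by positivity
      have h1 : Tendsto (fun n : ℕ => Real.exp (-(η / 2 * n))) atTop (𝓝 0) := by
        refine Real.tendsto_exp_neg_atTop_nhds_zero.comp ?_
        exact tendsto_natCast_atTop_atTop.const_mul_atTop (half_pos hη)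
      filter_upwards [h1.eventually (gt_mem_nhds hc), eventually_ge_atTop b] with n h2 hnb hni _
      obtain ⟨q, hq⟩ : ∃ q, n = n0 * q + b := by
        have h3 : n0 ∣ n - b := (Nat.modEq_iff_dvd' hnb).1 (hbi.trans hni.symm)
        obtain ⟨q, hq⟩ := h3
        exact ⟨q, by omega⟩
      have h4 : r ^ (n0 * q) * a b ≤ a n := by
        rw [hq, pow_mul]
        exact (mul_le_mul_of_nonneg_right (pow_le_pow_left₀ (by positivity) h0 q) (ha b)).trans
          (hpow q b)
      refine le_trans ?_ h4
      have h5 : r ^ (n0 * q) * a b = r ^ n * (a b / r ^ b) := by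
        rw [hq, pow_add]
        field_simp
      rw [h5]
      refine le_trans (le_of_eq ?_) (mul_le_mul_of_nonneg_left h2.le (by positivity))
      rw [hr, mul_pow, ← Real.exp_nat_mul, mul_right_comm, ← Real.exp_add]
      congr 2
      ring
    · push Not at hb
      exact Eventually.of_forall fun n hn hne => absurd (hb n hn) hne
  filter_upwards [(Finset.range n0).eventually_all.2 hclass] with n hn
  exact hn (n % n0) (Finset.mem_range.2 (Nat.mod_lt n hn0)) rfl

/-- The generating function of the weights of forests is a power of that of trees. -/
theorem hasSum_forest {v : ℕ → ℝ} (hv : ∀ k, 0 ≤ v k) {x : ℝ} (hx : 0 ≤ x)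
    (hs : Summable fun n => forest v 1 n * x ^ n) (r : ℕ) :
    HasSum (fun n => forest v r n * x ^ n) ((∑' n, forest v 1 n * x ^ n) ^ r) := by
  induction r with
  | zero =>
    convert hasSum_single 0 ?_ using 1
    · simp [forest]
    · intro n hn
      obtain ⟨n, rfl⟩ := Nat.exists_eq_succ_of_ne_zero hn
      simp [forest]
  | succ r ih =>
    have hnn : ∀ q n, 0 ≤ forest v q n * x ^ n := fun q n =>
      mul_nonneg (forest_nonneg hv _ _) (pow_nonneg hx _)
    have hfun : (fun n => forest v (r + 1) n * x ^ n) = fun n =>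
        ∑ p ∈ Finset.HasAntidiagonal.antidiagonal n,
          (forest v r p.1 * x ^ p.1) * (forest v 1 p.2 * x ^ p.2) := by
      ext n
      rw [forest_add, Finset.sum_mul]
      refine Finset.sum_congr rfl fun p hp => ?_
      rw [← Finset.HasAntidiagonal.mem_antidiagonal.1 hp, pow_add]
      ring
    rw [hfun, pow_succ, ← ih.tsum_eq]
    generalize hf : (fun n => forest v r n * x ^ n) = f at *
    generalize hg : (fun n => forest v 1 n * x ^ n) = g at *
    simp only [show ∀ n, forest v r n * x ^ n = f n from fun n => congrFun hf n,
      show ∀ n, forest v 1 n * x ^ n = g n from fun n => congrFun hg n]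
    rw [tsum_mul_tsum_eq_tsum_sum_antidiagonal_of_summable_norm ih.summable.norm hs.norm]
    exact (summable_norm_sum_mul_antidiagonal_of_summable_norm ih.summable.norm hs.norm).of_norm.hasSum

/-- Splitting off the root gives the functional equation z = xΦ(z) for the tree series z. The
inequality suffices, and it bounds the partial sums of Φ(z), so that convergence of Φ at z comes out
as well. -/
theorem summable_of_summable_forest {v : ℕ → ℝ} (hv : ∀ k, 0 ≤ v k) {x : ℝ} (hx : 0 < x)
    (hs : Summable fun n => forest v 1 n * x ^ n) :
    (Summable fun k => v k * (∑' n, forest v 1 n * x ^ n) ^ k) ∧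
      x * ∑' k, v k * (∑' n, forest v 1 n * x ^ n) ^ k ≤ ∑' n, forest v 1 n * x ^ n := by
  set z := ∑' n, forest v 1 n * x ^ n with hz
  have hnn : ∀ q n, 0 ≤ forest v q n * x ^ n := fun q n =>
    mul_nonneg (forest_nonneg hv _ _) (pow_nonneg hx.le _)
  have hz0 : 0 ≤ z := tsum_nonneg (hnn 1)
  have hpart : ∀ K : ℕ, ∑ k ∈ Finset.range K, v k * z ^ k ≤ z / x := by
    intro K
    rw [le_div_iff₀ hx]
    have h1 : HasSum (fun m => ∑ k ∈ Finset.range K, v k * (forest v k m * x ^ m))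
        (∑ k ∈ Finset.range K, v k * z ^ k) :=
      hasSum_sum fun k _ => (hasSum_forest hv hx.le hs k).mul_left (v k)
    have h2 := h1.mul_right x
    have h3 : HasSum (fun m => forest v 1 (m + 1) * x ^ (m + 1)) z := by
      have := (hasSum_nat_add_iff' (f := fun n => forest v 1 n * x ^ n) 1).2 hs.hasSum
      simpa [forest] using this
    refine hasSum_le (fun m => ?_) h2 h3
    rw [forest, Finset.sum_mul, Finset.sum_mul]
    have h4 : ∑ k ∈ Finset.range K, v k * (forest v k m * x ^ m) * x =
        ∑ k ∈ (Finset.range K).filter (· < m + 1), v k * (forest v k m * x ^ m) * x := by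
      refine (Finset.sum_filter_of_ne fun k _ hk => ?_).symm
      by_contra hcon
      exact hk (by rw [forest_eq_zero v (by omega : m < k)]; ring)
    rw [h4]
    refine (Finset.sum_le_sum_of_subset_of_nonneg (t := Finset.range (m + 1)) (fun k hk => ?_)
      fun k _ _ => mul_nonneg (mul_nonneg (hv k) (hnn _ _)) hx.le).trans
      (le_of_eq (Finset.sum_congr rfl fun k _ => ?_))
    · exact Finset.mem_range.2 (Finset.mem_filter.1 hk).2
    · rw [zero_add]; ring
  have hsum : Summable fun k => v k * z ^ k :=
    summable_of_sum_range_le (fun k => mul_nonneg (hv k) (pow_nonneg hz0 k)) hpart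
  refine ⟨hsum, ?_⟩
  rw [← le_div_iff₀' hx]
  exact Real.tsum_le_of_sum_range_le (fun k => mul_nonneg (hv k) (pow_nonneg hz0 k)) hpart

/-- The exponential growth rate of the tree weights is at least the minimum of `Φ(t) / t`. -/
theorem exists_pow_le_forest {v : ℕ → ℝ} (hv : ∀ k, 0 ≤ v k) (hv0 : 0 < v 0) {t : ℝ} (ht : 0 < t)
    (hPhi : 0 < ∑' k, v k * t ^ k)
    (hmin : ∀ z > 0, (Summable fun k => v k * z ^ k) →
      z * ∑' k, v k * t ^ k ≤ t * ∑' k, v k * z ^ k) {η : ℝ} (hη : 0 < η) :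
    ∃ n ≥ 1, (Real.exp (-η) * ((∑' k, v k * t ^ k) / t)) ^ n ≤ forest v 1 (n + 1) / v 0 := by
  set Z := ∑' k, v k * t ^ k with hZ
  by_contra! hcon
  set R := Real.exp (-η) * (Z / t) with hR
  have hR0 : 0 < R := by positivity
  have h1 : ∀ n, forest v 1 (n + 1) ≤ v 0 * R ^ n := by
    intro n
    rcases Nat.eq_zero_or_pos n with rfl | hn
    · simp [forest]
    · have := (hcon n hn).le
      rwa [div_le_iff₀ hv0, mul_comm] at this
  -- This x lies strictly between t/Z and 1/R. The assumed bound on the weights makes the tree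
  -- series converge at x, and its value z then satisfies Φ(z)/z ≤ 1/x < Φ(t)/t, against minimality.
  set x := Real.exp (η / 2) * (t / Z) with hx
  have hx0 : 0 < x := by positivity
  have hRx : R * x = Real.exp (-(η / 2)) := by
    rw [hR, hx]
    have : Real.exp (-η) * (Z / t) * (Real.exp (η / 2) * (t / Z)) =
        Real.exp (-η) * Real.exp (η / 2) := by field_simp
    rw [this, ← Real.exp_add]
    congr 1
    ring
  have hRx1 : R * x < 1 := by
    rw [hRx, Real.exp_lt_one_iff]
    linarith
  have hs : Summable fun n => forest v 1 n * x ^ n := by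
    rw [← summable_nat_add_iff 1]
    refine Summable.of_nonneg_of_le (fun n => mul_nonneg (forest_nonneg hv _ _) (by positivity))
      (fun n => ?_) ((summable_geometric_of_lt_one (by positivity) hRx1).mul_left (v 0 * x))
    calc forest v 1 (n + 1) * x ^ (n + 1) ≤ v 0 * R ^ n * x ^ (n + 1) :=
          mul_le_mul_of_nonneg_right (h1 n) (by positivity)
      _ = _ := by rw [mul_pow, pow_succ]; ring
  obtain ⟨h2, h3⟩ := summable_of_summable_forest hv hx0 hs
  set z := ∑' n, forest v 1 n * x ^ n with hz
  have hz0 : 0 < z := hs.tsum_pos (fun n => mul_nonneg (forest_nonneg hv _ _) (by positivity)) 1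
    (by simp [forest]; positivity)
  have h4 := hmin z hz0 h2
  have h5 : x * (z * Z) ≤ t * z := by
    calc x * (z * Z) ≤ x * (t * ∑' k, v k * z ^ k) := mul_le_mul_of_nonneg_left h4 hx0.le
      _ = t * (x * ∑' k, v k * z ^ k) := by ring
      _ ≤ t * z := mul_le_mul_of_nonneg_left h3 ht.le
  have h6 : x * (z * Z) = Real.exp (η / 2) * (t * z) := by
    rw [hx]; field_simp
  rw [h6] at h5
  have h7 : 1 < Real.exp (η / 2) := Real.one_lt_exp_iff.2 (by linarith)
  have h8 : 0 < t * z := by positivity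
  nlinarith

/-- Grafting a tree onto a leaf makes forest(1, n + 1)/v_0 supermultiplicative, so the growth rate
found at single sizes holds at all large sizes of positive weight. -/
theorem nearMaximal_of_forest_ne_zero {ι : Type*} {l : Filter ι} {v : ℕ → ℝ} (hv : ∀ k, 0 ≤ v k)
    (hv0 : 0 < v 0) {t : ℝ} (ht : 0 < t) (hPhi : 0 < ∑' k, v k * t ^ k)
    (hmin : ∀ z > 0, (Summable fun k => v k * z ^ k) →
      z * ∑' k, v k * t ^ k ≤ t * ∑' k, v k * z ^ k) {n : ι → ℕ} (hn : Tendsto n l atTop)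
    (hne : ∀ᶠ i in l, forest v 1 (n i) ≠ 0) : NearMaximal l v t n (fun i => n i - 1) := by
  set Z := ∑' k, v k * t ^ k with hZ
  have hn1 := (tendsto_sub_atTop_nat 1).comp hn
  refine ⟨hn, hn1, fun η hη => ?_⟩
  have hsuper := eventually_exp_mul_pow_le_of_supermultiplicative
    (a := fun n => forest v 1 (n + 1) / v 0)
    (fun n => div_nonneg (forest_nonneg hv _ _) hv0.le) (fun m n => by
      have := forest_mul_forest_le hv 0 m n
      rw [div_mul_div_comm, div_le_div_iff₀ (by positivity) hv0]
      simp only [zero_add] at this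
      nlinarith) (by positivity : 0 < Z / t)
    (fun η hη => exists_pow_le_forest hv hv0 ht hPhi hmin hη) hη
  have hcast : Tendsto (fun i => (n i : ℝ)) l atTop := tendsto_natCast_atTop_atTop.comp hn
  filter_upwards [hn1.eventually hsuper, hne, hn.eventually_ge_atTop 1,
    hcast.eventually_ge_atTop (Z / v 0)] with i h1 h2 h3 h4
  obtain ⟨m, hm⟩ : ∃ m, n i = m + 1 := ⟨n i - 1, by omega⟩
  rw [← hZ]
  simp only [Function.comp_apply, hm, Nat.add_sub_cancel] at *
  have h5 := h1 (div_ne_zero h2 hv0.ne')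
  have h6 := mul_forest_one v (n := m + 1) (by omega)
  rw [Nat.add_sub_cancel] at h6
  rw [← h6]
  rw [le_div_iff₀ hv0] at h5
  -- The factor n in n · forest(1, n) = [x^(n-1)] Φ^n absorbs the one surplus factor Z, as Z ≤ n v_0
  -- eventually.
  rw [div_le_iff₀ hv0] at h4
  have h7 : Real.exp (-(η * (m + 1 : ℕ))) ≤ Real.exp (-(η * m)) := by
    rw [Real.exp_le_exp]
    push_cast
    nlinarith
  calc Real.exp (-(η * (m + 1 : ℕ))) * Z ^ (m + 1)
      ≤ Real.exp (-(η * m)) * Z ^ (m + 1) := by gcongr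
    _ = Real.exp (-(η * m)) * (Z / t) ^ m * t ^ m * Z := by
        rw [div_pow, pow_succ]
        field_simp
    _ ≤ Real.exp (-(η * m)) * (Z / t) ^ m * t ^ m * ((m + 1 : ℕ) * v 0) := by gcongr
    _ = (m + 1 : ℕ) * (Real.exp (-(η * m)) * (Z / t) ^ m * v 0) * t ^ m := by ring
    _ ≤ _ := by gcongr

theorem subcriticalPairs_of_forest_ne_zero {ι : Type*} {l : Filter ι} {v : ℕ → ℝ}
    (hv : ∀ k, 0 ≤ v k) {n : ι → ℕ} (hn : Tendsto n l atTop)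
    (hne : ∀ᶠ i in l, forest v 1 (n i) ≠ 0) : SubcriticalPairs l v n (fun i => n i - 1) := by
  refine ⟨hn, (tendsto_sub_atTop_nat 1).comp hn, ⟨0, Eventually.of_forall fun i => by omega⟩, ?_⟩
  filter_upwards [hne, hn.eventually_ge_atTop 1] with i h1 h2
  rw [← mul_forest_one v h2]
  have h3 : (0 : ℝ) < n i := by exact_mod_cast h2
  exact mul_pos h3 ((forest_nonneg hv _ _).lt_of_ne' h1)

/-- The hypotheses on `τ` that determine the local limit, in terms of the real weights `v` and the
limiting probabilities `p`. -/
def IsLimitOffspring (v p : ℕ → ℝ) : Prop :=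
  (∃ t > 0, (Summable fun k => v k * t ^ k) ∧ (∀ k, p k = v k * t ^ k / ∑' k, v k * t ^ k) ∧
    ∀ z > 0, (Summable fun k => v k * z ^ k) → z * ∑' k, v k * t ^ k ≤ t * ∑' k, v k * z ^ k) ∨
  ((∀ B : ℝ, ∃ᶠ M in atTop, B ^ M ≤ v M) ∧ ∀ k, p k = if k = 0 then 1 else 0)

/-- The sequence lemma behind the local limit: any finite family of entries of a sequence of length
n with sum n - 1 becomes independent with law p. The two alternatives use the near-maximal and the
subcritical class, respectively. -/
theorem IsLimitOffspring.tendsto {α ι : Type*} {l : Filter ι} {v p : ℕ → ℝ}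
    (h : IsLimitOffspring v p) (hv : ∀ k, 0 ≤ v k) (hv0 : 0 < v 0) {n : ι → ℕ}
    (hn : Tendsto n l atTop) (hne : ∀ᶠ i in l, forest v 1 (n i) ≠ 0) (S : Finset α) (d : α → ℕ) :
    Tendsto (fun i => (∏ u ∈ S, v (d u)) * powCoeff v (n i - S.card) (n i - 1 - ∑ u ∈ S, d u) /
      powCoeff v (n i) (n i - 1)) l (𝓝 (∏ u ∈ S, p (d u))) := by
  rcases h with ⟨t, ht, hsum, hp, hmin⟩ | ⟨hrad, hp⟩
  · have hPhi : 0 < ∑' k, v k * t ^ k :=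
      hsum.tsum_pos (fun k => mul_nonneg (hv k) (by positivity)) 0 (by simpa using hv0)
    refine tendsto_prod_powCoeff hv (p := p) (fun k => ?_) (NearMaximal l v t)
      (fun h => h.tendsto_length) (fun h => h.tendsto_sum) (fun h => h.pos ht hPhi)
      (fun h k => ?_) (fun h k hk => ?_) S d
      (nearMaximal_of_forest_ne_zero hv hv0 ht hPhi hmin hn hne)
    · rw [hp]
      exact div_nonneg (mul_nonneg (hv k) (by positivity)) hPhi.le
    · rw [hp]
      exact h.tendsto_entryProb hv ht hsum hPhi k
    · refine h.step hv ht hsum hPhi ((hv k).lt_of_ne' fun h0 => ?_)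
      rw [hp, h0] at hk
      simp at hk
  · refine tendsto_prod_powCoeff hv (p := p) (fun k => ?_) (SubcriticalPairs l v)
      (fun h => h.tendsto_length) (fun h => h.tendsto_sum) (fun h => h.pos)
      (fun h k => ?_) (fun h k hk => ?_) S d (subcriticalPairs_of_forest_ne_zero hv hn hne)
    · rw [hp]
      split_ifs <;> norm_num
    · rw [hp]
      split_ifs with hk
      · subst hk
        exact h.tendsto_entryProb_zero hv hv0 hrad
      · exact h.tendsto_entryProb_succ hv hv0 hrad (by omega)
    · rw [hp] at hk
      split_ifs at hk with hk0
      · subst hk0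
        exact h.step hv hv0 hrad
      · exact absurd hk (lt_irrefl _)

/-! ### Cylinder sets of trees -/

/-- `S` is the node set of the top part of a tree in which the nodes `u ∈ S` have outdegree
`d u`. -/
def Consistent (S : Finset (List ℕ)) (d : List ℕ → ℕ) : Prop :=
  ∀ u i, u ++ [i] ∈ S → u ∈ S ∧ i < d u

/-- The root and the children of the nodes in `S`. -/
def childNodes (S : Finset (List ℕ)) (d : List ℕ → ℕ) : Finset (List ℕ) :=
  insert [] ((S.sigma fun u => Finset.range (d u)).image fun p => p.1 ++ [p.2])

/-- The positions at which a tree with top part `S` continues. -/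
def slots (S : Finset (List ℕ)) (d : List ℕ → ℕ) : Finset (List ℕ) := childNodes S d \ S

/-- The trees in which the nodes `u ∈ S` have outdegree `d u`. -/
def cyl (S : Finset (List ℕ)) (d : List ℕ → ℕ) : Set Tree := {T | ∀ u ∈ S, T.deg u = d u}

theorem nil_mem_childNodes (S : Finset (List ℕ)) (d : List ℕ → ℕ) : [] ∈ childNodes S d := by
  simp [childNodes]

theorem append_mem_childNodes {S : Finset (List ℕ)} {d : List ℕ → ℕ} {u : List ℕ} {i : ℕ} :
    u ++ [i] ∈ childNodes S d ↔ u ∈ S ∧ i < d u := by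
  simp only [childNodes, Finset.mem_insert, List.append_eq_nil_iff, List.cons_ne_nil, and_false,
    false_or, Finset.mem_image, Finset.mem_sigma, Finset.mem_range, Sigma.exists]
  constructor
  · rintro ⟨a, b, h, hab⟩
    obtain ⟨rfl, h2⟩ := List.append_inj' hab rfl
    simp only [List.cons.injEq, and_true] at h2
    exact h2 ▸ h
  · exact fun h => ⟨u, i, h, rfl⟩

theorem card_childNodes (S : Finset (List ℕ)) (d : List ℕ → ℕ) :
    (childNodes S d).card = 1 + ∑ u ∈ S, d u := by
  rw [childNodes, Finset.card_insert_of_notMem, Finset.card_image_of_injective, Finset.card_sigma,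
    add_comm]
  · simp
  · rintro ⟨a, b⟩ ⟨a', b'⟩ h
    obtain ⟨h1, h2⟩ := List.append_inj' h rfl
    simp only [List.cons.injEq, and_true] at h1 h2
    subst h1 h2
    rfl
  · simp

theorem Consistent.subset_childNodes {S : Finset (List ℕ)} {d : List ℕ → ℕ} (h : Consistent S d) :
    S ⊆ childNodes S d := by
  intro u hu
  induction u using List.reverseRecOn with
  | nil => exact nil_mem_childNodes S d
  | append_singleton u i _ => exact append_mem_childNodes.2 (h u i hu)

/-- Every node of S is the root or a child of a node of S, so the slots are what remains of 1 + ∑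
d(u) positions after removing S. -/
theorem Consistent.card_slots {S : Finset (List ℕ)} {d : List ℕ → ℕ} (h : Consistent S d) :
    (slots S d).card + S.card = 1 + ∑ u ∈ S, d u := by
  rw [slots, Finset.card_sdiff_add_card_eq_card h.subset_childNodes, card_childNodes]

theorem Consistent.mem_of_prefix {S : Finset (List ℕ)} {d : List ℕ → ℕ} (h : Consistent S d)
    {u v : List ℕ} (huv : u <+: v) (hv : v ∈ S) : u ∈ S := by
  induction v using List.reverseRecOn with
  | nil => rwa [List.prefix_nil.1 huv]
  | append_singleton v i ih =>
    rcases List.prefix_concat_iff.1 huv with rfl | h1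
    · exact hv
    · exact ih h1 (h v i hv).1

theorem Consistent.mem_nodes {S : Finset (List ℕ)} {d : List ℕ → ℕ} (h : Consistent S d) {T : Tree}
    (hT : T ∈ cyl S d) {u : List ℕ} (hu : u ∈ childNodes S d) : u ∈ T.nodes := by
  induction u using List.reverseRecOn with
  | nil => exact T.nil_mem_nodes
  | append_singleton u i ih =>
    obtain ⟨h1, h2⟩ := append_mem_childNodes.1 hu
    refine Tree.append_mem_nodes.2 ⟨ih (h.subset_childNodes h1), ?_⟩
    rw [hT u h1]
    exact_mod_cast h2

theorem nodes_eq_of_slots_eq_empty {S : Finset (List ℕ)} {d : List ℕ → ℕ} (h : Consistent S d)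
    (hs : slots S d = ∅) {T : Tree} (hT : T ∈ cyl S d) : T.nodes = S := by
  have hsub : childNodes S d ⊆ S := Finset.sdiff_eq_empty_iff_subset.1 hs
  refine Subset.antisymm (fun u hu => ?_) fun u hu => h.mem_nodes hT (h.subset_childNodes hu)
  induction u using List.reverseRecOn with
  | nil => exact hsub (nil_mem_childNodes S d)
  | append_singleton u i ih =>
    obtain ⟨h1, h2⟩ := Tree.append_mem_nodes.1 hu
    have h3 := ih h1
    rw [hT u h3] at h2
    exact hsub (append_mem_childNodes.2 ⟨h3, by exact_mod_cast h2⟩)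

theorem Consistent.insert {S : Finset (List ℕ)} {d : List ℕ → ℕ} (h : Consistent S d)
    {e : List ℕ} (he : e ∈ slots S d) (k : ℕ) :
    Consistent (insert e S) (Function.update d e k) := by
  obtain ⟨he1, he2⟩ := Finset.mem_sdiff.1 he
  intro u i hu
  have key : u ∈ S ∧ i < d u := by
    rcases Finset.mem_insert.1 hu with h1 | h1
    · exact append_mem_childNodes.1 (h1 ▸ he1)
    · exact h u i h1
  have hne : u ≠ e := fun h1 => he2 (h1 ▸ key.1)
  exact ⟨Finset.mem_insert_of_mem key.1, by simpa [hne] using key.2⟩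

theorem Tree.deg_ne_top_of_finite {T : Tree} (h : T.nodes.Finite) (u : List ℕ) : T.deg u ≠ ⊤ := by
  intro hu
  have hmem : u ∈ T.nodes := by
    by_contra hcon
    rw [T.deg_eq_zero_of_notMem u hcon] at hu
    exact absurd hu (by simp)
  have hsub : Set.range (fun i : ℕ => u ++ [i]) ⊆ T.nodes := by
    rintro _ ⟨i, rfl⟩
    exact Tree.append_mem_nodes.2 ⟨hmem, by rw [hu]; exact ENat.natCast_lt_top i⟩
  exact Set.infinite_range_of_injective (fun a b hab => by simpa using hab) (h.subset hsub)

theorem TreeOfSize.deg_ne_top {n : ℕ} (T : TreeOfSize n) (u : List ℕ) : T.1.deg u ≠ ⊤ :=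
  Tree.deg_ne_top_of_finite (Set.finite_of_encard_eq_coe T.2) u

/-- The tree whose node set is `S`, with outdegrees `d`. -/
def Consistent.tree {S : Finset (List ℕ)} {d : List ℕ → ℕ} (h : Consistent S d) : Tree where
  deg u := if u ∈ S then d u else 0
  deg_eq_zero u i hi := by
    rw [if_neg]
    intro hu
    obtain ⟨h1, h2⟩ := h u i hu
    rw [if_pos h1] at hi
    exact absurd h2 (not_lt.2 (by exact_mod_cast hi))

/-- The total weight of the trees of size `n` in a set of trees. -/
def setWeight (w : ℕ → ℝ≥0) (n : ℕ) (A : Set Tree) : ℝ≥0∞ :=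
  ∑' T : TreeOfSize n, A.indicator (fun T => (weight w T : ℝ≥0∞)) T.1

theorem setWeight_tsum {ι : Type*} (w : ℕ → ℝ≥0) (n : ℕ) (A : Set Tree) (B : ι → Set Tree)
    (hB : Pairwise (Function.onFun Disjoint B))
    (h : ∀ T : TreeOfSize n, T.1 ∈ A ↔ ∃ i, T.1 ∈ B i) :
    setWeight w n A = ∑' i, setWeight w n (B i) := by
  simp only [setWeight]
  rw [ENNReal.tsum_comm]
  congr 1
  ext T
  by_cases hT : T.1 ∈ A
  · obtain ⟨i, hi⟩ := (h T).1 hT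
    rw [tsum_eq_single i, Set.indicator_of_mem hT, Set.indicator_of_mem hi]
    intro j hj
    exact Set.indicator_of_notMem (fun hj' => Set.disjoint_left.1 (hB hj) hj' hi) _
  · rw [Set.indicator_of_notMem hT]
    refine (ENNReal.tsum_eq_zero.2 fun i => Set.indicator_of_notMem (fun hi => ?_) _).symm
    exact hT ((h T).2 ⟨i, hi⟩)

theorem mem_cyl_insert {S : Finset (List ℕ)} {d : List ℕ → ℕ} {e : List ℕ} (he : e ∉ S) {k : ℕ}
    {T : Tree} : T ∈ cyl (insert e S) (Function.update d e k) ↔ T ∈ cyl S d ∧ T.deg e = k := by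
  simp only [cyl, Set.mem_ofPred_eq, Finset.forall_mem_insert, Function.update_self]
  rw [and_comm]
  refine and_congr_left fun _ => forall₂_congr fun u hu => ?_
  rw [Function.update_of_ne (fun h : u = e => he (h ▸ hu))]

/-- Exploring one slot e and splitting by its outdegree k replaces r + 1 slots by r + k and uses up
one of the j remaining nodes. This is exactly the recursion that defines `forest`, and the order in
which slots are explored is irrelevant. -/
theorem setWeight_cyl (w : ℕ → ℝ≥0) (j : ℕ) {S : Finset (List ℕ)} {d : List ℕ → ℕ}
    (h : Consistent S d) :
    setWeight w (S.card + j) (cyl S d) = (∏ u ∈ S, (w (d u) : ℝ≥0∞)) *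
      ENNReal.ofReal (forest (fun k => (w k : ℝ)) (slots S d).card j) := by
  induction j generalizing S d with
  | zero =>
    rcases (slots S d).eq_empty_or_nonempty with hs | ⟨e, he⟩
    · have hcyl : h.tree ∈ cyl S d := fun u hu => if_pos hu
      have hnodes := nodes_eq_of_slots_eq_empty h hs hcyl
      let T0 : TreeOfSize (S.card + 0) := ⟨h.tree, by
        rw [hnodes, Set.encard_coe_eq_coe_finsetCard, add_zero]⟩
      rw [setWeight, tsum_eq_single T0]
      · rw [Set.indicator_of_mem hcyl, hs, weight]
        change ((∏ᶠ v ∈ h.tree.nodes, w (h.tree.deg v).toNat : ℝ≥0) : ℝ≥0∞) = _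
        rw [hnodes, finprod_mem_coe_finset]
        simp only [Finset.card_empty, forest, ENNReal.ofReal_one, mul_one]
        push_cast
        refine Finset.prod_congr rfl fun u hu => ?_
        rw [hcyl u hu]
        rfl
      · intro T hT
        refine Set.indicator_of_notMem (fun hT' => hT ?_) _
        refine Subtype.ext (Tree.nodes_injective ?_)
        rw [nodes_eq_of_slots_eq_empty h hs hT']
        exact hnodes.symm
    · obtain ⟨r, hr⟩ := Nat.exists_eq_succ_of_ne_zero (Finset.card_pos.2 ⟨e, he⟩).ne'
      rw [hr]
      simp only [forest, ENNReal.ofReal_zero, mul_zero]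
      refine ENNReal.tsum_eq_zero.2 fun T => Set.indicator_of_notMem (fun hT => ?_) _
      obtain ⟨he1, he2⟩ := Finset.mem_sdiff.1 he
      have hsub : ((Insert.insert e S : Finset (List ℕ)) : Set (List ℕ)) ⊆ T.1.nodes := by
        intro u hu
        rcases Finset.mem_insert.1 (Finset.mem_coe.1 hu) with rfl | hu
        · exact h.mem_nodes hT he1
        · exact h.mem_nodes hT (h.subset_childNodes hu)
      have h1 := Set.encard_le_encard hsub
      rw [T.2, Set.encard_coe_eq_coe_finsetCard, Finset.card_insert_of_notMem he2] at h1
      -- An open slot is itself a node, so a tree in the cylinder has more than |S| nodes.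
      have h2 : S.card + 1 ≤ S.card + 0 := by exact_mod_cast h1
      omega
  | succ j ih =>
    rcases (slots S d).eq_empty_or_nonempty with hs | ⟨e, he⟩
    · rw [hs]
      simp only [Finset.card_empty, forest, ENNReal.ofReal_zero, mul_zero]
      refine ENNReal.tsum_eq_zero.2 fun T => Set.indicator_of_notMem (fun hT => ?_) _
      have h1 := T.2
      rw [nodes_eq_of_slots_eq_empty h hs hT, Set.encard_coe_eq_coe_finsetCard] at h1
      have h2 : S.card = S.card + (j + 1) := by exact_mod_cast h1
      omega
    · obtain ⟨r, hr⟩ := Nat.exists_eq_succ_of_ne_zero (Finset.card_pos.2 ⟨e, he⟩).ne'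
      have he2 := (Finset.mem_sdiff.1 he).2
      rw [setWeight_tsum w _ _ (fun k => cyl (Insert.insert e S) (Function.update d e k))]
      · have hcard : S.card + (j + 1) = (Insert.insert e S).card + j := by
          rw [Finset.card_insert_of_notMem he2]; ring
        have hprod : ∀ k, ∏ u ∈ Insert.insert e S, (w (Function.update d e k u) : ℝ≥0∞) =
            (∏ u ∈ S, (w (d u) : ℝ≥0∞)) * w k := by
          intro k
          rw [Finset.prod_insert he2, Function.update_self, mul_comm]
          congr 1
          refine Finset.prod_congr rfl fun u hu => ?_
          rw [Function.update_of_ne (fun h : u = e => he2 (h ▸ hu))]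
        have hslots : ∀ k, (slots (Insert.insert e S) (Function.update d e k)).card = r + k := by
          intro k
          have h1 := (h.insert he k).card_slots
          have h2 := h.card_slots
          have h3 : ∑ u ∈ S, Function.update d e k u = ∑ u ∈ S, d u :=
            Finset.sum_congr rfl fun u hu =>
              Function.update_of_ne (fun h : u = e => he2 (h ▸ hu)) k d
          rw [Finset.card_insert_of_notMem he2, Finset.sum_insert he2, Function.update_self,
            h3] at h1
          omega
        have hterm : ∀ k, setWeight w (S.card + (j + 1))
            (cyl (Insert.insert e S) (Function.update d e k)) =
            (∏ u ∈ S, (w (d u) : ℝ≥0∞)) *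
              ENNReal.ofReal (w k * forest (fun k => (w k : ℝ)) (r + k) j) := by
          intro k
          rw [hcard, ih (h.insert he k), hprod, hslots, ENNReal.ofReal_mul (NNReal.coe_nonneg _),
            ENNReal.ofReal_coe_nnreal, mul_assoc]
        simp only [hterm]
        rw [ENNReal.tsum_mul_left, hr, Nat.succ_eq_add_one, forest,
          ENNReal.ofReal_sum_of_nonneg fun k _ => mul_nonneg (NNReal.coe_nonneg _)
            (forest_nonneg (fun k => NNReal.coe_nonneg _) _ _)]
        congr 1
        refine tsum_eq_sum fun k hk => ?_
        rw [Finset.mem_range, not_lt] at hk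
        rw [forest_eq_zero _ (by omega), mul_zero, ENNReal.ofReal_zero]
      · intro k k' hkk'
        refine Set.disjoint_left.2 fun T hT hT' => hkk' ?_
        have h1 := ((mem_cyl_insert he2).1 hT).2
        rw [((mem_cyl_insert he2).1 hT').2] at h1
        exact_mod_cast h1.symm
      · intro T
        simp only [mem_cyl_insert he2]
        refine ⟨fun hT => ?_, fun ⟨k, hk⟩ => hk.1⟩
        obtain ⟨k, hk⟩ := ENat.ne_top_iff_exists.1 (T.deg_ne_top e)
        exact ⟨k, hT, hk.symm⟩

theorem partitionFn_eq (w : ℕ → ℝ≥0) (n : ℕ) :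
    partitionFn w n = ENNReal.ofReal (forest (fun k => (w k : ℝ)) 1 n) := by
  have h := setWeight_cyl w n (S := ∅) (d := fun _ => 0) (fun u i hu => by simp at hu)
  have h1 : (slots ∅ fun _ => 0).card = 1 := by simp [slots, childNodes]
  rw [h1, Finset.card_empty, zero_add, Finset.prod_empty, one_mul] at h
  rw [← h, setWeight, partitionFn]
  congr 1
  ext T
  rw [Set.indicator_of_mem]
  simp [cyl]

theorem isEmbedding_deg : IsEmbedding Tree.deg := ⟨⟨rfl⟩, fun _ _ h => Tree.ext h⟩

instance : T2Space Tree := isEmbedding_deg.t2Space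

theorem simplyGeneratedTree_apply (w : ℕ → ℝ≥0) (n : {n : ℕ // partitionFn w n ≠ 0})
    (A : Set Tree) :
    (simplyGeneratedTree w n).toMeasure {T | T.1 ∈ A} = setWeight w n A / partitionFn w n := by
  rw [PMF.toMeasure_apply_eq_tsum, setWeight, div_eq_mul_inv, ← ENNReal.tsum_mul_right]
  congr 1
  ext T
  by_cases hT : T.1 ∈ A
  · rw [Set.indicator_of_mem (s := {T : TreeOfSize n | T.1 ∈ A}) hT, Set.indicator_of_mem hT]
    exact PMF.normalize_apply _ _ T
  · rw [Set.indicator_of_notMem (s := {T : TreeOfSize n | T.1 ∈ A}) hT, Set.indicator_of_notMem hT,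
      zero_mul]

/-! ### The choices at a single node -/

theorem specialOffspring_apply (p : PMF ℕ) (h : mean p ≤ 1) (k : ℕ∞) (j : ℕ) :
    specialOffspring p h (k, j) = sizeBiasedMass p k * uniformChild k j := by
  rw [specialOffspring, PMF.bind_apply, tsum_eq_single k]
  · congr 1
    rw [PMF.map_apply, tsum_eq_single j]
    · simp
    · intro i hi
      simp [hi.symm]
  · intro k' hk'
    rw [PMF.map_apply]
    simp [hk'.symm]

theorem uniformChild_apply {k j : ℕ} (h : j < k) : uniformChild k j = (k : ℝ≥0∞)⁻¹ := by
  have hk : ((k : ℕ∞).toNat) ≠ 0 := by simp; omega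
  rw [uniformChild, dif_neg hk, PMF.uniformOfFinset_apply]
  simp [h]

/-- Size-biasing cancels against the uniform choice of the special child; hence special and normal
nodes contribute the same factor to the probability of a cylinder. -/
theorem specialOffspring_apply_coe (p : PMF ℕ) (h : mean p ≤ 1) {k j : ℕ} (hj : j < k) :
    specialOffspring p h (k, j) = p k := by
  rw [specialOffspring_apply, uniformChild_apply hj]
  change (k : ℝ≥0∞) * p k * (k : ℝ≥0∞)⁻¹ = p k
  rw [mul_right_comm, ENNReal.mul_inv_cancel, one_mul]
  · simp; omega
  · simp

theorem lt_of_mem_support_specialOffspring (p : PMF ℕ) (h : mean p ≤ 1) {x : ℕ∞ × ℕ}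
    (hx : x ∈ (specialOffspring p h).support) (hx1 : x.1 ≠ ⊤) : (x.2 : ℕ∞) < x.1 := by
  obtain ⟨k, j⟩ := x
  obtain ⟨k, rfl⟩ := ENat.ne_top_iff_exists.1 hx1
  rw [PMF.mem_support_iff, specialOffspring_apply] at hx
  change (k : ℝ≥0∞) * p k * _ ≠ 0 at hx
  have hk : k ≠ 0 := by
    rintro rfl
    simp at hx
  have hk' : ((k : ℕ∞).toNat) ≠ 0 := by simpa using hk
  have h2 := right_ne_zero_of_mul hx
  rw [uniformChild, dif_neg hk', ← PMF.mem_support_iff, PMF.support_uniformOfFinset] at h2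
  simpa using h2

theorem map_fst_specialOffspring (p : PMF ℕ) (h : mean p ≤ 1) :
    (specialOffspring p h).map Prod.fst = sizeBiased p h := by
  rw [specialOffspring, PMF.map_bind]
  conv_rhs => rw [← PMF.bind_pure (sizeBiased p h)]
  congr 1
  ext1 k
  rw [PMF.map_comp]
  exact PMF.map_const _ _

/-- The law of the choices at a node. -/
def nodeLaw (p : PMF ℕ) (h : mean p ≤ 1) : Measure (ℕ × (ℕ∞ × ℕ)) :=
  p.toMeasure.prod (specialOffspring p h).toMeasure

instance (p : PMF ℕ) (h : mean p ≤ 1) : IsProbabilityMeasure (nodeLaw p h) := by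
  unfold nodeLaw
  infer_instance

theorem nodeLaw_fst (p : PMF ℕ) (h : mean p ≤ 1) (k : ℕ) : nodeLaw p h {x | x.1 = k} = p k := by
  have : {x : ℕ × (ℕ∞ × ℕ) | x.1 = k} = {k} ×ˢ univ := by ext; simp
  rw [this, nodeLaw, Measure.prod_prod, measure_univ, mul_one, PMF.toMeasure_apply_singleton _ _
    (measurableSet_singleton k)]

theorem nodeLaw_snd (p : PMF ℕ) (h : mean p ≤ 1) (A : Set (ℕ∞ × ℕ)) :
    nodeLaw p h {x | x.2 ∈ A} = (specialOffspring p h).toMeasure A := by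
  have : {x : ℕ × (ℕ∞ × ℕ) | x.2 ∈ A} = univ ×ˢ A := by ext; simp
  rw [this, nodeLaw, Measure.prod_prod, measure_univ, one_mul]

theorem nodeLaw_snd_eq (p : PMF ℕ) (h : mean p ≤ 1) {k j : ℕ} (hj : j < k) :
    nodeLaw p h {x | x.2 = ((k : ℕ∞), j)} = p k := by
  refine (nodeLaw_snd p h {((k : ℕ∞), j)}).trans ?_
  rw [PMF.toMeasure_apply_singleton _ _ (measurableSet_singleton _), specialOffspring_apply_coe p h hj]

theorem nodeLaw_top (p : PMF ℕ) (h : mean p ≤ 1) :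
    nodeLaw p h {x | x.2.1 = ⊤} = 1 - mean p := by
  refine (nodeLaw_snd p h (Prod.fst ⁻¹' {⊤})).trans ?_
  rw [← PMF.toMeasure_map_apply _ _ _ measurable_fst (measurableSet_singleton _),
    map_fst_specialOffspring, PMF.toMeasure_apply_singleton _ _ (measurableSet_singleton _)]
  rfl

theorem choiceMeasure_pi (p : PMF ℕ) (h : mean p ≤ 1) (S : Finset (List ℕ))
    (B : List ℕ → Set (ℕ × (ℕ∞ × ℕ))) :
    choiceMeasure p h {ω | ∀ u ∈ S, ω u ∈ B u} = ∏ u ∈ S, nodeLaw p h (B u) :=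
  Measure.infinitePi_pi (μ := fun _ => nodeLaw p h) fun _ _ => MeasurableSet.of_discrete

theorem measurableSet_pi_choices (S : Finset (List ℕ)) (B : List ℕ → Set (ℕ × (ℕ∞ × ℕ))) :
    MeasurableSet {ω : Choices | ∀ u ∈ S, ω u ∈ B u} :=
  MeasurableSet.pi S.countable_toSet fun _ _ => MeasurableSet.of_discrete

theorem ae_choice (p : PMF ℕ) (h : mean p ≤ 1) (A : Set (ℕ × (ℕ∞ × ℕ)))
    (hA : nodeLaw p h Aᶜ = 0) : ∀ᵐ ω ∂choiceMeasure p h, ∀ u, ω u ∈ A := by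
  refine ae_all_iff.2 fun u => ?_
  have := choiceMeasure_pi p h {u} (fun _ => Aᶜ)
  simpa [hA, ae_iff] using this

/-- Special nodes with finitely many children have a special child. -/
def Choices.Valid (ω : Choices) : Prop := ∀ u, (ω u).2.1 ≠ ⊤ → ((ω u).2.2 : ℕ∞) < (ω u).2.1

theorem ae_valid (p : PMF ℕ) (h : mean p ≤ 1) : ∀ᵐ ω ∂choiceMeasure p h, Choices.Valid ω := by
  refine ae_choice p h {x | x.2.1 ≠ ⊤ → (x.2.2 : ℕ∞) < x.2.1} ?_
  refine (nodeLaw_snd p h {y | y.1 ≠ ⊤ → (y.2 : ℕ∞) < y.1}ᶜ).trans ?_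
  rw [PMF.toMeasure_apply_eq_zero_iff _ MeasurableSet.of_discrete, Set.disjoint_compl_right_iff_subset]
  exact fun x hx => lt_of_mem_support_specialOffspring p h hx

theorem ae_ne_top (p : PMF ℕ) (h : mean p ≤ 1) (h1 : mean p = 1) :
    ∀ᵐ ω ∂choiceMeasure p h, ∀ u, (ω u).2.1 ≠ ⊤ := by
  refine ae_choice p h {x | x.2.1 ≠ ⊤} ?_
  have := nodeLaw_top p h
  rw [h1, tsub_self] at this
  rw [← this]
  congr 1
  ext x
  simp

/-! ### The spine -/

theorem nil_mem_spine (ω : Choices) : [] ∈ spine ω := by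
  intro u i h
  simp at h

theorem mem_spine_of_prefix {ω : Choices} {u v : List ℕ} (h : u <+: v) (hv : v ∈ spine ω) :
    u ∈ spine ω := fun a i ha => hv a i (ha.trans h)

theorem append_mem_spine {ω : Choices} {v : List ℕ} {i : ℕ} :
    v ++ [i] ∈ spine ω ↔ v ∈ spine ω ∧ (ω v).2.1 ≠ ⊤ ∧ (i : ℕ∞) < (ω v).2.1 ∧ i = (ω v).2.2 := by
  constructor
  · intro h
    exact ⟨mem_spine_of_prefix (List.prefix_append _ _) h, h v i (List.prefix_refl _)⟩
  · rintro ⟨h, hi⟩ u j hu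
    rcases List.prefix_concat_iff.1 hu with h1 | h1
    · obtain ⟨rfl, h3⟩ := List.append_inj' h1 rfl
      simp only [List.cons.injEq, and_true] at h3
      exact h3 ▸ hi
    · exact h u j h1

theorem exists_append_prefix {u v : List ℕ} (h : u <+: v) (hne : u ≠ v) : ∃ i, u ++ [i] <+: v := by
  obtain ⟨t, rfl⟩ := h
  rcases t with _ | ⟨i, t⟩
  · simp at hne
  · exact ⟨i, t, by simp⟩

theorem spine_chain {ω : Choices} {u v : List ℕ} (hu : u ∈ spine ω) (hv : v ∈ spine ω) :
    u <+: v ∨ v <+: u := by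
  induction u using List.reverseRecOn with
  | nil => exact Or.inl List.nil_prefix
  | append_singleton a i ih =>
    obtain ⟨ha, -, -, hi⟩ := append_mem_spine.1 hu
    rcases ih ha with h | h
    · rcases eq_or_ne a v with rfl | hne
      · exact Or.inr (List.prefix_append _ _)
      · obtain ⟨j, hj⟩ := exists_append_prefix h hne
        have := (hv a j hj).2.2
        rw [hi, ← this]
        exact Or.inl hj
    · exact Or.inr (h.trans (List.prefix_append _ _))

theorem prefix_of_mem_spine_of_top {ω : Choices} {u v : List ℕ} (hu : u ∈ spine ω)
    (hv : v ∈ spine ω) (htop : (ω v).2.1 = ⊤) : u <+: v := by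
  rcases spine_chain hu hv with h | h
  · exact h
  · by_contra hcon
    obtain ⟨i, hi⟩ := exists_append_prefix h (fun h1 => hcon (h1 ▸ List.prefix_refl _))
    exact (hu v i hi).1 htop

theorem offspring_eq_top_iff {ω : Choices} {u : List ℕ} :
    offspring ω u = ⊤ ↔ u ∈ spine ω ∧ (ω u).2.1 = ⊤ := by
  unfold offspring
  split_ifs with h
  · simp [h]
  · simp [h]

theorem mem_nodes_treeOfOffspring {f : List ℕ → ℕ∞} {v : List ℕ} :
    v ∈ (treeOfOffspring f).nodes ↔ ∀ (u : List ℕ) (i : ℕ), u ++ [i] <+: v → (i : ℕ∞) < f u := by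
  classical
  constructor
  · intro h u i hu
    refine (h u i hu).trans_le ?_
    simp only [treeOfOffspring]
    split_ifs
    · exact le_rfl
    · exact zero_le
  · intro h u i hu
    simp only [treeOfOffspring]
    rw [if_pos fun a j ha => h a j (ha.trans ((List.prefix_append _ _).trans hu))]
    exact h u i hu

theorem deg_treeOfOffspring {f : List ℕ → ℕ∞} {v : List ℕ} (h : v ∈ (treeOfOffspring f).nodes) :
    (treeOfOffspring f).deg v = f v := by
  classical
  exact if_pos (mem_nodes_treeOfOffspring.1 h)

theorem deg_treeOfOffspring_le (f : List ℕ → ℕ∞) (v : List ℕ) :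
    (treeOfOffspring f).deg v ≤ f v := by
  classical
  simp only [treeOfOffspring]
  split_ifs
  · exact le_rfl
  · exact zero_le

theorem mem_spine_of_deg_eq_top {ω : Choices} {u : List ℕ} (h : (modifiedGW ω).deg u = ⊤) :
    u ∈ spine ω ∧ (ω u).2.1 = ⊤ :=
  offspring_eq_top_iff.1 (top_le_iff.1 (h ▸ deg_treeOfOffspring_le (offspring ω) u))

/-- At most one node has infinite outdegree. -/
theorem eq_of_deg_eq_top {ω : Choices} {u v : List ℕ} (hu : (modifiedGW ω).deg u = ⊤)
    (hv : (modifiedGW ω).deg v = ⊤) : u = v := by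
  obtain ⟨h1, h2⟩ := mem_spine_of_deg_eq_top hu
  obtain ⟨h3, h4⟩ := mem_spine_of_deg_eq_top hv
  exact (prefix_of_mem_spine_of_top h1 h3 h4).eq_of_length_le
    (prefix_of_mem_spine_of_top h3 h1 h2).length_le

theorem spine_subset_nodes (ω : Choices) : spine ω ⊆ (modifiedGW ω).nodes := by
  intro v hv
  refine mem_nodes_treeOfOffspring.2 fun u i hu => ?_
  have h1 : u ∈ spine ω := mem_spine_of_prefix ((List.prefix_append _ _).trans hu) hv
  rw [offspring, if_pos h1]
  exact (hv u i hu).2.1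

/-- Either side guarantees that every node of S is present in the tree, by following the path from
the root inside S, so the value 0 outside the tree never interferes on S. The values of D lie in
`ℕ∞` so that one node may have infinite outdegree. -/
theorem forall_deg_treeOfOffspring_eq_iff {S : Finset (List ℕ)} {D : List ℕ → ℕ∞}
    (h : ∀ u i, u ++ [i] ∈ S → u ∈ S ∧ (i : ℕ∞) < D u) (f : List ℕ → ℕ∞) :
    (∀ u ∈ S, (treeOfOffspring f).deg u = D u) ↔ ∀ u ∈ S, f u = D u := by
  have key : ∀ g : List ℕ → ℕ∞, (∀ u ∈ S, g u = D u) → ∀ v ∈ S, ∀ (u : List ℕ) (i : ℕ),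
      u ++ [i] <+: v → (i : ℕ∞) < g u := by
    intro g hg v hv u i hu
    induction v using List.reverseRecOn with
    | nil => simp at hu
    | append_singleton v j ih =>
      obtain ⟨h1, h2⟩ := h v j hv
      rcases List.prefix_concat_iff.1 hu with h3 | h3
      · obtain ⟨rfl, h4⟩ := List.append_inj' h3 rfl
        simp only [List.cons.injEq, and_true] at h4
        rw [h4, hg _ h1]
        exact h2
      · exact ih h1 h3
  constructor
  · intro hf u hu
    rw [← hf u hu]
    exact (deg_treeOfOffspring (key _ hf u hu)).symm
  · intro hf u hu
    rw [← hf u hu]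
    exact deg_treeOfOffspring (mem_nodes_treeOfOffspring.2 (key _ hf u hu))

/-! ### The law of the modified Galton–Watson tree on cylinder sets -/

/-- The index of the child of `u` on the path to `e`. -/
def branch (e u : List ℕ) : ℕ := e.getD u.length 0

theorem branch_eq {e u : List ℕ} {i : ℕ} (h : u ++ [i] <+: e) : branch e u = i := by
  obtain ⟨t, rfl⟩ := h
  simp [branch]

theorem append_branch_prefix {e u : List ℕ} (h : u <+: e) (hne : u ≠ e) :
    u ++ [branch e u] <+: e := by
  obtain ⟨i, hi⟩ := exists_append_prefix h hne
  rwa [branch_eq hi]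

/-- The choices at `u` for which `u` has `d u` children, the spine passing through `e`. -/
def slotBox (d : List ℕ → ℕ) (e u : List ℕ) : Set (ℕ × (ℕ∞ × ℕ)) :=
  open Classical in
  if u <+: e then {x | x.2 = ((d u : ℕ∞), branch e u)} else {x | x.1 = d u}

theorem Consistent.of_prefix_childNodes {S : Finset (List ℕ)} {d : List ℕ → ℕ}
    (h : Consistent S d) {e u : List ℕ} {i : ℕ} (he : e ∈ childNodes S d) (hu : u ++ [i] <+: e) :
    u ∈ S ∧ i < d u := by
  rcases List.eq_nil_or_concat' e with rfl | ⟨a, j, rfl⟩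
  · simp at hu
  · have he' := append_mem_childNodes.1 he
    rcases List.prefix_concat_iff.1 hu with h1 | h1
    · obtain ⟨rfl, h2⟩ := List.append_inj' h1 rfl
      simp only [List.cons.injEq, and_true] at h2
      exact h2 ▸ he'
    · exact h u i (h.mem_of_prefix h1 he'.1)

theorem mem_spine_of_slotBox {S : Finset (List ℕ)} {d : List ℕ → ℕ} (h : Consistent S d)
    {e : List ℕ} (he : e ∈ slots S d) {ω : Choices} (hω : ∀ u ∈ S, ω u ∈ slotBox d e u) :
    e ∈ spine ω := by
  obtain ⟨he1, he2⟩ := Finset.mem_sdiff.1 he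
  intro u i hu
  obtain ⟨h1, h2⟩ := h.of_prefix_childNodes he1 hu
  have h3 := hω u h1
  rw [slotBox, if_pos ((List.prefix_append _ _).trans hu), branch_eq hu] at h3
  rw [h3]
  exact ⟨by simp, Nat.cast_lt.2 h2, rfl⟩

theorem slotBox_disjoint {S : Finset (List ℕ)} {d : List ℕ → ℕ} (h : Consistent S d)
    {e e' : List ℕ} (he : e ∈ slots S d) (he' : e' ∈ slots S d) {ω : Choices}
    (hω : ∀ u ∈ S, ω u ∈ slotBox d e u) (hω' : ∀ u ∈ S, ω u ∈ slotBox d e' u) : e = e' := by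
  have aux : ∀ {a b}, a ∈ slots S d → b ∈ slots S d → a <+: b → a = b := by
    intro a b ha hb hab
    by_contra hne
    obtain ⟨i, hi⟩ := exists_append_prefix hab hne
    exact (Finset.mem_sdiff.1 ha).2 (h.of_prefix_childNodes (Finset.mem_sdiff.1 hb).1 hi).1
  rcases spine_chain (mem_spine_of_slotBox h he hω) (mem_spine_of_slotBox h he' hω') with h1 | h1
  · exact aux he he' h1
  · exact (aux he' he h1).symm

/-- All outdegrees in S are finite, so the spine cannot stop inside S and leaves it through some
slot e. The special nodes of S are then the prefixes of e. -/
theorem Consistent.modifiedGW_mem_cyl_iff {S : Finset (List ℕ)} {d : List ℕ → ℕ}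
    (h : Consistent S d) {ω : Choices} (hv : ω.Valid) :
    modifiedGW ω ∈ cyl S d ↔ ∃ e ∈ slots S d, ∀ u ∈ S, ω u ∈ slotBox d e u := by
  have h0 : modifiedGW ω ∈ cyl S d ↔ ∀ u ∈ S, offspring ω u = d u :=
    forall_deg_treeOfOffspring_eq_iff (D := fun u => (d u : ℕ∞))
      (fun u i hu => ⟨(h u i hu).1, by exact_mod_cast (h u i hu).2⟩) (offspring ω)
  rw [h0]
  constructor
  · intro hd
    classical
    -- The exit slot is the longest spine node among the root and the children of S: if it were in
    -- S, its special child would be longer.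
    obtain ⟨e, he, hmax⟩ := ((childNodes S d).filter (· ∈ spine ω)).exists_max_image List.length
      ⟨[], by simp [nil_mem_childNodes, nil_mem_spine]⟩
    obtain ⟨he1, he2⟩ := Finset.mem_filter.1 he
    have heS : e ∉ S := by
      intro heS
      have h1 := hd e heS
      rw [offspring, if_pos he2] at h1
      have h2 : (ω e).2.1 ≠ ⊤ := by rw [h1]; simp
      have h3 := hv e h2
      have h4 : e ++ [(ω e).2.2] ∈ childNodes S d :=
        append_mem_childNodes.2 ⟨heS, by rw [h1] at h3; exact_mod_cast h3⟩
      have h5 := hmax _ (Finset.mem_filter.2 ⟨h4, append_mem_spine.2 ⟨he2, h2, h3, rfl⟩⟩)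
      simp at h5
    refine ⟨e, Finset.mem_sdiff.2 ⟨he1, heS⟩, fun u hu => ?_⟩
    have h1 := hd u hu
    have hne : u ≠ e := fun h => heS (h ▸ hu)
    rw [slotBox]
    split_ifs with hue
    · rw [offspring, if_pos (mem_spine_of_prefix hue he2)] at h1
      have h2 := he2 u _ (append_branch_prefix hue hne)
      exact Prod.ext h1 h2.2.2.symm
    · rw [offspring, if_neg] at h1
      · exact_mod_cast h1
      · intro hus
        rcases spine_chain hus he2 with h2 | h2
        · exact hue h2
        · exact heS (h.mem_of_prefix h2 hu)
  · rintro ⟨e, he, hω⟩ u hu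
    have hes := mem_spine_of_slotBox h he hω
    have h1 := hω u hu
    rw [slotBox] at h1
    split_ifs at h1 with hue
    · rw [offspring, if_pos (mem_spine_of_prefix hue hes), h1]
    · rw [offspring, if_neg, h1]
      intro hus
      rcases spine_chain hus hes with h2 | h2
      · exact hue h2
      · exact (Finset.mem_sdiff.1 he).2 (h.mem_of_prefix h2 hu)

theorem nodeLaw_slotBox (p : PMF ℕ) (hp : mean p ≤ 1) {S : Finset (List ℕ)} {d : List ℕ → ℕ}
    (h : Consistent S d) {e : List ℕ} (he : e ∈ slots S d) {u : List ℕ} (hu : u ∈ S) :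
    nodeLaw p hp (slotBox d e u) = p (d u) := by
  obtain ⟨he1, he2⟩ := Finset.mem_sdiff.1 he
  rw [slotBox]
  split_ifs with hue
  · have hne : u ≠ e := fun h => he2 (h ▸ hu)
    exact nodeLaw_snd_eq p hp (h.of_prefix_childNodes he1 (append_branch_prefix hue hne)).2
  · exact nodeLaw_fst p hp _

/-- The events for the different exit slots are disjoint, since two slots are never on one path, and
by independence each has probability ∏ π_{d(u)}. -/
theorem choiceMeasure_cyl (p : PMF ℕ) (hp : mean p ≤ 1) {S : Finset (List ℕ)} {d : List ℕ → ℕ}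
    (h : Consistent S d) :
    choiceMeasure p hp {ω | modifiedGW ω ∈ cyl S d} = (slots S d).card * ∏ u ∈ S, p (d u) := by
  have h1 : choiceMeasure p hp {ω | modifiedGW ω ∈ cyl S d} =
      choiceMeasure p hp (⋃ e ∈ slots S d, {ω | ∀ u ∈ S, ω u ∈ slotBox d e u}) := by
    refine measure_congr ?_
    filter_upwards [ae_valid p hp] with ω hω
    refine propext ((h.modifiedGW_mem_cyl_iff hω).trans ?_)
    change _ ↔ ω ∈ ⋃ e ∈ slots S d, {ω | ∀ u ∈ S, ω u ∈ slotBox d e u}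
    simp
  rw [h1, measure_biUnion_finset]
  · rw [Finset.sum_congr rfl fun e he => (choiceMeasure_pi p hp S (slotBox d e)).trans
      (Finset.prod_congr rfl fun u hu => nodeLaw_slotBox p hp h he hu)]
    simp
  · intro e he e' he' hne
    exact Set.disjoint_left.2 fun ω hω hω' => hne (slotBox_disjoint h he he' hω hω')
  · exact fun e _ => measurableSet_pi_choices S _

/-- The trees in which `v` has infinite outdegree and the other nodes `u ∈ S` have outdegree
`d u`. -/
def topCyl (S : Finset (List ℕ)) (d : List ℕ → ℕ) (v : List ℕ) : Set Tree :=
  {T | (∀ u ∈ S, u ≠ v → T.deg u = d u) ∧ T.deg v = ⊤}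

/-- Only a special node can have infinite outdegree, so the spine must run to v and end there. In
contrast to `choiceMeasure_cyl` there is a single way, hence no factor counting slots. -/
theorem choiceMeasure_topCyl (p : PMF ℕ) (hp : mean p ≤ 1) {S : Finset (List ℕ)} {d : List ℕ → ℕ}
    {v : List ℕ} (hv : v ∈ S) {K : ℕ} (h : Consistent S (Function.update d v K)) :
    choiceMeasure p hp {ω | modifiedGW ω ∈ topCyl S d v} =
      (1 - mean p) * ∏ u ∈ S.erase v, p (d u) := by
  classical
  set B : List ℕ → Set (ℕ × (ℕ∞ × ℕ)) := Function.update (slotBox d v) v {x | x.2.1 = ⊤} with hB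
  have hd : ∀ u ∈ S, u ≠ v → ∀ i, u ++ [i] ∈ S → i < d u := by
    intro u _ hne i hi
    have := (h u i hi).2
    rwa [Function.update_of_ne hne] at this
  set D : List ℕ → ℕ∞ := Function.update (fun u => (d u : ℕ∞)) v ⊤ with hD
  have hDS : ∀ u i, u ++ [i] ∈ S → u ∈ S ∧ (i : ℕ∞) < D u := by
    intro u i hu
    refine ⟨(h u i hu).1, ?_⟩
    rcases eq_or_ne u v with rfl | hne
    · simp [hD]
    · simpa [hD, hne] using hd u (h u i hu).1 hne i hu
  have hset : {ω | modifiedGW ω ∈ topCyl S d v} = {ω | ∀ u ∈ S, ω u ∈ B u} := by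
    ext ω
    have h1 : modifiedGW ω ∈ topCyl S d v ↔ ∀ u ∈ S, (modifiedGW ω).deg u = D u := by
      constructor
      · rintro ⟨h2, h3⟩ u hu
        rcases eq_or_ne u v with rfl | hne
        · simpa [hD] using h3
        · simpa [hD, hne] using h2 u hu hne
      · intro h2
        exact ⟨fun u hu hne => by simpa [hD, hne] using h2 u hu, by simpa [hD] using h2 v hv⟩
    refine h1.trans ((forall_deg_treeOfOffspring_eq_iff hDS (offspring ω)).trans ?_)
    constructor
    · intro h2 u hu
      have h3 := h2 v hv
      rw [hD, Function.update_self, offspring_eq_top_iff] at h3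
      rcases eq_or_ne u v with rfl | hne
      · simpa [hB] using h3.2
      · rw [hB, Function.update_of_ne hne, slotBox]
        have h4 := h2 u hu
        rw [hD, Function.update_of_ne hne] at h4
        split_ifs with huv
        · rw [offspring, if_pos (mem_spine_of_prefix huv h3.1)] at h4
          exact Prod.ext h4 (h3.1 u _ (append_branch_prefix huv hne)).2.2.symm
        · rw [offspring, if_neg fun hus => huv (prefix_of_mem_spine_of_top hus h3.1 h3.2)] at h4
          exact_mod_cast h4
    · intro h2
      have hspine : v ∈ spine ω := by
        intro u i hui
        have hne : u ≠ v := by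
          rintro rfl
          have := hui.length_le
          simp at this
        have huS : u ++ [i] ∈ S := h.mem_of_prefix hui hv
        have h3 := h2 u (h u i huS).1
        rw [hB, Function.update_of_ne hne, slotBox, if_pos ((List.prefix_append _ _).trans hui),
          branch_eq hui] at h3
        rw [h3]
        exact ⟨by simp, Nat.cast_lt.2 (hd u (h u i huS).1 hne i huS), rfl⟩
      have htop : (ω v).2.1 = ⊤ := by simpa [hB] using h2 v hv
      intro u hu
      rcases eq_or_ne u v with rfl | hne
      · rw [hD, Function.update_self, offspring_eq_top_iff]
        exact ⟨hspine, htop⟩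
      · have h3 := h2 u hu
        rw [hB, Function.update_of_ne hne, slotBox] at h3
        rw [hD, Function.update_of_ne hne]
        split_ifs at h3 with huv
        · rw [offspring, if_pos (mem_spine_of_prefix huv hspine), h3]
        · rw [offspring, if_neg fun hus => huv (prefix_of_mem_spine_of_top hus hspine htop), h3]
  rw [hset, choiceMeasure_pi, ← Finset.mul_prod_erase S _ hv]
  congr 1
  · rw [hB, Function.update_self, nodeLaw_top]
  · refine Finset.prod_congr rfl fun u hu => ?_
    obtain ⟨hne, huS⟩ := Finset.mem_erase.1 hu
    rw [hB, Function.update_of_ne hne, slotBox]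
    split_ifs with huv
    · have h1 := append_branch_prefix huv hne
      have h2 : u ++ [branch v u] ∈ S := h.mem_of_prefix h1 hv
      exact nodeLaw_snd_eq p hp (hd u huS hne _ h2)
    · exact nodeLaw_fst p hp _

/-- The trees in which `v` has outdegree at least `K` and the other nodes `u ∈ S` have outdegree
`d u`. -/
def geCyl (S : Finset (List ℕ)) (d : List ℕ → ℕ) (v : List ℕ) (K : ℕ) : Set Tree :=
  {T | (∀ u ∈ S, u ≠ v → T.deg u = d u) ∧ (K : ℕ∞) ≤ T.deg v}

theorem mem_cyl_update {S : Finset (List ℕ)} {d : List ℕ → ℕ} {v : List ℕ} (hv : v ∈ S) {k : ℕ}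
    {T : Tree} : T ∈ cyl S (Function.update d v k) ↔
      (∀ u ∈ S, u ≠ v → T.deg u = d u) ∧ T.deg v = k := by
  constructor
  · intro h
    exact ⟨fun u hu hne => by simpa [hne] using h u hu, by simpa using h v hv⟩
  · rintro ⟨h1, h2⟩ u hu
    rcases eq_or_ne u v with rfl | hne
    · simpa using h2
    · simpa [hne] using h1 u hu hne

theorem cyl_update_disjoint {S : Finset (List ℕ)} {d : List ℕ → ℕ} {v : List ℕ} (hv : v ∈ S)
    (K : ℕ) :
    Pairwise (Function.onFun Disjoint fun k : ℕ => cyl S (Function.update d v (K + k))) := by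
  intro k k' hne
  refine Set.disjoint_left.2 fun T hT hT' => hne ?_
  have h1 := ((mem_cyl_update hv).1 hT).2
  rw [((mem_cyl_update hv).1 hT').2] at h1
  have h2 : K + k' = K + k := by exact_mod_cast h1
  omega

theorem geCyl_eq {S : Finset (List ℕ)} {d : List ℕ → ℕ} {v : List ℕ} (hv : v ∈ S) (K : ℕ) :
    geCyl S d v K = topCyl S d v ∪ ⋃ k : ℕ, cyl S (Function.update d v (K + k)) := by
  ext T
  simp only [Set.mem_union, Set.mem_iUnion, mem_cyl_update hv]
  constructor
  · rintro ⟨h1, h2⟩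
    by_cases ht : T.deg v = ⊤
    · exact Or.inl ⟨h1, ht⟩
    · obtain ⟨k, hk⟩ := ENat.ne_top_iff_exists.1 ht
      rw [← hk] at h2
      have h3 : K ≤ k := by exact_mod_cast h2
      exact Or.inr ⟨k - K, h1, by rw [← hk, Nat.add_sub_cancel' h3]⟩
  · rintro (⟨h1, h2⟩ | ⟨k, h1, h2⟩)
    · exact ⟨h1, h2 ▸ le_top⟩
    · exact ⟨h1, by rw [h2]; exact_mod_cast Nat.le_add_right K k⟩

theorem setWeight_geCyl (w : ℕ → ℝ≥0) (n : ℕ) {S : Finset (List ℕ)} {d : List ℕ → ℕ}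
    {v : List ℕ} (hv : v ∈ S) (K : ℕ) :
    setWeight w n (geCyl S d v K) =
      ∑' k : ℕ, setWeight w n (cyl S (Function.update d v (K + k))) := by
  refine setWeight_tsum w n _ _ (cyl_update_disjoint hv K) fun T => ?_
  rw [geCyl_eq hv, Set.mem_union, Set.mem_iUnion]
  exact or_iff_right fun h => T.deg_ne_top v h.2

/-! ### Measurability of the random tree -/

theorem measurable_offspring (u : List ℕ) : Measurable fun ω : Choices => offspring ω u := by
  have hω : ∀ u : List ℕ, Measurable fun ω : Choices => ω u := fun u => measurable_pi_apply u
  unfold offspring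
  refine Measurable.ite ?_ (measurable_fst.comp (measurable_snd.comp (hω u)))
    ((measurable_of_countable fun n : ℕ => (n : ℕ∞)).comp (measurable_fst.comp (hω u)))
  have : {ω : Choices | u ∈ spine ω} = ⋂ (a : List ℕ) (i : ℕ) (_ : a ++ [i] <+: u),
      (fun ω : Choices => ω a) ⁻¹' {x | x.2.1 ≠ ⊤ ∧ (i : ℕ∞) < x.2.1 ∧ i = x.2.2} := by
    ext ω
    simp [spine]
  rw [this]
  exact MeasurableSet.iInter fun a => MeasurableSet.iInter fun i => MeasurableSet.iInter fun _ =>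
    hω a MeasurableSet.of_discrete

instance : BorelSpace ℕ∞ := by
  refine ⟨?_⟩
  refine le_antisymm (fun s _ => ?_) le_top
  have : @MeasurableSingletonClass ℕ∞ (borel ℕ∞) :=
    @MeasurableSingletonClass.mk _ (borel ℕ∞) fun x => @MeasurableSet.of_compl _ _ (borel ℕ∞)
      (MeasurableSpace.measurableSet_generateFrom (isClosed_singleton (x := x)).isOpen_compl)
  exact @Set.Countable.measurableSet _ (borel ℕ∞) this _ (Set.to_countable s)

theorem measurable_modifiedGW : Measurable modifiedGW := by
  have h1 : borel Tree = MeasurableSpace.comap Tree.deg MeasurableSpace.pi := by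
    rw [BorelSpace.measurable_eq (α := List ℕ → ℕ∞), borel_comap]
  have h2 : Measurable (Tree.deg ∘ modifiedGW) := by
    refine measurable_pi_iff.2 fun v => ?_
    change Measurable fun ω => (treeOfOffspring (offspring ω)).deg v
    simp only [treeOfOffspring]
    refine Measurable.ite ?_ (measurable_offspring v) measurable_const
    have : {ω : Choices | ∀ (u : List ℕ) (i : ℕ), u ++ [i] <+: v → (i : ℕ∞) < offspring ω u} =
        ⋂ (u : List ℕ) (i : ℕ) (_ : u ++ [i] <+: v), (fun ω => offspring ω u) ⁻¹' Set.Ioi (i : ℕ∞) := by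
      ext ω
      simp
    rw [this]
    exact MeasurableSet.iInter fun a => MeasurableSet.iInter fun i => MeasurableSet.iInter fun _ =>
      measurable_offspring a MeasurableSet.of_discrete
  change @Measurable _ _ _ (borel Tree) _
  rw [h1]
  exact measurable_comap_iff.2 h2

theorem measurable_deg (v : List ℕ) : Measurable fun T : Tree => T.deg v :=
  ((continuous_apply v).comp isEmbedding_deg.continuous).measurable

theorem measurableSet_cyl (S : Finset (List ℕ)) (d : List ℕ → ℕ) : MeasurableSet (cyl S d) := by
  have : cyl S d = ⋂ u ∈ S, (fun T : Tree => T.deg u) ⁻¹' {(d u : ℕ∞)} := by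
    ext T; simp [cyl]
  rw [this]
  exact Finset.measurableSet_biInter _ fun u _ => measurable_deg u MeasurableSet.of_discrete

theorem choiceMeasure_geCyl (p : PMF ℕ) (hp : mean p ≤ 1) {S : Finset (List ℕ)} {d : List ℕ → ℕ}
    {v : List ℕ} (hv : v ∈ S) {K : ℕ} (h : Consistent S (Function.update d v K)) :
    choiceMeasure p hp {ω | modifiedGW ω ∈ geCyl S d v K} =
      (1 - mean p) * ∏ u ∈ S.erase v, p (d u) +
        ∑' k : ℕ, choiceMeasure p hp {ω | modifiedGW ω ∈ cyl S (Function.update d v (K + k))} := by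
  have hm : ∀ k, MeasurableSet {ω | modifiedGW ω ∈ cyl S (Function.update d v (K + k))} :=
    fun k => measurable_modifiedGW (measurableSet_cyl _ _)
  rw [← choiceMeasure_topCyl p hp hv h, ← measure_iUnion ?_ hm, ← measure_union ?_ (.iUnion hm)]
  · congr 1
    ext ω
    rw [geCyl_eq hv]
    simp
  · refine Set.disjoint_left.2 fun ω h1 h2 => ?_
    obtain ⟨k, hk⟩ := Set.mem_iUnion.1 h2
    have h3 := ((mem_cyl_update hv).1 hk).2
    rw [h1.2] at h3
    exact ENat.natCast_ne_top (K + k) h3.symm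
  · intro k k' hne
    exact Set.disjoint_left.2 fun ω h1 h2 =>
      Set.disjoint_left.1 (cyl_update_disjoint hv K hne) h1 h2

/-! ### Limits of the probabilities of cylinder sets -/

theorem tendsto_natCast_div_natCast_sub {ι : Type*} {l : Filter ι} {N : ι → ℕ}
    (hN : Tendsto N l atTop) (a b : ℕ) :
    Tendsto (fun i => ((N i - a : ℕ) : ℝ) / ((N i - b : ℕ) : ℝ)) l (𝓝 1) := by
  have h : Tendsto (fun n : ℕ => ((n - a : ℕ) : ℝ) / ((n - b : ℕ) : ℝ)) atTop (𝓝 1) := by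
    rw [← tendsto_add_atTop_iff_nat (a + b)]
    have h1 : Tendsto (fun n : ℕ => (1 + (b : ℝ) / n) / (1 + (a : ℝ) / n)) atTop (𝓝 1) := by
      have h2 := fun c : ℝ => (tendsto_const_nhds (x := (1 : ℝ))).add
        (tendsto_const_div_atTop_nhds_zero_nat c)
      have h3 := (h2 b).div (h2 a) (by simp)
      simp only [add_zero, div_one] at h3
      exact h3
    refine h1.congr' ?_
    filter_upwards [eventually_gt_atTop 0] with n hn
    have hn' : (0 : ℝ) < n := by exact_mod_cast hn
    rw [show n + (a + b) - a = n + b by omega, show n + (a + b) - b = n + a by omega]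
    push_cast
    field_simp
  exact h.comp hN

theorem ofReal_prod_toReal {α : Type*} (p : PMF ℕ) (S : Finset α) (d : α → ℕ) :
    ENNReal.ofReal (∏ u ∈ S, (p (d u)).toReal) = ∏ u ∈ S, p (d u) := by
  rw [ENNReal.ofReal_prod_of_nonneg fun _ _ => ENNReal.toReal_nonneg]
  exact Finset.prod_congr rfl fun u _ => ENNReal.ofReal_toReal (p.apply_ne_top _)

theorem prod_coe_eq_ofReal {α : Type*} (w : ℕ → ℝ≥0) (S : Finset α) (d : α → ℕ) :
    ∏ u ∈ S, (w (d u) : ℝ≥0∞) = ENNReal.ofReal (∏ u ∈ S, (w (d u) : ℝ)) := by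
  rw [ENNReal.ofReal_prod_of_nonneg fun _ _ => NNReal.coe_nonneg _]
  simp

section

variable {ι : Type*} {l : Filter ι} {w : ℕ → ℝ≥0} {p : PMF ℕ} {N : ι → ℕ}

theorem eventually_forest_ne_zero (hne : ∀ᶠ i in l, partitionFn w (N i) ≠ 0) :
    ∀ᶠ i in l, forest (fun k => (w k : ℝ)) 1 (N i) ≠ 0 := by
  filter_upwards [hne] with i hi h
  rw [partitionFn_eq, h] at hi
  simp at hi

/-- The Otter–Dwass formula for numerator and denominator leaves n/(n - |S|) times the ratio treated
in `IsLimitOffspring.tendsto`, times the number of slots. -/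
theorem tendsto_setWeight_cyl (hw0 : 0 < w 0)
    (hp : IsLimitOffspring (fun k => (w k : ℝ)) fun k => (p k).toReal)
    (hN : Tendsto N l atTop) (hne : ∀ᶠ i in l, partitionFn w (N i) ≠ 0)
    {S : Finset (List ℕ)} {d : List ℕ → ℕ} (h : Consistent S d) :
    Tendsto (fun i => setWeight w (N i) (cyl S d) / partitionFn w (N i)) l
      (𝓝 ((slots S d).card * ∏ u ∈ S, p (d u))) := by
  set v : ℕ → ℝ := fun k => (w k : ℝ) with hv
  have hv0 : ∀ k, 0 ≤ v k := fun k => NNReal.coe_nonneg _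
  have hne' := eventually_forest_ne_zero hne
  have hQ := hp.tendsto hv0 (by exact_mod_cast hw0) hN hne' S d
  have hlim := ((tendsto_natCast_div_natCast_sub hN 0 S.card).mul hQ).const_mul
    ((slots S d).card : ℝ)
  rw [one_mul] at hlim
  have hlim' := ENNReal.tendsto_ofReal hlim
  rw [ENNReal.ofReal_mul (by positivity), ofReal_prod_toReal, ENNReal.ofReal_natCast] at hlim'
  refine hlim'.congr' ?_
  filter_upwards [hne', hN.eventually_ge_atTop (1 + S.card + (slots S d).card)] with i h1 h2
  obtain ⟨m, hm⟩ : ∃ m, N i = S.card + m := ⟨N i - S.card, by omega⟩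
  have h3 := h.card_slots
  have h4 := mul_forest v (r := (slots S d).card) (m := m) (by omega)
  have h5 := mul_forest_one v (n := N i) (by omega)
  have hpos : 0 < forest v 1 (N i) := (forest_nonneg hv0 _ _).lt_of_ne' h1
  have hN0 : (0 : ℝ) < N i := by exact_mod_cast (by omega : 0 < N i)
  have hm0 : (0 : ℝ) < m := by exact_mod_cast (by omega : 0 < m)
  have h6 : setWeight w (N i) (cyl S d) =
      ENNReal.ofReal ((∏ u ∈ S, v (d u)) * forest v (slots S d).card m) := by
    rw [hm, setWeight_cyl w m h, prod_coe_eq_ofReal, ENNReal.ofReal_mul]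
    exact Finset.prod_nonneg fun _ _ => hv0 _
  rw [h6, partitionFn_eq, ← ENNReal.ofReal_div_of_pos hpos]
  congr 1
  rw [Nat.sub_zero, show N i - S.card = m by omega, ← h5,
    show N i - 1 - ∑ u ∈ S, d u = m - (slots S d).card by omega]
  field_simp
  linear_combination -(∏ u ∈ S, v (d u)) * h4

/-- A sum over all outdegrees j ≥ K is rewritten as the sum over all j minus K terms. After
Otter–Dwass the summand carries the factor r - K + j, affine in j, so the full sum follows from the
total weight and the mean of an entry. This avoids a limit under an infinite sum, where mass may
escape. -/
theorem sum_mul_forest_shift (v : ℕ → ℝ) {r m K : ℕ} (hr : r ≤ m) :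
    (m : ℝ) * ∑ k ∈ Finset.range (m - r + 1), v (K + k) * forest v (r + k) m =
      ((r : ℝ) - K + ((m - r + K : ℕ) : ℝ) / (m + 1)) * powCoeff v (m + 1) (m - r + K) -
        ∑ j ∈ Finset.range K, ((r : ℝ) - K + j) * (v j * powCoeff v m (m - r + K - j)) := by
  have h1 := sum_mul_powCoeff v m (m - r + K)
  have h2 := powCoeff_succ v m (m - r + K)
  set M := m - r + K with hM
  have h3 : ∑ j ∈ Finset.range (M + 1), ((r : ℝ) - K + j) * (v j * powCoeff v m (M - j)) =
      ((r : ℝ) - K + (M : ℝ) / (m + 1)) * powCoeff v (m + 1) M := by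
    have h4 : ∑ j ∈ Finset.range (M + 1), (j : ℝ) * (v j * powCoeff v m (M - j)) =
        (M : ℝ) / (m + 1) * powCoeff v (m + 1) M := by
      rw [div_mul_eq_mul_div, eq_div_iff (by positivity), ← h1]
      ring
    rw [add_mul, h2, ← h2, ← h4, h2, Finset.mul_sum, ← Finset.sum_add_distrib]
    exact Finset.sum_congr rfl fun j _ => by ring
  rw [← h3, show M + 1 = K + (m - r + 1) by omega, Finset.sum_range_add _ K, add_sub_cancel_left,
    Finset.mul_sum]
  refine Finset.sum_congr rfl fun k hk => ?_
  have hk' : r + k ≤ m := by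
    simp only [Finset.mem_range] at hk
    omega
  have h5 := mul_forest v hk'
  rw [show M - (K + k) = m - (r + k) by omega]
  push_cast at h5 ⊢
  linear_combination v (K + k) * h5

theorem prod_update_eq {S : Finset (List ℕ)} {v : List ℕ} (hv : v ∈ S) {M : Type*} [CommMonoid M]
    (f : ℕ → M) (d : List ℕ → ℕ) (k : ℕ) :
    ∏ u ∈ S, f (Function.update d v k u) = f k * ∏ u ∈ S.erase v, f (d u) := by
  rw [← Finset.mul_prod_erase S _ hv, Function.update_self]
  congr 1
  exact Finset.prod_congr rfl fun u hu => by rw [Function.update_of_ne (Finset.ne_of_mem_erase hu)]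

theorem sum_update_eq {S : Finset (List ℕ)} {v : List ℕ} (hv : v ∈ S) (d : List ℕ → ℕ) (k : ℕ) :
    ∑ u ∈ S, Function.update d v k u = k + ∑ u ∈ S.erase v, d u := by
  rw [← Finset.add_sum_erase S _ hv, Function.update_self]
  congr 1
  exact Finset.sum_congr rfl fun u hu => by rw [Function.update_of_ne (Finset.ne_of_mem_erase hu)]

theorem Consistent.update_add {S : Finset (List ℕ)} {d : List ℕ → ℕ} {v : List ℕ} {K : ℕ}
    (h : Consistent S (Function.update d v K)) (k : ℕ) :
    Consistent S (Function.update d v (K + k)) := by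
  intro u i hu
  obtain ⟨h1, h2⟩ := h u i hu
  refine ⟨h1, ?_⟩
  rcases eq_or_ne u v with rfl | hne
  · simp only [Function.update_self] at h2 ⊢
    omega
  · simpa [hne] using h2

theorem Consistent.card_slots_update_add {S : Finset (List ℕ)} {d : List ℕ → ℕ} {v : List ℕ}
    (hv : v ∈ S) {K : ℕ} (h : Consistent S (Function.update d v K)) (k : ℕ) :
    (slots S (Function.update d v (K + k))).card = (slots S (Function.update d v K)).card + k := by
  have h1 := h.card_slots
  have h2 := (h.update_add k).card_slots
  rw [sum_update_eq hv] at h1 h2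
  omega

theorem hasSum_toReal_mass (p : PMF ℕ) : HasSum (fun k => (p k).toReal) 1 := by
  have h1 := ENNReal.hasSum_toReal (f := p) (by rw [p.tsum_coe]; simp)
  rwa [← ENNReal.tsum_toReal_eq p.apply_ne_top, p.tsum_coe] at h1

theorem hasSum_toReal_mean (p : PMF ℕ) (hp : mean p ≠ ⊤) :
    HasSum (fun k : ℕ => k * (p k).toReal) (mean p).toReal := by
  have h1 := ENNReal.hasSum_toReal (f := fun k : ℕ => (k : ℝ≥0∞) * p k) hp
  rw [← ENNReal.tsum_toReal_eq (fun k => ENNReal.mul_ne_top (by simp) (p.apply_ne_top k))] at h1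
  simpa [mean] using h1

/-- The series ∑ (c + j)π_j equals c + μ, and the atom 1 - μ at infinity raises this to c + 1. So μ
disappears, in agreement with the mean entry tending to 1 on the side of the finite trees. -/
theorem choiceMeasure_geCyl_eq_ofReal (hmean : mean p ≤ 1)
    {S : Finset (List ℕ)} {d : List ℕ → ℕ} {v : List ℕ} (hv : v ∈ S) {K : ℕ}
    (h : Consistent S (Function.update d v K)) {c : ℝ}
    (hc : c = (slots S (Function.update d v K)).card - K) :
    choiceMeasure p hmean {ω | modifiedGW ω ∈ geCyl S d v K} =
      ENNReal.ofReal ((c + 1) * ∏ u ∈ S.erase v, (p (d u)).toReal -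
        ∑ j ∈ Finset.range K, (c + j) * ∏ u ∈ S, (p (Function.update d v j u)).toReal) := by
  have hmt : mean p ≠ ⊤ := ne_top_of_le_ne_top (by simp) hmean
  set P := ∏ u ∈ S.erase v, (p (d u)).toReal with hP
  have hP0 : 0 ≤ P := Finset.prod_nonneg fun _ _ => ENNReal.toReal_nonneg
  have hμ : (mean p).toReal ≤ 1 := ENNReal.toReal_le_of_le_ofReal zero_le_one (by simpa using hmean)
  have hsum : HasSum (fun j : ℕ => (c + j) * (p j).toReal) (c + (mean p).toReal) := by
    have := ((hasSum_toReal_mass p).mul_left c).add (hasSum_toReal_mean p hmt)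
    simpa [add_mul] using this
  have hshift := (hasSum_nat_add_iff' K).2 hsum
  have hcast : ∀ k : ℕ, c + (k + K : ℕ) = ((slots S (Function.update d v K)).card + k : ℕ) := by
    intro k
    rw [hc]; push_cast; ring
  have hterm : ∀ k : ℕ, choiceMeasure p hmean
      {ω | modifiedGW ω ∈ cyl S (Function.update d v (K + k))} =
      ENNReal.ofReal ((c + (k + K : ℕ)) * (p (k + K)).toReal) * ENNReal.ofReal P := by
    intro k
    rw [choiceMeasure_cyl p hmean (h.update_add k), h.card_slots_update_add hv, hcast,
      prod_update_eq hv p, ENNReal.ofReal_mul (by positivity), ENNReal.ofReal_natCast,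
      ENNReal.ofReal_toReal (p.apply_ne_top _), hP, ofReal_prod_toReal, add_comm K k, mul_assoc]
  rw [choiceMeasure_geCyl p hmean hv h]
  simp only [hterm]
  have hnn : ∀ k : ℕ, 0 ≤ (c + (k + K : ℕ)) * (p (k + K)).toReal := fun k => by
    rw [hcast]; positivity
  rw [ENNReal.tsum_mul_right, ← ENNReal.ofReal_tsum_of_nonneg hnn hshift.summable, hshift.tsum_eq,
    ← ofReal_prod_toReal, ← hP]
  have h1 : 1 - mean p = ENNReal.ofReal (1 - (mean p).toReal) := by
    rw [ENNReal.ofReal_sub _ ENNReal.toReal_nonneg, ENNReal.ofReal_one, ENNReal.ofReal_toReal hmt]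
  have h2 : 0 ≤ c + (mean p).toReal - ∑ j ∈ Finset.range K, (c + j) * (p j).toReal := by
    rw [← hshift.tsum_eq]
    exact tsum_nonneg hnn
  rw [h1, ← add_mul, ← ENNReal.ofReal_add (by linarith) h2,
    ← ENNReal.ofReal_mul (by linarith)]
  congr 1
  have h3 : ∀ j, ∏ u ∈ S, (p (Function.update d v j u)).toReal = (p j).toReal * P := fun j =>
    prod_update_eq hv (fun k => (p k).toReal) d j
  simp only [h3]
  have h4 : ∑ j ∈ Finset.range K, (c + j) * ((p j).toReal * P) =
      (∑ j ∈ Finset.range K, (c + j) * (p j).toReal) * P := by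
    rw [Finset.sum_mul]
    exact Finset.sum_congr rfl fun j _ => by ring
  rw [h4]
  ring

theorem setWeight_geCyl_eq_ofReal {S : Finset (List ℕ)} {d : List ℕ → ℕ} {v : List ℕ}
    (hv : v ∈ S) {K : ℕ} (h : Consistent S (Function.update d v K)) {m : ℕ}
    (hm : (slots S (Function.update d v K)).card ≤ m) :
    setWeight w (S.card + m) (geCyl S d v K) =
      ENNReal.ofReal ((∏ u ∈ S.erase v, (w (d u) : ℝ)) *
        ∑ k ∈ Finset.range (m - (slots S (Function.update d v K)).card + 1),
          w (K + k) * forest (fun k => (w k : ℝ)) ((slots S (Function.update d v K)).card + k) m) := by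
  have hnn : ∀ r, 0 ≤ forest (fun k => (w k : ℝ)) r m :=
    fun r => forest_nonneg (fun k => NNReal.coe_nonneg _) _ _
  have hP : 0 ≤ ∏ u ∈ S.erase v, (w (d u) : ℝ) := Finset.prod_nonneg fun _ _ => NNReal.coe_nonneg _
  rw [setWeight_geCyl w _ hv]
  have hterm : ∀ k : ℕ, setWeight w (S.card + m) (cyl S (Function.update d v (K + k))) =
      ENNReal.ofReal ((∏ u ∈ S.erase v, (w (d u) : ℝ)) * (w (K + k) *
        forest (fun k => (w k : ℝ)) ((slots S (Function.update d v K)).card + k) m)) := by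
    intro k
    rw [setWeight_cyl w m (h.update_add k), h.card_slots_update_add hv, prod_coe_eq_ofReal,
      ← ENNReal.ofReal_mul (Finset.prod_nonneg fun _ _ => NNReal.coe_nonneg _),
      prod_update_eq hv (fun k => (w k : ℝ))]
    congr 1
    ring
  simp only [hterm]
  rw [tsum_eq_sum (s := Finset.range (m - (slots S (Function.update d v K)).card + 1)),
    Finset.mul_sum, ENNReal.ofReal_sum_of_nonneg]
  · exact fun k _ => mul_nonneg hP (mul_nonneg (NNReal.coe_nonneg _) (hnn _))
  · intro k hk
    rw [Finset.mem_range, not_lt] at hk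
    rw [forest_eq_zero _ (by omega)]
    simp

theorem tendsto_setWeight_geCyl (hw0 : 0 < w 0)
    (hp : IsLimitOffspring (fun k => (w k : ℝ)) fun k => (p k).toReal) (hmean : mean p ≤ 1)
    (hN : Tendsto N l atTop) (hne : ∀ᶠ i in l, partitionFn w (N i) ≠ 0)
    {S : Finset (List ℕ)} {d : List ℕ → ℕ} {v : List ℕ} (hv : v ∈ S) {K : ℕ}
    (h : Consistent S (Function.update d v K)) :
    Tendsto (fun i => setWeight w (N i) (geCyl S d v K) / partitionFn w (N i)) l
      (𝓝 (choiceMeasure p hmean {ω | modifiedGW ω ∈ geCyl S d v K})) := by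
  set a : ℕ → ℝ := fun k => (w k : ℝ) with ha
  have ha0 : ∀ k, 0 ≤ a k := fun k => NNReal.coe_nonneg _
  have hne' := eventually_forest_ne_zero hne
  set r := (slots S (Function.update d v K)).card with hr
  set c : ℝ := r - K with hc
  set s := ∑ u ∈ S.erase v, d u with hs
  have hcard : (S.erase v).card + 1 = S.card := Finset.card_erase_add_one hv
  have h3 := h.card_slots
  rw [sum_update_eq hv, ← hr, ← hs] at h3
  have hQ1 := hp.tendsto ha0 (by exact_mod_cast hw0) hN hne' (S.erase v) d
  have hQ2 := fun j => hp.tendsto ha0 (by exact_mod_cast hw0) hN hne' S (Function.update d v j)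
  -- The second quotient is the mean of an entry in the sequence of length N - (|S| - 1) left when
  -- all nodes of S other than v are fixed; it tends to 1 whatever μ is.
  have hlim := (tendsto_natCast_div_natCast_sub hN 0 S.card).mul
    ((((tendsto_natCast_div_natCast_sub hN (1 + s) (S.erase v).card).const_add c).mul hQ1).sub
      (tendsto_finsetSum (Finset.range K) fun j _ => (hQ2 j).const_mul (c + j)))
  rw [one_mul] at hlim
  rw [choiceMeasure_geCyl_eq_ofReal hmean hv h hc]
  refine (ENNReal.tendsto_ofReal hlim).congr' ?_
  filter_upwards [hne', hN.eventually_ge_atTop (1 + S.card + r)] with i h1 h2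
  obtain ⟨m, hm⟩ : ∃ m, N i = S.card + m := ⟨N i - S.card, by omega⟩
  have hrm : r ≤ m := by omega
  have hpos : 0 < forest a 1 (N i) := (forest_nonneg ha0 _ _).lt_of_ne' h1
  have h5 := mul_forest_one a (n := N i) (by omega)
  have hN0 : (0 : ℝ) < N i := by exact_mod_cast (by omega : 0 < N i)
  have hm0 : (0 : ℝ) < m := by exact_mod_cast (by omega : 0 < m)
  have h6 := setWeight_geCyl_eq_ofReal (w := w) hv h hrm
  have h7 := sum_mul_forest_shift a (K := K) hrm
  rw [← hm] at h6
  rw [h6, partitionFn_eq, ← ENNReal.ofReal_div_of_pos hpos]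
  congr 1
  rw [← hr, Nat.sub_zero, show N i - S.card = m by omega, ← h5,
    show N i - (1 + s) = m - r + K by omega, show N i - (S.erase v).card = m + 1 by omega,
    show N i - 1 - s = m - r + K by omega]
  have h8 : ∀ j, (∏ u ∈ S, a (Function.update d v j u)) = a j * ∏ u ∈ S.erase v, a (d u) :=
    fun j => prod_update_eq hv a d j
  have h9 : ∀ j, N i - 1 - ∑ u ∈ S, Function.update d v j u = m - r + K - j := by
    intro j
    rw [sum_update_eq hv]
    omega
  simp only [h8, h9]
  set P := ∏ u ∈ S.erase v, a (d u) with hP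
  have h10 : ∑ j ∈ Finset.range K, (c + j) *
      (a j * P * powCoeff a m (m - r + K - j) / (N i * forest a 1 (N i))) =
      P * (∑ j ∈ Finset.range K, (c + j) * (a j * powCoeff a m (m - r + K - j))) /
        (N i * forest a 1 (N i)) := by
    rw [Finset.mul_sum, Finset.sum_div]
    exact Finset.sum_congr rfl fun j _ => by ring
  rw [h10]
  change _ = P * (∑ k ∈ Finset.range (m - r + 1), a (K + k) * forest a (r + k) m) / _
  set G := ∑ k ∈ Finset.range (m - r + 1), a (K + k) * forest a (r + k) m with hG
  rw [← hc] at h7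
  push_cast at h7 ⊢
  have h11 : (N i : ℝ) / m * ((c + (((m - r : ℕ) : ℝ) + K) / (m + 1)) *
      (P * powCoeff a (m + 1) (m - r + K) / (N i * forest a 1 (N i))) -
      P * (∑ j ∈ Finset.range K, (c + j) * (a j * powCoeff a m (m - r + K - j))) /
        (N i * forest a 1 (N i))) = P * (m * G) / (m * forest a 1 (N i)) := by
    rw [h7]
    field_simp
  rw [h11]
  field_simp

end

/-! ### Weak convergence from cylinder sets -/

theorem finite_setOf_box (m : ℕ) : {v : List ℕ | v.length < m ∧ ∀ x ∈ v, x < m}.Finite := by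
  refine ((List.finite_length_lt (Fin m) m).image (List.map Fin.val)).subset ?_
  rintro v ⟨h1, h2⟩
  exact ⟨v.pmap (fun x hx => ⟨x, hx⟩) h2, by simpa using h1, by simp [List.map_pmap]⟩

/-- The strings of length less than `m` with entries less than `m`. -/
def box (m : ℕ) : Finset (List ℕ) := (finite_setOf_box m).toFinset

theorem mem_box {m : ℕ} {v : List ℕ} : v ∈ box m ↔ v.length < m ∧ ∀ x ∈ v, x < m := by
  simp [box]

theorem append_mem_box {m : ℕ} {v : List ℕ} {i : ℕ} (h : v ++ [i] ∈ box m) : v ∈ box m ∧ i < m := by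
  simp only [mem_box, List.length_append, List.length_singleton, List.mem_append,
    List.mem_singleton] at *
  exact ⟨⟨by omega, fun x hx => h.2 x (Or.inl hx)⟩, h.2 i (Or.inr rfl)⟩

theorem box_mono {m m' : ℕ} (h : m ≤ m') : box m ⊆ box m' := by
  intro v hv
  rw [mem_box] at *
  exact ⟨by omega, fun x hx => (hv.2 x hx).trans_le h⟩

theorem eventually_mem_box (v : List ℕ) : ∀ᶠ m in atTop, v ∈ box m := by
  filter_upwards [eventually_ge_atTop (v.length + v.sum + 1)] with m hm
  refine mem_box.2 ⟨by omega, fun x hx => ?_⟩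
  have := List.le_sum_of_mem hx
  omega

/-- The trees with the same outdegrees as `T` in `box m`, outdegrees being truncated at `K`. -/
def cell (m K : ℕ) (T : Tree) : Set Tree :=
  {T' | ∀ u ∈ box m, min (T'.deg u) K = min (T.deg u) K}

theorem cell_subset_cell {m m' K K' : ℕ} (hm : m ≤ m') (hK : K ≤ K') (T : Tree) :
    cell m' K' T ⊆ cell m K T := by
  intro T' hT' u hu
  have h1 := congrArg (fun x => min x (K : ℕ∞)) (hT' u (box_mono hm hu))
  have h2 : (K : ℕ∞) ≤ K' := by exact_mod_cast hK
  simpa [min_assoc, min_eq_right h2] using h1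

/-- Children in `box m` have index below m ≤ K, so truncation at K does not hide them. Agreement on
the nodes of T in the box therefore gives both trees the same nodes there. -/
theorem mem_cell_iff {m K : ℕ} (hmK : m ≤ K) {T T' : Tree} :
    T' ∈ cell m K T ↔ ∀ u ∈ box m, u ∈ T.nodes → min (T'.deg u) K = min (T.deg u) K := by
  refine ⟨fun h u hu _ => h u hu, fun h u hu => ?_⟩
  have key : ∀ u ∈ box m, u ∈ T'.nodes → u ∈ T.nodes := by
    intro u
    induction u using List.reverseRecOn with
    | nil => exact fun _ _ => T.nil_mem_nodes
    | append_singleton a i ih =>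
      intro hu hu'
      obtain ⟨h1, h2⟩ := append_mem_box hu
      obtain ⟨h3, h4⟩ := Tree.append_mem_nodes.1 hu'
      have h5 := ih h1 h3
      refine Tree.append_mem_nodes.2 ⟨h5, ?_⟩
      have h6 : (i : ℕ∞) < min (T'.deg a) K := lt_min h4 (by exact_mod_cast h2.trans_le hmK)
      rw [h a h1 h5] at h6
      exact h6.trans_le (min_le_left _ _)
  by_cases hT : u ∈ T.nodes
  · exact h u hu hT
  · rw [T.deg_eq_zero_of_notMem u hT, T'.deg_eq_zero_of_notMem u fun h' => hT (key u hu h')]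

/-- The trees with two nodes in `box m` of outdegree at least `K`. -/
def badTrees (m K : ℕ) : Set Tree :=
  {T | ∃ p ∈ (box m).offDiag, (K : ℕ∞) ≤ T.deg p.1 ∧ (K : ℕ∞) ≤ T.deg p.2}

theorem min_eq_coe_iff {x : ℕ∞} {k K : ℕ} (h : k < K) : min x (K : ℕ∞) = k ↔ x = k := by
  have hk : (k : ℕ∞) < K := by exact_mod_cast h
  constructor
  · intro hx
    rcases min_choice x (K : ℕ∞) with h1 | h1
    · rw [← h1, hx]
    · rw [h1] at hx
      exact absurd hx.symm hk.ne
  · rintro rfl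
    exact min_eq_left hk.le

/-- Outside the bad trees at most one node in the box has a truncated outdegree, and all other
outdegrees are determined exactly. -/
theorem cell_eq {m K : ℕ} (hmK : m < K) {T : Tree} (hT : T ∉ badTrees m K) :
    (∃ S d, Consistent S d ∧ cell m K T = cyl S d) ∨
      ∃ S d v, v ∈ S ∧ Consistent S (Function.update d v K) ∧ cell m K T = geCyl S d v K := by
  classical
  set S := (box m).filter (· ∈ T.nodes) with hS
  set d : List ℕ → ℕ := fun u => (T.deg u).toNat with hd
  have hdT : ∀ u, T.deg u < K → T.deg u = d u := fun u hu =>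
    (ENat.natCast_toNat (ne_top_of_lt hu)).symm
  have hSapp : ∀ u i, u ++ [i] ∈ S → u ∈ S ∧ i < m ∧ (i : ℕ∞) < T.deg u := by
    intro u i hu
    obtain ⟨h1, h2⟩ := Finset.mem_filter.1 hu
    obtain ⟨h3, h4⟩ := append_mem_box h1
    obtain ⟨h5, h6⟩ := Tree.append_mem_nodes.1 h2
    exact ⟨Finset.mem_filter.2 ⟨h3, h5⟩, h4, h6⟩
  have hcell : ∀ T', T' ∈ cell m K T ↔ ∀ u ∈ S, min (T'.deg u) K = min (T.deg u) K := by
    intro T'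
    rw [mem_cell_iff hmK.le]
    simp only [hS, Finset.mem_filter, and_imp]
  have hsmall : ∀ u, T.deg u < K → ∀ T' : Tree,
      (min (T'.deg u) K = min (T.deg u) K ↔ T'.deg u = d u) := by
    intro u hu T'
    rw [min_eq_left hu.le, hdT u hu]
    refine min_eq_coe_iff ?_
    rw [hdT u hu] at hu
    exact_mod_cast hu
  by_cases hex : ∃ v ∈ S, (K : ℕ∞) ≤ T.deg v
  · obtain ⟨v, hvS, hv⟩ := hex
    have hother : ∀ u ∈ S, u ≠ v → T.deg u < K := by
      intro u hu hne
      by_contra hcon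
      exact hT ⟨(u, v), Finset.mem_offDiag.2 ⟨(Finset.mem_filter.1 hu).1,
        (Finset.mem_filter.1 hvS).1, hne⟩, not_lt.1 hcon, hv⟩
    refine Or.inr ⟨S, d, v, hvS, ?_, ?_⟩
    · intro u i hu
      obtain ⟨h1, h2, h3⟩ := hSapp u i hu
      refine ⟨h1, ?_⟩
      rcases eq_or_ne u v with rfl | hne
      · simpa using h2.trans hmK
      · rw [Function.update_of_ne hne]
        rw [hdT u (hother u h1 hne)] at h3
        exact_mod_cast h3
    · ext T'
      rw [hcell]
      constructor
      · intro h
        refine ⟨fun u hu hne => (hsmall u (hother u hu hne) T').1 (h u hu), ?_⟩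
        have := h v hvS
        rw [min_eq_right hv] at this
        exact min_eq_right_iff.1 this
      · rintro ⟨h1, h2⟩ u hu
        rcases eq_or_ne u v with rfl | hne
        · rw [min_eq_right hv, min_eq_right h2]
        · exact (hsmall u (hother u hu hne) T').2 (h1 u hu hne)
  · push Not at hex
    refine Or.inl ⟨S, d, ?_, ?_⟩
    · intro u i hu
      obtain ⟨h1, h2, h3⟩ := hSapp u i hu
      refine ⟨h1, ?_⟩
      rw [hdT u (hex u h1)] at h3
      exact_mod_cast h3
    · ext T'
      rw [hcell]
      exact forall₂_congr fun u hu => hsmall u (hex u hu) T'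

/-- The truncated outdegrees in `box m`. -/
def truncDeg (m K : ℕ) (T : Tree) : box m → Fin (K + 1) := fun u =>
  ⟨(min (T.deg u) K).toNat, by
    have h : min (T.deg u) (K : ℕ∞) ≤ K := min_le_right _ _
    have := ENat.toNat_le_toNat h (ENat.natCast_ne_top K)
    rw [ENat.toNat_natCast] at this
    omega⟩

theorem truncDeg_eq_iff {m K : ℕ} {T T' : Tree} :
    truncDeg m K T' = truncDeg m K T ↔ T' ∈ cell m K T := by
  have hne : ∀ x : ℕ∞, min x (K : ℕ∞) ≠ ⊤ := fun x =>
    ne_top_of_le_ne_top (ENat.natCast_ne_top K) (min_le_right _ _)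
  simp only [funext_iff, truncDeg, Fin.mk.injEq, Subtype.forall, cell, Set.mem_ofPred_eq]
  refine forall₂_congr fun u _ => ⟨fun h => ?_, fun h => by rw [h]⟩
  rw [← ENat.natCast_toNat (hne (T'.deg u)), h, ENat.natCast_toNat (hne _)]

theorem measurableSet_cell (m K : ℕ) (T : Tree) : MeasurableSet (cell m K T) := by
  have : cell m K T = ⋂ u ∈ box m, (fun T : Tree => T.deg u) ⁻¹'
      {x | min x (K : ℕ∞) = min (T.deg u) K} := by
    ext; simp [cell]
  rw [this]
  exact Finset.measurableSet_biInter _ fun u _ => measurable_deg u MeasurableSet.of_discrete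

/-- A basic neighbourhood restricts finitely many outdegrees. A neighbourhood of a finite value
contains that value, one of infinity contains a tail, and both conditions can be read off after
truncation at a high level. -/
theorem exists_cell_subset {G : Set Tree} (hG : IsOpen G) {T : Tree} (hT : T ∈ G) :
    ∃ m, cell m (m + 1) T ⊆ G := by
  obtain ⟨V, hV, rfl⟩ := isOpen_induced_iff.1 hG
  obtain ⟨I, U, hU, hIV⟩ := isOpen_pi_iff.1 hV T.deg hT
  have hev : ∀ u ∈ I, ∀ᶠ m : ℕ in atTop, u ∈ box m ∧
      ∀ y : ℕ∞, min y (m + 1 : ℕ) = min (T.deg u) (m + 1 : ℕ) → y ∈ U u := by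
    intro u hu
    refine (eventually_mem_box u).and ?_
    obtain ⟨h1, h2⟩ := hU u hu
    by_cases htop : T.deg u = ⊤
    · rw [htop] at h2 ⊢
      obtain ⟨a, ha, hsub⟩ := (nhds_top_basis (α := ℕ∞)).mem_iff.1 (h1.mem_nhds h2)
      obtain ⟨k, rfl⟩ := ENat.ne_top_iff_exists.1 ha.ne
      filter_upwards [eventually_ge_atTop k] with m hm y hy
      rw [min_eq_right le_top, min_eq_right_iff] at hy
      refine hsub (lt_of_lt_of_le ?_ hy)
      exact_mod_cast Nat.lt_succ_of_le hm
    · obtain ⟨k, hk⟩ := ENat.ne_top_iff_exists.1 htop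
      rw [← hk] at h2 ⊢
      filter_upwards [eventually_ge_atTop k] with m hm y hy
      have h3 : (k : ℕ∞) ≤ (m + 1 : ℕ) := Nat.cast_le.2 (Nat.le_succ_of_le hm)
      rw [min_eq_left h3, min_eq_coe_iff (Nat.lt_succ_of_le hm)] at hy
      rwa [hy]
  obtain ⟨m, hm⟩ := (I.eventually_all.2 hev).exists
  refine ⟨m, fun T' hT' => hIV fun u hu => ?_⟩
  exact (hm u hu).2 _ (hT' u (hm u hu).1)

/-- The portmanteau criterion for open sets. An open set is exhausted by sets whose good part is
covered by finitely many cells contained in the open set, and each of these cells is of one of the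
two kinds with convergent probabilities. Convergence for two simultaneously large outdegrees is
never needed, as this has small limit probability. -/
theorem le_liminf_of_tendsto_cyl {ι : Type*} {l : Filter ι} [l.NeBot] {P : Measure Tree}
    [IsFiniteMeasure P] {Q : ι → Measure Tree}
    (hcyl : ∀ S d, Consistent S d → Tendsto (fun i => Q i (cyl S d)) l (𝓝 (P (cyl S d))))
    (hge : ∀ S d v K, v ∈ S → Consistent S (Function.update d v K) →
      Tendsto (fun i => Q i (geCyl S d v K)) l (𝓝 (P (geCyl S d v K))))
    (htop : ∀ u v, u ≠ v → P {T | T.deg u = ⊤ ∧ T.deg v = ⊤} = 0) {G : Set Tree}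
    (hG : IsOpen G) : P G ≤ liminf (fun i => Q i G) l := by
  classical
  set G' : ℕ → Set Tree := fun m => {T | cell m (m + 1) T ⊆ G} with hG'
  have hunion : G = ⋃ m, G' m := by
    refine Subset.antisymm (fun T hT => mem_iUnion.2 (exists_cell_subset hG hT)) ?_
    refine iUnion_subset fun m T hT => hT ?_
    exact fun u _ => rfl
  have hmono : Monotone G' := monotone_nat_of_le_succ fun m T hT =>
    (cell_subset_cell (Nat.le_succ m) (Nat.le_succ _) T).trans hT
  rw [show P G = ⨆ m, P (G' m) by rw [← hmono.measure_iUnion, ← hunion]]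
  refine iSup_le fun m => ?_
  -- The truncation level K is independent of m: m fixes the part of G being covered, and K is sent
  -- to infinity afterwards to remove the bad trees.
  have hgood : ∀ K, m < K → P (G' m \ badTrees m K) ≤ liminf (fun i => Q i G) l := by
    intro K hK
    set X : Finset (box m → Fin (K + 1)) :=
      Finset.univ.filter fun x => ∃ T ∈ G' m \ badTrees m K, truncDeg m K T = x with hX
    have hXcell : ∀ x ∈ X, ∃ T ∈ G' m \ badTrees m K, truncDeg m K ⁻¹' {x} = cell m K T := by
      intro x hx
      obtain ⟨T, hT, rfl⟩ := (Finset.mem_filter.1 hx).2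
      exact ⟨T, hT, by ext T'; exact truncDeg_eq_iff⟩
    have hmeas : ∀ x ∈ X, MeasurableSet (truncDeg m K ⁻¹' {x}) := by
      intro x hx
      obtain ⟨T, -, h⟩ := hXcell x hx
      rw [h]
      exact measurableSet_cell _ _ _
    have hdisj : Set.PairwiseDisjoint (X : Set (box m → Fin (K + 1)))
        fun x => truncDeg m K ⁻¹' {x} := by
      intro x _ y _ hxy
      exact Disjoint.preimage _ (Set.disjoint_singleton.2 hxy)
    have hlim : ∀ x ∈ X, Tendsto (fun i => Q i (truncDeg m K ⁻¹' {x})) l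
        (𝓝 (P (truncDeg m K ⁻¹' {x}))) := by
      intro x hx
      obtain ⟨T, hT, h⟩ := hXcell x hx
      rw [h]
      rcases cell_eq hK hT.2 with ⟨S, d, hc, h2⟩ | ⟨S, d, v, hv, hc, h2⟩
      · rw [h2]
        exact hcyl S d hc
      · rw [h2]
        exact hge S d v K hv hc
    calc P (G' m \ badTrees m K) ≤ P (⋃ x ∈ X, truncDeg m K ⁻¹' {x}) := by
          refine measure_mono fun T hT => ?_
          simp only [mem_iUnion]
          exact ⟨truncDeg m K T, Finset.mem_filter.2 ⟨Finset.mem_univ _, T, hT, rfl⟩, rfl⟩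
      _ = ∑ x ∈ X, P (truncDeg m K ⁻¹' {x}) := measure_biUnion_finset hdisj hmeas
      _ = liminf (fun i => ∑ x ∈ X, Q i (truncDeg m K ⁻¹' {x})) l :=
          (tendsto_finsetSum X hlim).liminf_eq.symm
      _ ≤ liminf (fun i => Q i G) l := by
          refine liminf_le_liminf (Eventually.of_forall fun i => ?_)
          rw [← measure_biUnion_finset hdisj hmeas]
          refine measure_mono (iUnion₂_subset fun x hx => ?_)
          obtain ⟨T, hT, h⟩ := hXcell x hx
          rw [h]
          exact (cell_subset_cell le_rfl hK T).trans hT.1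
  have hbad : Tendsto (fun K => P (badTrees m K)) atTop (𝓝 0) := by
    have h1 : Tendsto (fun K : ℕ => ∑ p ∈ (box m).offDiag,
        P {T | (K : ℕ∞) ≤ T.deg p.1 ∧ (K : ℕ∞) ≤ T.deg p.2}) atTop (𝓝 0) := by
      rw [← Finset.sum_const_zero (s := (box m).offDiag)]
      refine tendsto_finsetSum _ fun p hp => ?_
      have hp' := (Finset.mem_offDiag.1 hp).2.2
      have h2 := tendsto_measure_iInter_atTop (μ := P)
        (s := fun K : ℕ => {T : Tree | (K : ℕ∞) ≤ T.deg p.1 ∧ (K : ℕ∞) ≤ T.deg p.2})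
        (fun K => ((measurable_deg p.1 (MeasurableSet.of_discrete (s := Set.Ici (K : ℕ∞)))).inter
          (measurable_deg p.2 (MeasurableSet.of_discrete
            (s := Set.Ici (K : ℕ∞))))).nullMeasurableSet)
        (fun K K' h T hT => by
          have h3 : (K : ℕ∞) ≤ K' := by exact_mod_cast h
          exact ⟨h3.trans hT.1, h3.trans hT.2⟩) ⟨0, measure_ne_top _ _⟩
      have h4 : (⋂ K : ℕ, {T : Tree | (K : ℕ∞) ≤ T.deg p.1 ∧ (K : ℕ∞) ≤ T.deg p.2}) =
          {T | T.deg p.1 = ⊤ ∧ T.deg p.2 = ⊤} := by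
        ext T
        simp only [mem_iInter, Set.mem_ofPred_eq, forall_and, ENat.eq_top_iff_forall_ge]
      rw [h4, htop _ _ hp'] at h2
      exact h2
    refine tendsto_of_tendsto_of_tendsto_of_le_of_le tendsto_const_nhds h1 (fun _ => zero_le)
      fun K => ?_
    have h5 : badTrees m K = ⋃ p ∈ (box m).offDiag,
        {T : Tree | (K : ℕ∞) ≤ T.deg p.1 ∧ (K : ℕ∞) ≤ T.deg p.2} := by
      ext T
      simp only [badTrees, mem_iUnion, Set.mem_ofPred_eq, exists_prop]
    rw [h5]
    exact measure_biUnion_finset_le _ _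
  refine ge_of_tendsto (x := atTop) (f := fun K => liminf (fun i => Q i G) l + P (badTrees m K))
    (by simpa using hbad.const_add (liminf (fun i => Q i G) l)) ?_
  filter_upwards [eventually_gt_atTop m] with K hK
  calc P (G' m) ≤ P ((G' m \ badTrees m K) ∪ badTrees m K) :=
        measure_mono fun T hT => by by_cases h : T ∈ badTrees m K <;> simp [h, hT]
    _ ≤ P (G' m \ badTrees m K) + P (badTrees m K) := measure_union_le _ _
    _ ≤ _ := add_le_add_left (hgood K hK) _

/-! ### Convergence in distribution -/

/-- Repeatedly grafting a root with k leaves onto a leaf gives trees of positive weight with jk + 1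
nodes, so the admissible sizes are unbounded. -/
theorem forest_one_pos {v : ℕ → ℝ} (hv : ∀ k, 0 ≤ v k) (hv0 : 0 < v 0) {k : ℕ} (hk : 1 ≤ k)
    (hvk : 0 < v k) (j : ℕ) : 0 < forest v 1 (j * k + 1) := by
  have h1 : 0 < forest v 1 (k + 1) := by
    have h2 : 0 < forest v k k := by
      have h3 := mul_forest v (le_refl k)
      have h4 := pow_le_powCoeff hv (n := 1) (s := 0) k
      rw [powCoeff_one, mul_one, mul_zero] at h4
      have hk0 : (0 : ℝ) < k := by exact_mod_cast hk
      rw [Nat.sub_self] at h3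
      rw [mul_left_cancel₀ hk0.ne' h3]
      exact (pow_pos hv0 k).trans_le h4
    rw [forest]
    refine (mul_pos hvk h2).trans_le ?_
    have := Finset.single_le_sum (f := fun i => v i * forest v (0 + i) k)
      (fun i _ => mul_nonneg (hv i) (forest_nonneg hv _ _)) (Finset.self_mem_range_succ k)
    simpa using this
  induction j with
  | zero => simpa [forest] using hv0
  | succ j ih =>
    have h2 := (mul_pos ih h1).trans_le (forest_mul_forest_le hv 0 (j * k) k)
    rw [show (j + 1) * k + 1 = j * k + k + 1 by ring]
    exact pos_of_mul_pos_right h2 hv0.le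

theorem exists_partitionFn_ne_zero {w : ℕ → ℝ≥0} (hw0 : 0 < w 0) (hw2 : ∃ k, 2 ≤ k ∧ 0 < w k)
    (m : ℕ) : ∃ n, m ≤ n ∧ partitionFn w n ≠ 0 := by
  obtain ⟨k, hk, hwk⟩ := hw2
  refine ⟨m * k + 1, by nlinarith, ?_⟩
  rw [partitionFn_eq]
  simpa using forest_one_pos (v := fun k => (w k : ℝ)) (fun k => NNReal.coe_nonneg _)
    (by exact_mod_cast hw0) (by omega : 1 ≤ k) (by exact_mod_cast hwk) m

theorem tendsto_subtype_val_atTop {q : ℕ → Prop} (h : ∀ m, ∃ n, m ≤ n ∧ q n) :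
    Tendsto (fun n : {n // q n} => n.1) atTop atTop := by
  refine tendsto_atTop.2 fun m => ?_
  obtain ⟨n, hn, hq⟩ := h m
  filter_upwards [eventually_ge_atTop (⟨n, hq⟩ : {n // q n})] with i hi
  exact hn.trans hi

theorem tendstoInDistribution_simplyGeneratedTree {w : ℕ → ℝ≥0} (hw0 : 0 < w 0)
    (hw2 : ∃ k, 2 ≤ k ∧ 0 < w k) {p : PMF ℕ} (hmean : mean p ≤ 1)
    (hp : IsLimitOffspring (fun k => (w k : ℝ)) fun k => (p k).toReal) :
    TendstoInDistribution
      (fun (n : {n : ℕ // partitionFn w n ≠ 0}) (T : TreeOfSize n) => (T : Tree)) atTop modifiedGW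
      (fun n => (simplyGeneratedTree w n).toMeasure) (choiceMeasure p hmean) := by
  have hinf := exists_partitionFn_ne_zero hw0 hw2
  have : Nonempty {n : ℕ // partitionFn w n ≠ 0} := by
    obtain ⟨n, -, hn⟩ := hinf 0
    exact ⟨⟨n, hn⟩⟩
  have hN := tendsto_subtype_val_atTop hinf
  have hne : ∀ᶠ n : {n : ℕ // partitionFn w n ≠ 0} in atTop, partitionFn w n.1 ≠ 0 :=
    Eventually.of_forall fun n => n.2
  have hmapQ : ∀ (n : {n : ℕ // partitionFn w n ≠ 0}) (A : Set Tree), MeasurableSet A →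
      (simplyGeneratedTree w n).toMeasure.map (fun T : TreeOfSize n => (T : Tree)) A =
        setWeight w n A / partitionFn w n := by
    intro n A hA
    rw [Measure.map_apply measurable_subtype_coe hA]
    exact simplyGeneratedTree_apply w n A
  have hmapP : ∀ A : Set Tree, MeasurableSet A →
      (choiceMeasure p hmean).map modifiedGW A = choiceMeasure p hmean {ω | modifiedGW ω ∈ A} :=
    fun A hA => Measure.map_apply measurable_modifiedGW hA
  have hge_meas : ∀ (S : Finset (List ℕ)) d v K, MeasurableSet (geCyl S d v K) := by
    intro S d v K
    have : geCyl S d v K = (⋂ u ∈ S.erase v, (fun T : Tree => T.deg u) ⁻¹' {(d u : ℕ∞)}) ∩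
        (fun T : Tree => T.deg v) ⁻¹' Set.Ici (K : ℕ∞) := by
      ext T
      simp only [geCyl, Finset.mem_erase, ne_eq, mem_inter_iff, mem_iInter, and_imp,
        Set.mem_ofPred_eq, mem_preimage, Set.mem_singleton_iff, Set.mem_Ici]
      refine and_congr_left fun _ => forall_congr' fun u => ⟨fun h h1 h2 => h h2 h1,
        fun h h1 h2 => h h2 h1⟩
    rw [this]
    exact (Finset.measurableSet_biInter _ fun u _ =>
      measurable_deg u MeasurableSet.of_discrete).inter (measurable_deg v MeasurableSet.of_discrete)
  refine ⟨fun n => measurable_subtype_coe.aemeasurable, measurable_modifiedGW.aemeasurable, ?_⟩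
  refine tendsto_of_forall_isOpen_le_liminf' fun G hG => ?_
  have : IsProbabilityMeasure ((choiceMeasure p hmean).map modifiedGW) :=
    Measure.isProbabilityMeasure_map measurable_modifiedGW.aemeasurable
  simp only [ProbabilityMeasure.coe_mk]
  refine le_liminf_of_tendsto_cyl ?_ ?_ ?_ hG
  · intro S d h
    rw [hmapP _ (measurableSet_cyl S d), choiceMeasure_cyl p hmean h]
    refine (tendsto_setWeight_cyl hw0 hp hN hne h).congr fun n => ?_
    exact (hmapQ n _ (measurableSet_cyl S d)).symm
  · intro S d v K hv h
    rw [hmapP _ (hge_meas S d v K)]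
    refine (tendsto_setWeight_geCyl hw0 hp hmean hN hne hv h).congr fun n => ?_
    exact (hmapQ n _ (hge_meas S d v K)).symm
  · intro u v huv
    have hm : MeasurableSet {T : Tree | T.deg u = ⊤ ∧ T.deg v = ⊤} :=
      (measurable_deg u (measurableSet_singleton ⊤)).inter
        (measurable_deg v (measurableSet_singleton ⊤))
    rw [hmapP _ hm]
    convert measure_empty (μ := choiceMeasure p hmean)
    ext ω
    simp only [Set.mem_ofPred_eq, mem_empty_iff_false, iff_false]
    exact fun h => huv (eq_of_deg_eq_top h.1 h.2)

/-! ### The spine of the modified Galton–Watson tree -/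

/-- The `m`-th node on the path that follows the special children. -/
def spineNode (ω : Choices) : ℕ → List ℕ
  | 0 => []
  | m + 1 => spineNode ω m ++ [(ω (spineNode ω m)).2.2]

theorem spineNode_eq_map (ω : Choices) (m : ℕ) :
    spineNode ω m = (List.range m).map fun j => (ω (spineNode ω j)).2.2 := by
  induction m with
  | zero => rfl
  | succ m ih =>
    rw [List.range_succ, List.map_append, ← ih]
    rfl

theorem eq_spineNode_of_mem_spine {ω : Choices} {v : List ℕ} (h : v ∈ spine ω) :
    v = spineNode ω v.length := by
  induction v using List.reverseRecOn with
  | nil => rfl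
  | append_singleton v i ih =>
    obtain ⟨h1, -, -, h2⟩ := append_mem_spine.1 h
    rw [List.length_append, List.length_singleton, spineNode, ← ih h1, h2]

theorem spine_eq_range {ω : Choices} (hv : ω.Valid) (htop : ∀ u, (ω u).2.1 ≠ ⊤) :
    ∃ x : ℕ → ℕ, spine ω = Set.range fun m : ℕ => (List.range m).map x := by
  refine ⟨fun j => (ω (spineNode ω j)).2.2, ?_⟩
  simp only [← spineNode_eq_map]
  refine Subset.antisymm (fun v h => ⟨_, (eq_spineNode_of_mem_spine h).symm⟩) ?_
  rintro _ ⟨m, rfl⟩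
  induction m with
  | zero => exact nil_mem_spine ω
  | succ m ih => exact append_mem_spine.2 ⟨ih, htop _, hv _ (htop _), rfl⟩

/-- A spine node with finitely many children always has a spine child, so a spine that misses some
level has a node with infinitely many children, and it must end there. -/
theorem exists_last_of_spine {ω : Choices} (hv : ω.Valid) {m : ℕ}
    (hm : ∀ v ∈ spine ω, v.length ≠ m) :
    ∃ v : List ℕ, spine ω = {u | u <+: v} ∧ (modifiedGW ω).deg v = ⊤ ∧
      ∀ u, u ≠ v → (modifiedGW ω).deg u < ⊤ := by
  have hlast : ∃ v ∈ spine ω, (ω v).2.1 = ⊤ := by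
    by_contra! hcon
    have : ∀ j, spineNode ω j ∈ spine ω ∧ (spineNode ω j).length = j := by
      intro j
      induction j with
      | zero => exact ⟨nil_mem_spine ω, rfl⟩
      | succ j ih =>
        have h1 := hcon _ ih.1
        exact ⟨append_mem_spine.2 ⟨ih.1, h1, hv _ h1, rfl⟩, by simp [spineNode, ih.2]⟩
    exact hm _ (this m).1 (this m).2
  obtain ⟨v, h1, h2⟩ := hlast
  have hdeg : (modifiedGW ω).deg v = ⊤ := by
    rw [modifiedGW, deg_treeOfOffspring (spine_subset_nodes ω h1), offspring_eq_top_iff]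
    exact ⟨h1, h2⟩
  refine ⟨v, ?_, hdeg, fun u hu => ?_⟩
  · exact Subset.antisymm (fun u hu => prefix_of_mem_spine_of_top hu h1 h2)
      fun u hu => mem_spine_of_prefix hu h1
  · exact lt_top_iff_ne_top.2 fun h => hu (eq_of_deg_eq_top h hdeg)

/-- The choices at a special node for which the spine continues with its child `i`. -/
def spineStep (i : ℕ) : Set (ℕ × (ℕ∞ × ℕ)) := {x | x.2.1 ≠ ⊤ ∧ (i : ℕ∞) < x.2.1 ∧ i = x.2.2}

theorem choiceMeasure_mem_spine (p : PMF ℕ) (hp : mean p ≤ 1) (v : List ℕ) :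
    choiceMeasure p hp {ω | v ∈ spine ω} = (v.map fun i => nodeLaw p hp (spineStep i)).prod := by
  classical
  -- The event is kept as a product event over strings shorter than v, so that the next step imposes
  -- a condition at a fresh node and independence gives one more factor.
  obtain ⟨S, B, -, h1, h2⟩ : ∃ (S : Finset (List ℕ)) (B : List ℕ → Set (ℕ × (ℕ∞ × ℕ))),
      (∀ u ∈ S, u.length < v.length) ∧ {ω | v ∈ spine ω} = {ω | ∀ u ∈ S, ω u ∈ B u} ∧
        ∏ u ∈ S, nodeLaw p hp (B u) = (v.map fun i => nodeLaw p hp (spineStep i)).prod := by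
    induction v using List.reverseRecOn with
    | nil =>
      refine ⟨∅, fun _ => univ, by simp, ?_, by simp⟩
      ext ω
      simp [nil_mem_spine]
    | append_singleton v i ih =>
      obtain ⟨S, B, h1, h2, h3⟩ := ih
      have hvS : v ∉ S := fun h => lt_irrefl _ (h1 v h)
      have hup : ∀ u ∈ S, Function.update B v (spineStep i) u = B u := fun u hu =>
        Function.update_of_ne (fun h : u = v => hvS (h ▸ hu)) _ _
      refine ⟨insert v S, Function.update B v (spineStep i), ?_, ?_, ?_⟩
      · intro u hu
        rw [List.length_append, List.length_singleton]
        rcases Finset.mem_insert.1 hu with rfl | hu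
        · omega
        · have := h1 u hu; omega
      · ext ω
        have h4 : v ∈ spine ω ↔ ∀ u ∈ S, ω u ∈ B u := Set.ext_iff.1 h2 ω
        simp only [Set.mem_ofPred_eq, append_mem_spine, h4, Finset.forall_mem_insert,
          Function.update_self]
        rw [and_comm]
        refine and_congr Iff.rfl (forall₂_congr fun u hu => ?_)
        rw [hup u hu]
      · rw [Finset.prod_insert hvS, Function.update_self,
          Finset.prod_congr rfl fun u hu => by rw [hup u hu], h3]
        simp [mul_comm]
  rw [h1, choiceMeasure_pi, h2]

theorem tsum_nodeLaw_spineStep_le (p : PMF ℕ) (hp : mean p ≤ 1) :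
    ∑' i, nodeLaw p hp (spineStep i) ≤ mean p := by
  have hdisj : Pairwise (Function.onFun Disjoint spineStep) := fun i j hij =>
    Set.disjoint_left.2 fun x hx hy => hij (hx.2.2.trans hy.2.2.symm)
  rw [← measure_iUnion hdisj fun _ => MeasurableSet.of_discrete]
  calc nodeLaw p hp (⋃ i, spineStep i) ≤ nodeLaw p hp {x | x.2.1 = ⊤}ᶜ := by
        refine measure_mono (iUnion_subset fun i x hx => hx.1)
    _ = 1 - (1 - mean p) := by
        rw [prob_compl_eq_one_sub MeasurableSet.of_discrete, nodeLaw_top]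
    _ = mean p := ENNReal.sub_sub_cancel (by simp) hp

theorem tsum_prod_fin (c : ℕ → ℝ≥0∞) (m : ℕ) :
    ∑' f : Fin m → ℕ, ∏ i, c (f i) = (∑' i, c i) ^ m := by
  induction m with
  | zero => simp [tsum_fintype]
  | succ m ih =>
    rw [← (Fin.consEquiv fun _ => ℕ).tsum_eq, ENNReal.tsum_prod', pow_succ', ← ih,
      ← ENNReal.tsum_mul_right]
    congr 1
    ext i
    rw [← ENNReal.tsum_mul_left]
    congr 1
    ext f
    rw [Fin.prod_univ_succ]
    simp [Fin.consEquiv]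

/-- A union bound over the strings of length m; the sum of the products factorizes into the m-th
power of the probability of one further step, which is at most μ. -/
theorem choiceMeasure_exists_mem_spine_le (p : PMF ℕ) (hp : mean p ≤ 1) (m : ℕ) :
    choiceMeasure p hp {ω | ∃ v ∈ spine ω, v.length = m} ≤ mean p ^ m := by
  calc choiceMeasure p hp {ω | ∃ v ∈ spine ω, v.length = m}
      ≤ choiceMeasure p hp (⋃ f : Fin m → ℕ, {ω | List.ofFn f ∈ spine ω}) := by
        refine measure_mono ?_
        rintro ω ⟨v, hv, rfl⟩
        exact mem_iUnion.2 ⟨v.get, by simpa using hv⟩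
    _ ≤ ∑' f : Fin m → ℕ, choiceMeasure p hp {ω | List.ofFn f ∈ spine ω} := measure_iUnion_le _
    _ = (∑' i, nodeLaw p hp (spineStep i)) ^ m := by
        rw [← tsum_prod_fin]
        congr 1
        ext f
        rw [choiceMeasure_mem_spine, List.map_ofFn, List.prod_ofFn]
        rfl
    _ ≤ mean p ^ m := pow_le_pow_left' (tsum_nodeLaw_spineStep_le p hp) m

theorem ae_spine_of_mean_eq_one (p : PMF ℕ) (hp : mean p ≤ 1) (h : mean p = 1) :
    ∀ᵐ ω ∂choiceMeasure p hp, (∀ v, (modifiedGW ω).deg v < ⊤) ∧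
      ∃ x : ℕ → ℕ, spine ω = Set.range fun m : ℕ => (List.range m).map x := by
  filter_upwards [ae_valid p hp, ae_ne_top p hp h] with ω h1 h2
  refine ⟨fun v => lt_top_iff_ne_top.2 fun hv => ?_, spine_eq_range h1 h2⟩
  exact h2 v (mem_spine_of_deg_eq_top hv).2

theorem ae_spine_of_mean_lt_one (p : PMF ℕ) (hp : mean p ≤ 1) (h : mean p < 1) :
    ∀ᵐ ω ∂choiceMeasure p hp, ∃ v : List ℕ, spine ω = {u | u <+: v} ∧
      (modifiedGW ω).deg v = ⊤ ∧ ∀ u, u ≠ v → (modifiedGW ω).deg u < ⊤ := by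
  have h0 : choiceMeasure p hp {ω | ∀ m, ∃ v ∈ spine ω, v.length = m} = 0 := by
    refine le_antisymm ?_ zero_le
    refine ge_of_tendsto' (ENNReal.tendsto_pow_atTop_nhds_zero_of_lt_one h) fun m => ?_
    have h3 : {ω | ∀ m, ∃ v ∈ spine ω, v.length = m} ⊆ {ω | ∃ v ∈ spine ω, v.length = m} :=
      fun ω hω => hω m
    exact (measure_mono h3).trans (choiceMeasure_exists_mem_spine_le p hp m)
  filter_upwards [ae_valid p hp, measure_eq_zero_iff_ae_notMem.1 h0] with ω h1 h2
  simp only [not_forall, not_exists, not_and] at h2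
  obtain ⟨m, hm⟩ := h2
  exact exists_last_of_spine h1 hm

/-! ### Moments of the tilted weights -/

/-- `∑ k ^ j w_k t ^ k` with values in `[0, ∞]`. -/
def powMoment (w : ℕ → ℝ≥0) (j : ℕ) (t : ℝ≥0∞) : ℝ≥0∞ :=
  ∑' k : ℕ, (k : ℝ≥0∞) ^ j * w k * t ^ k

/-- `∑ k ^ j w_k x ^ k` for real `x`. -/
def realMoment (w : ℕ → ℝ≥0) (j : ℕ) (x : ℝ) : ℝ :=
  ∑' k : ℕ, (k : ℝ) ^ j * w k * x ^ k

theorem Phi_eq_powMoment (w : ℕ → ℝ≥0) (t : ℝ≥0∞) : Phi w t = powMoment w 0 t := by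
  simp [Phi, powMoment]

theorem psiQuot_eq_powMoment_div (w : ℕ → ℝ≥0) (t : ℝ≥0∞) :
    psiQuot w t = powMoment w 1 t / powMoment w 0 t := by
  simp [Phi, powMoment, psiQuot]

theorem coe_le_Phi (w : ℕ → ℝ≥0) (t : ℝ≥0∞) : (w 0 : ℝ≥0∞) ≤ Phi w t := by
  have h := ENNReal.le_tsum (f := fun k => (w k : ℝ≥0∞) * t ^ k) 0
  rwa [pow_zero, mul_one] at h

theorem Phi_zero (w : ℕ → ℝ≥0) : Phi w 0 = w 0 := by
  rw [Phi, tsum_eq_single 0 (fun k hk => by simp [hk])]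
  simp

theorem psiQuot_zero (w : ℕ → ℝ≥0) : psiQuot w 0 = 0 := by
  rw [psiQuot, ENNReal.tsum_eq_zero.2, ENNReal.zero_div]
  rintro (_ | k) <;> simp

/-! ### Summability inside the disc of convergence -/

theorem summable_moment_of_lt_rho {w : ℕ → ℝ≥0} {x : ℝ} (hx : 0 ≤ x)
    (h : ENNReal.ofReal x < rho w) (j : ℕ) :
    Summable fun k : ℕ => (k : ℝ) ^ j * w k * x ^ k := by
  obtain ⟨r, hxr, hr⟩ := ENNReal.lt_iff_exists_nnreal_btwn.1 h
  obtain ⟨C, hC, hb⟩ := FormalMultilinearSeries.norm_mul_pow_le_of_lt_radius _ hr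
  have hxr' : x < r := by
    rw [← ENNReal.ofReal_coe_nnreal] at hxr
    exact (ENNReal.ofReal_lt_ofReal_iff_of_nonneg hx).1 hxr
  have hr0 : (0 : ℝ) < r := hx.trans_lt hxr'
  have hq : ‖x / r‖ < 1 := by
    rw [Real.norm_of_nonneg (by positivity), div_lt_one hr0]
    exact hxr'
  refine Summable.of_nonneg_of_le (fun k => by positivity) (fun k => ?_)
    ((summable_pow_mul_geometric_of_norm_lt_one j hq).mul_left C)
  have h1 : (w k : ℝ) * r ^ k ≤ C := by
    have := hb k
    rwa [FormalMultilinearSeries.ofScalars_norm, Real.norm_of_nonneg (w k).coe_nonneg] at this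
  calc (k : ℝ) ^ j * w k * x ^ k = (w k * r ^ k) * ((k : ℝ) ^ j * (x / r) ^ k) := by
        rw [div_pow]; field_simp
    _ ≤ C * ((k : ℝ) ^ j * (x / r) ^ k) := by gcongr

theorem powMoment_ofReal {w : ℕ → ℝ≥0} {x : ℝ} (hx : 0 ≤ x) {j : ℕ}
    (h : Summable fun k : ℕ => (k : ℝ) ^ j * w k * x ^ k) :
    powMoment w j (ENNReal.ofReal x) = ENNReal.ofReal (realMoment w j x) := by
  rw [powMoment, realMoment, ENNReal.ofReal_tsum_of_nonneg (fun k => by positivity) h]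
  refine tsum_congr fun k => ?_
  rw [ENNReal.ofReal_mul (by positivity), ENNReal.ofReal_mul (by positivity),
    ENNReal.ofReal_pow hx, ENNReal.ofReal_pow (by positivity), ENNReal.ofReal_natCast,
    ENNReal.ofReal_coe_nnreal]

theorem summable_of_Phi_lt_top {w : ℕ → ℝ≥0} {x : ℝ} (hx : 0 ≤ x)
    (h : Phi w (ENNReal.ofReal x) < ∞) : Summable fun k : ℕ => (w k : ℝ) * x ^ k := by
  lift x to ℝ≥0 using hx
  rw [ENNReal.ofReal_coe_nnreal] at h
  have h1 : (∑' k : ℕ, ((w k * x ^ k : ℝ≥0) : ℝ≥0∞)) ≠ ∞ := by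
    simpa [Phi] using h.ne
  exact_mod_cast ENNReal.tsum_coe_ne_top_iff_summable.1 h1

theorem le_rho_of_summable {w : ℕ → ℝ≥0} {x : ℝ} (hx : 0 ≤ x)
    (h : Summable fun k : ℕ => (w k : ℝ) * x ^ k) : ENNReal.ofReal x ≤ rho w := by
  lift x to ℝ≥0 using hx
  rw [ENNReal.ofReal_coe_nnreal]
  refine FormalMultilinearSeries.le_radius_of_summable_norm _ ?_
  simpa [FormalMultilinearSeries.ofScalars_norm] using h

theorem frequently_pow_le_of_rho_eq_zero {w : ℕ → ℝ≥0} (h : rho w = 0) (B : ℝ) :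
    ∃ᶠ M in atTop, B ^ M ≤ (w M : ℝ) := by
  intro hn
  set b : ℝ := max |B| 1 with hb
  have hb0 : 0 < b := lt_of_lt_of_le one_pos (le_max_right _ _)
  -- If w_k ≤ b^k eventually, then the series converges at 1/(2b) by comparison with the geometric
  -- series of ratio 1/2, so ρ > 0.
  set r : ℝ≥0 := ⟨1 / (2 * b), by positivity⟩ with hr
  have h1 : Summable fun k : ℕ => (w k : ℝ) * (r : ℝ) ^ k := by
    refine summable_of_isBigO_nat (g := fun k => (1 / 2 : ℝ) ^ k)
      (summable_geometric_of_lt_one (by norm_num) (by norm_num)) ?_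
    refine Asymptotics.IsBigO.of_bound 1 ?_
    filter_upwards [hn] with k hk
    have hk' : (w k : ℝ) ≤ b ^ k := by
      refine (not_le.1 hk).le.trans ((le_abs_self _).trans ?_)
      rw [abs_pow]
      gcongr
      exact le_max_left _ _
    rw [one_mul, Real.norm_of_nonneg (by positivity), Real.norm_of_nonneg (by positivity)]
    calc (w k : ℝ) * (r : ℝ) ^ k ≤ b ^ k * (r : ℝ) ^ k := by gcongr
      _ = (1 / 2) ^ k := by
        rw [← mul_pow, hr]
        congr 1
        change b * (1 / (2 * b)) = 1 / 2
        field_simp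
  have h2 := le_rho_of_summable r.2 h1
  rw [h] at h2
  have : (0 : ℝ) < 1 / (2 * b) := by positivity
  simp only [nonpos_iff_eq_zero, ENNReal.ofReal_eq_zero] at h2
  exact absurd h2 (not_le.2 this)

/-! ### Derivatives -/

theorem exists_hasDerivAt_realMoment {w : ℕ → ℝ≥0} {x : ℝ} (hx : 0 ≤ x)
    (h : ENNReal.ofReal x < rho w) (j : ℕ) :
    ∃ D, HasDerivAt (realMoment w j) D x ∧ x * D = realMoment w (j + 1) x := by
  obtain ⟨r, hxr, hr⟩ := ENNReal.lt_iff_exists_nnreal_btwn.1 h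
  rw [← ENNReal.ofReal_coe_nnreal] at hxr hr
  have hxr' : x < r := (ENNReal.ofReal_lt_ofReal_iff_of_nonneg hx).1 hxr
  have hr0 : (0 : ℝ) < r := hx.trans_lt hxr'
  have hsum : Summable fun k : ℕ => (k : ℝ) ^ (j + 1) * w k * (r : ℝ) ^ (k - 1) := by
    refine ((summable_moment_of_lt_rho hr0.le hr (j + 1)).mul_left (r : ℝ)⁻¹).congr fun k => ?_
    rcases k with _ | k
    · simp
    · rw [Nat.add_sub_cancel, pow_succ (r : ℝ) k]
      field_simp
  refine ⟨∑' k : ℕ, (k : ℝ) ^ j * w k * (k * x ^ (k - 1)), ?_, ?_⟩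
  · refine hasDerivAt_tsum_of_isPreconnected
      (g := fun (k : ℕ) (y : ℝ) => (k : ℝ) ^ j * w k * y ^ k)
      (g' := fun (k : ℕ) (y : ℝ) => (k : ℝ) ^ j * w k * (k * y ^ (k - 1))) hsum
      Metric.isOpen_ball (convex_ball (0 : ℝ) r).isPreconnected
      (fun k y _ => (hasDerivAt_pow k y).const_mul _) (fun k y hy => ?_)
      (y₀ := x) ?_ (summable_moment_of_lt_rho hx h j) ?_
    · have hy' : ‖y‖ ≤ r := (mem_ball_zero_iff.1 hy).le
      rw [norm_mul, norm_mul, norm_mul, norm_pow, norm_pow, Real.norm_natCast,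
        Real.norm_of_nonneg (w k).coe_nonneg]
      calc (k : ℝ) ^ j * w k * (k * ‖y‖ ^ (k - 1)) = (k : ℝ) ^ (j + 1) * w k * ‖y‖ ^ (k - 1) := by
            ring
        _ ≤ _ := by gcongr
    · rwa [mem_ball_zero_iff, Real.norm_of_nonneg hx]
    · rwa [mem_ball_zero_iff, Real.norm_of_nonneg hx]
  · rw [realMoment, ← tsum_mul_left]
    refine tsum_congr fun k => ?_
    rcases k with _ | k
    · simp
    · rw [Nat.add_sub_cancel]; ring

theorem realMoment_zero_pos {w : ℕ → ℝ≥0} (hw0 : 0 < w 0) {x : ℝ} (hx : 0 ≤ x)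
    (h : ENNReal.ofReal x < rho w) : 0 < realMoment w 0 x := by
  have h1 := (summable_moment_of_lt_rho hx h 0).le_tsum 0 (fun k _ => by positivity)
  refine lt_of_lt_of_le ?_ h1
  simpa using hw0

theorem realMoment_one_pos {w : ℕ → ℝ≥0} (hw2 : ∃ k, 2 ≤ k ∧ 0 < w k) {x : ℝ} (hx : 0 < x)
    (h : ENNReal.ofReal x < rho w) : 0 < realMoment w 1 x := by
  obtain ⟨k, hk, hwk⟩ := hw2
  have h1 := (summable_moment_of_lt_rho hx.le h 1).le_tsum k (fun k _ => by positivity)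
  refine lt_of_lt_of_le ?_ h1
  have : 0 < k := by omega
  have : (0 : ℝ) < w k := hwk
  positivity

/-- The variance of the tilted distribution is positive. -/
theorem sq_realMoment_div_lt {w : ℕ → ℝ≥0} (hw0 : 0 < w 0) (hw2 : ∃ k, 2 ≤ k ∧ 0 < w k) {x : ℝ}
    (hx : 0 < x) (h : ENNReal.ofReal x < rho w) :
    (realMoment w 1 x / realMoment w 0 x) ^ 2 < realMoment w 2 x / realMoment w 0 x := by
  have h0 := realMoment_zero_pos hw0 hx.le h
  have h1 := realMoment_one_pos hw2 hx h
  set m := realMoment w 1 x / realMoment w 0 x with hm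
  have hm0 : 0 < m := by positivity
  have hs := ((summable_moment_of_lt_rho hx.le h 2).hasSum.sub
    ((summable_moment_of_lt_rho hx.le h 1).hasSum.mul_left (2 * m))).add
    ((summable_moment_of_lt_rho hx.le h 0).hasSum.mul_left (m ^ 2))
  -- Only the term k = 0 of ∑ (k - m)² w_k x^k is kept; it is positive because w_0 > 0 and the mean
  -- m is positive.
  have h2 : (w 0 : ℝ) * m ^ 2 ≤ realMoment w 2 x - 2 * m * realMoment w 1 x
      + m ^ 2 * realMoment w 0 x := by
    have h3 := le_hasSum hs 0 fun k _ => ?_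
    · rw [← realMoment, ← realMoment, ← realMoment] at h3
      simpa [mul_comm] using h3
    · have h4 : (k : ℝ) ^ 2 * w k * x ^ k - 2 * m * ((k : ℝ) ^ 1 * w k * x ^ k)
          + m ^ 2 * ((k : ℝ) ^ 0 * w k * x ^ k) = ((k : ℝ) - m) ^ 2 * (w k * x ^ k) := by ring
      rw [h4]
      positivity
  have h3 : realMoment w 1 x = m * realMoment w 0 x := by
    rw [hm]; field_simp
  have h4 : (0 : ℝ) < w 0 := hw0
  rw [lt_div_iff₀ h0]
  rw [h3] at h2
  nlinarith [mul_pos h4 (pow_pos hm0 2)]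

theorem Phi_lt_top_of_lt_rho {w : ℕ → ℝ≥0} {t : ℝ≥0∞} (h : t < rho w) : Phi w t < ∞ := by
  lift t to ℝ≥0 using h.ne_top
  rw [← ENNReal.ofReal_coe_nnreal] at h ⊢
  rw [Phi_eq_powMoment, powMoment_ofReal t.coe_nonneg (summable_moment_of_lt_rho t.coe_nonneg h 0)]
  exact ENNReal.ofReal_lt_top

theorem Psi_eq_psiQuot {w : ℕ → ℝ≥0} {t : ℝ≥0∞} (h : Phi w t < ∞) : Psi w t = psiQuot w t :=
  if_pos h

theorem psiQuot_ofReal {w : ℕ → ℝ≥0} (hw0 : 0 < w 0) {x : ℝ} (hx : 0 ≤ x)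
    (h : ENNReal.ofReal x < rho w) :
    psiQuot w (ENNReal.ofReal x) = ENNReal.ofReal (realMoment w 1 x / realMoment w 0 x) := by
  rw [psiQuot_eq_powMoment_div, powMoment_ofReal hx (summable_moment_of_lt_rho hx h 1),
    powMoment_ofReal hx (summable_moment_of_lt_rho hx h 0),
    ENNReal.ofReal_div_of_pos (realMoment_zero_pos hw0 hx h)]

theorem realMoment_nonneg (w : ℕ → ℝ≥0) (j : ℕ) {x : ℝ} (hx : 0 ≤ x) : 0 ≤ realMoment w j x :=
  tsum_nonneg fun k => by positivity

theorem psiReal_eq {w : ℕ → ℝ≥0} (hw0 : 0 < w 0) {x : ℝ} (hx : 0 ≤ x)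
    (h : ENNReal.ofReal x < rho w) : psiReal w x = realMoment w 1 x / realMoment w 0 x := by
  rw [psiReal, Psi_eq_psiQuot (Phi_lt_top_of_lt_rho h), psiQuot_ofReal hw0 hx h,
    ENNReal.toReal_ofReal (div_nonneg (realMoment_nonneg w 1 hx) (realMoment_nonneg w 0 hx))]

/-- The operator x d/dx raises the moment index by one, so xΨ'(x) is second moment minus squared
mean, the variance of the tilted law. Both the monotonicity of Ψ and the formula for σ² rest on
this. -/
theorem exists_hasDerivAt_realMoment_div {w : ℕ → ℝ≥0} (hw0 : 0 < w 0) {x : ℝ} (hx : 0 ≤ x)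
    (h : ENNReal.ofReal x < rho w) :
    ∃ G, HasDerivAt (fun y => realMoment w 1 y / realMoment w 0 y) G x ∧
      x * G = realMoment w 2 x / realMoment w 0 x - (realMoment w 1 x / realMoment w 0 x) ^ 2 := by
  have h0 := realMoment_zero_pos hw0 hx h
  obtain ⟨D0, hD0, e0⟩ := exists_hasDerivAt_realMoment hx h 0
  obtain ⟨D1, hD1, e1⟩ := exists_hasDerivAt_realMoment hx h 1
  refine ⟨_, hD1.div hD0 h0.ne', ?_⟩
  norm_num at e0 e1
  rw [← e0, ← e1]
  field_simp

theorem exists_hasDerivWithinAt_psiReal {w : ℕ → ℝ≥0} (hw0 : 0 < w 0) {x : ℝ} (hx : 0 ≤ x)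
    (h : ENNReal.ofReal x < rho w) :
    ∃ G, HasDerivWithinAt (psiReal w) G (Ici 0) x ∧
      x * G = realMoment w 2 x / realMoment w 0 x - (realMoment w 1 x / realMoment w 0 x) ^ 2 := by
  obtain ⟨G, hG, e⟩ := exists_hasDerivAt_realMoment_div hw0 hx h
  refine ⟨G, hG.hasDerivWithinAt.congr_of_eventuallyEq_of_mem ?_ hx, e⟩
  have h1 : ∀ᶠ y in 𝓝[Ici 0] x, ENNReal.ofReal y < rho w :=
    (ENNReal.continuous_ofReal.tendsto x).mono_left nhdsWithin_le_nhds |>.eventually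
      (gt_mem_nhds h)
  filter_upwards [h1, self_mem_nhdsWithin] with y hy hy0
  exact psiReal_eq hw0 hy0 hy

/-! ### Monotonicity and boundary behaviour of `Ψ` -/

theorem psiQuot_lt_psiQuot {w : ℕ → ℝ≥0} (hw0 : 0 < w 0) (hw2 : ∃ k, 2 ≤ k ∧ 0 < w k)
    {s t : ℝ≥0∞} (hst : s < t) (ht : t < rho w) : psiQuot w s < psiQuot w t := by
  lift t to ℝ≥0 using ht.ne_top
  lift s to ℝ≥0 using hst.ne_top
  have hs := hst.trans ht
  have hst' : (s : ℝ) < t := by exact_mod_cast hst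
  rw [← ENNReal.ofReal_coe_nnreal] at ht hs
  rw [← ENNReal.ofReal_coe_nnreal, ← ENNReal.ofReal_coe_nnreal,
    psiQuot_ofReal hw0 s.coe_nonneg hs, psiQuot_ofReal hw0 t.coe_nonneg ht]
  have hlt : ∀ x : ℝ, x ≤ t → ENNReal.ofReal x < rho w := fun x hx =>
    (ENNReal.ofReal_le_ofReal hx).trans_lt ht
  have hmono : StrictMonoOn (fun x => realMoment w 1 x / realMoment w 0 x) (Icc (s : ℝ) t) := by
    refine strictMonoOn_of_deriv_pos (convex_Icc _ _) (fun x hx => ?_) fun x hx => ?_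
    · obtain ⟨G, hG, -⟩ :=
        exists_hasDerivAt_realMoment_div hw0 (s.coe_nonneg.trans hx.1) (hlt x hx.2)
      exact hG.continuousAt.continuousWithinAt
    · rw [interior_Icc] at hx
      have hx0 : 0 < x := s.coe_nonneg.trans_lt hx.1
      obtain ⟨G, hG, e⟩ := exists_hasDerivAt_realMoment_div hw0 hx0.le (hlt x hx.2.le)
      rw [hG.deriv]
      have h1 := sq_realMoment_div_lt hw0 hw2 hx0 (hlt x hx.2.le)
      exact pos_of_mul_pos_right (a := x) (by linarith) hx0.le
  have h1 := hmono (left_mem_Icc.2 hst'.le) (right_mem_Icc.2 hst'.le) hst'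
  exact (ENNReal.ofReal_lt_ofReal_iff_of_nonneg
    (div_nonneg (realMoment_nonneg w 1 s.coe_nonneg) (realMoment_nonneg w 0 s.coe_nonneg))).2 h1

theorem powMoment_mono (w : ℕ → ℝ≥0) (j : ℕ) : Monotone (powMoment w j) := fun s t h =>
  ENNReal.tsum_le_tsum fun k => by gcongr

/-- Abel's theorem for non-negative terms: continuous partial sums give the lower bound and
monotonicity the upper one. Infinite values are allowed, which is needed for the second moment at ρ.
-/
theorem tendsto_powMoment (w : ℕ → ℝ≥0) (j : ℕ) (r : ℝ≥0∞) :
    Tendsto (powMoment w j) (𝓝[<] r) (𝓝 (powMoment w j r)) := by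
  refine tendsto_order.2 ⟨fun a ha => ?_, fun a ha => ?_⟩
  · have h1 : Tendsto (fun n => ∑ k ∈ Finset.range n, (k : ℝ≥0∞) ^ j * w k * r ^ k) atTop
        (𝓝 (powMoment w j r)) := ENNReal.tendsto_nat_tsum _
    obtain ⟨n, hn⟩ := (h1.eventually (lt_mem_nhds ha)).exists
    have h2 : Continuous fun t : ℝ≥0∞ => ∑ k ∈ Finset.range n, (k : ℝ≥0∞) ^ j * w k * t ^ k :=
      continuous_finsetSum _ fun k _ => (ENNReal.continuous_const_mul
        (ENNReal.mul_ne_top (ENNReal.pow_ne_top (by simp)) ENNReal.coe_ne_top)).comp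
          (ENNReal.continuous_pow k)
    have h3 := (h2.tendsto r).mono_left (nhdsWithin_le_nhds (s := Iio r))
    filter_upwards [h3.eventually (lt_mem_nhds hn)] with t ht
    exact ht.trans_le (ENNReal.sum_le_tsum _)
  · filter_upwards [self_mem_nhdsWithin] with t ht
    exact (powMoment_mono w j (le_of_lt ht)).trans_lt ha

theorem powMoment_zero_ne_zero {w : ℕ → ℝ≥0} (hw0 : 0 < w 0) (t : ℝ≥0∞) : powMoment w 0 t ≠ 0 := by
  rw [← Phi_eq_powMoment]
  exact ((ENNReal.coe_pos.2 hw0).trans_le (coe_le_Phi w t)).ne'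

theorem tendsto_psiQuot_nu {w : ℕ → ℝ≥0} (hw0 : 0 < w 0) (hw2 : ∃ k, 2 ≤ k ∧ 0 < w k)
    (hr : 0 < rho w) : Tendsto (psiQuot w) (𝓝[<] (rho w)) (𝓝 (nu w)) := by
  have : (𝓝[<] (rho w)).NeBot := nhdsLT_neBot_of_exists_lt ⟨0, hr⟩
  by_cases hP : Phi w (rho w) < ∞
  · rw [nu, Psi_eq_psiQuot hP]
    have h1 := ENNReal.Tendsto.div (tendsto_powMoment w 1 (rho w))
      (Or.inr (powMoment_zero_ne_zero hw0 _)) (tendsto_powMoment w 0 (rho w))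
      (Or.inl (by rw [← Phi_eq_powMoment]; exact hP.ne))
    simpa only [← psiQuot_eq_powMoment_div] using h1
  · rw [nu, Psi, if_neg hP]
    have h1 : MonotoneOn (psiQuot w) (Iio (rho w)) := StrictMonoOn.monotoneOn
      fun s _ t ht hst => psiQuot_lt_psiQuot hw0 hw2 hst ht
    have h2 := h1.tendsto_nhdsLT (OrderTop.bddAbove _)
    rwa [h2.limUnder_eq]

theorem psiQuot_le_nu {w : ℕ → ℝ≥0} (hw0 : 0 < w 0) (hw2 : ∃ k, 2 ≤ k ∧ 0 < w k) {t : ℝ≥0∞}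
    (ht : t < rho w) : psiQuot w t ≤ nu w := by
  have : (𝓝[<] (rho w)).NeBot := nhdsLT_neBot_of_exists_lt ⟨t, ht⟩
  refine ge_of_tendsto (x := 𝓝[<] (rho w))
    (tendsto_psiQuot_nu hw0 hw2 ((zero_le).trans_lt ht)) ?_
  filter_upwards [Ioo_mem_nhdsLT ht] with s hs
  exact (psiQuot_lt_psiQuot hw0 hw2 hs.1 hs.2).le

theorem Psi_lt_Psi {w : ℕ → ℝ≥0} (hw0 : 0 < w 0) (hw2 : ∃ k, 2 ≤ k ∧ 0 < w k)
    {s t : ℝ≥0∞} (hst : s < t) (ht : t ≤ rho w) : Psi w s < Psi w t := by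
  rw [Psi_eq_psiQuot (Phi_lt_top_of_lt_rho (hst.trans_le ht))]
  rcases ht.lt_or_eq with h | rfl
  · rw [Psi_eq_psiQuot (Phi_lt_top_of_lt_rho h)]
    exact psiQuot_lt_psiQuot hw0 hw2 hst h
  · obtain ⟨u, hsu, hu⟩ := exists_between hst
    exact (psiQuot_lt_psiQuot hw0 hw2 hsu hu).trans_le (psiQuot_le_nu hw0 hw2 hu)

/-- The tangent line inequality for `Φ` in logarithmic coordinates. -/
theorem realMoment_zero_add_le {w : ℕ → ℝ≥0} {t z : ℝ} (ht : 0 < t) (hz : 0 ≤ z)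
    (h0 : Summable fun k : ℕ => (w k : ℝ) * t ^ k)
    (h1 : Summable fun k : ℕ => (k : ℝ) * (w k * t ^ k))
    (hzs : Summable fun k : ℕ => (w k : ℝ) * z ^ k) :
    (∑' k : ℕ, (w k : ℝ) * t ^ k) + (∑' k : ℕ, (k : ℝ) * (w k * t ^ k)) * (z / t - 1)
      ≤ ∑' k : ℕ, (w k : ℝ) * z ^ k := by
  refine hasSum_le (fun k => ?_) (h0.hasSum.add (h1.hasSum.mul_right (z / t - 1))) hzs.hasSum
  have hb : 1 + (k : ℝ) * (z / t - 1) ≤ (1 + (z / t - 1)) ^ k :=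
    one_add_mul_le_pow (by have : 0 ≤ z / t := by positivity
                           linarith) k
  calc (w k : ℝ) * t ^ k + k * (w k * t ^ k) * (z / t - 1)
      = w k * t ^ k * (1 + k * (z / t - 1)) := by ring
    _ ≤ w k * t ^ k * (1 + (z / t - 1)) ^ k := by gcongr
    _ = w k * z ^ k := by
      rw [add_sub_cancel, div_pow]
      field_simp

/-- If Ψ ≤ 1 below ρ, then Φ(x)/x does not exceed its value at a fixed s ≤ x, so Φ grows at most
linearly. This is incompatible with ρ = ∞ since some w_k with k ≥ 2 is positive, and it bounds Φ(ρ)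
by left continuity. -/
theorem rho_lt_top_and_Phi_lt_top {w : ℕ → ℝ≥0} (hw0 : 0 < w 0) (hw2 : ∃ k, 2 ≤ k ∧ 0 < w k)
    (hnu : nu w ≤ 1) : rho w < ∞ ∧ Phi w (rho w) < ∞ := by
  rcases eq_zero_or_pos (rho w) with h0 | hr
  · rw [h0, Phi_zero]
    exact ⟨ENNReal.zero_lt_top, ENNReal.coe_lt_top⟩
  obtain ⟨s, hs0, hs⟩ := ENNReal.lt_iff_exists_nnreal_btwn.1 hr
  have hs0' : (0 : ℝ) < s := by exact_mod_cast hs0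
  have hs' : ENNReal.ofReal (s : ℝ) < rho w := by rwa [ENNReal.ofReal_coe_nnreal]
  have key : ∀ x : ℝ, (s : ℝ) ≤ x → ENNReal.ofReal x < rho w →
      realMoment w 0 x ≤ x * (realMoment w 0 s / s) := by
    intro x hx hxr
    have hx0 : 0 < x := hs0'.trans_le hx
    have h0 := summable_moment_of_lt_rho hx0.le hxr 0
    have h1 := summable_moment_of_lt_rho hx0.le hxr 1
    have hz := summable_moment_of_lt_rho hs0'.le hs' 0
    have hm : realMoment w 1 x ≤ realMoment w 0 x := by
      have h2 := (psiQuot_le_nu hw0 hw2 hxr).trans hnu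
      rw [psiQuot_ofReal hw0 hx0.le hxr, ENNReal.ofReal_le_one,
        div_le_one (realMoment_zero_pos hw0 hx0.le hxr)] at h2
      exact h2
    have h3 := realMoment_zero_add_le (w := w) hx0 hs0'.le (by simpa using h0)
      (by simpa [mul_assoc] using h1) (by simpa using hz)
    have h4 : realMoment w 0 x + realMoment w 1 x * (s / x - 1) ≤ realMoment w 0 s := by
      simpa [realMoment, mul_assoc] using h3
    have h5 : (s : ℝ) / x - 1 ≤ 0 := by
      rw [sub_nonpos, div_le_one hx0]; exact hx
    have h6 : realMoment w 0 x * (s / x) ≤ realMoment w 0 s := by nlinarith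
    rw [← mul_div_assoc, le_div_iff₀ hs0']
    have h7 := mul_le_mul_of_nonneg_left h6 hx0.le
    calc realMoment w 0 x * s = x * (realMoment w 0 x * (s / x)) := by field_simp
      _ ≤ _ := h7
  have hfin : rho w < ∞ := by
    by_contra htop
    rw [not_lt, top_le_iff] at htop
    obtain ⟨k, hk, hwk⟩ := hw2
    have hwk' : (0 : ℝ) < w k := hwk
    set C := realMoment w 0 s / s
    -- At this x the term w_k x^k ≥ w_k x² is at least (C + 1)x, which exceeds the linear bound Cx.
    set x : ℝ := max (max 1 s) ((C + 1) / w k) with hx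
    have hxs : (s : ℝ) ≤ x := (le_max_right _ _).trans (le_max_left _ _)
    have hx1 : 1 ≤ x := (le_max_left _ _).trans (le_max_left _ _)
    have hxC : (C + 1) / w k ≤ x := le_max_right _ _
    have hxr : ENNReal.ofReal x < rho w := by rw [htop]; exact ENNReal.ofReal_lt_top
    have h1 := (summable_moment_of_lt_rho (by linarith) hxr 0).le_tsum k
      (fun k _ => by positivity)
    have h2 : (w k : ℝ) * x ^ k ≤ x * C := by
      refine le_trans ?_ (key x hxs hxr)
      simpa [realMoment] using h1
    have h3 : x ^ 2 ≤ x ^ k := pow_le_pow_right₀ hx1 hk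
    rw [div_le_iff₀ hwk'] at hxC
    nlinarith [mul_le_mul_of_nonneg_left h3 hwk'.le]
  refine ⟨hfin, ?_⟩
  have : (𝓝[<] (rho w)).NeBot := nhdsLT_neBot_of_exists_lt ⟨0, hr⟩
  have hle : powMoment w 0 (rho w)
      ≤ ENNReal.ofReal ((rho w).toReal * (realMoment w 0 s / s)) := by
    refine le_of_tendsto (x := 𝓝[<] (rho w)) (tendsto_powMoment w 0 (rho w)) ?_
    filter_upwards [Ioo_mem_nhdsLT hs] with t ht
    lift t to ℝ≥0 using ht.2.ne_top
    have ht' : ENNReal.ofReal (t : ℝ) < rho w := by rw [ENNReal.ofReal_coe_nnreal]; exact ht.2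
    rw [← ENNReal.ofReal_coe_nnreal, powMoment_ofReal t.coe_nonneg
      (summable_moment_of_lt_rho t.coe_nonneg ht' 0)]
    refine ENNReal.ofReal_le_ofReal ((key t (by exact_mod_cast ht.1.le) ht').trans ?_)
    have h2 := (realMoment_zero_pos hw0 hs0'.le hs').le
    have h3 : (t : ℝ) ≤ (rho w).toReal := by
      have := ENNReal.toReal_mono hfin.ne ht.2.le
      simpa using this
    gcongr
  rw [Phi_eq_powMoment]
  exact hle.trans_lt ENNReal.ofReal_lt_top

theorem nu_eq_zero_of_rho_eq_zero {w : ℕ → ℝ≥0} (h : rho w = 0) : nu w = 0 := by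
  rw [nu, h, Psi_eq_psiQuot (by rw [Phi_zero]; exact ENNReal.coe_lt_top), psiQuot_zero]

theorem exists_Psi_eq_one {w : ℕ → ℝ≥0} (hw0 : 0 < w 0) (hw2 : ∃ k, 2 ≤ k ∧ 0 < w k)
    (hnu : 1 ≤ nu w) : ∃ τ ≤ rho w, Psi w τ = 1 := by
  rcases hnu.eq_or_lt with h | h
  · exact ⟨rho w, le_rfl, h.symm⟩
  have hr : 0 < rho w := by
    rw [pos_iff_ne_zero]
    intro h0
    simp [nu_eq_zero_of_rho_eq_zero h0] at h
  have : (𝓝[<] (rho w)).NeBot := nhdsLT_neBot_of_exists_lt ⟨0, hr⟩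
  obtain ⟨t, ht1, ht⟩ := (((tendsto_psiQuot_nu hw0 hw2 hr).eventually (lt_mem_nhds h)).and
    self_mem_nhdsWithin).exists
  lift t to ℝ≥0 using ht.ne_top
  rw [← ENNReal.ofReal_coe_nnreal] at ht ht1
  rw [psiQuot_ofReal hw0 t.coe_nonneg ht, ENNReal.one_lt_ofReal] at ht1
  have hlt : ∀ x : ℝ, x ≤ t → ENNReal.ofReal x < rho w := fun x hx =>
    (ENNReal.ofReal_le_ofReal hx).trans_lt ht
  have hcont : ContinuousOn (fun x => realMoment w 1 x / realMoment w 0 x) (Icc 0 (t : ℝ)) := by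
    intro x hx
    obtain ⟨G, hG, -⟩ := exists_hasDerivAt_realMoment_div hw0 hx.1 (hlt x hx.2)
    exact hG.continuousAt.continuousWithinAt
  have h0 : realMoment w 1 0 / realMoment w 0 0 = 0 := by
    have : realMoment w 1 0 = 0 := by
      rw [realMoment, ← tsum_zero]
      refine tsum_congr fun k => ?_
      rcases k with _ | k <;> simp
    rw [this, zero_div]
  obtain ⟨x, hx, hx1⟩ := intermediate_value_Icc t.coe_nonneg hcont
    (show (1 : ℝ) ∈ Icc _ _ from ⟨by simp only [h0]; exact zero_le_one, ht1.le⟩)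
  have hxr := hlt x hx.2
  refine ⟨ENNReal.ofReal x, hxr.le, ?_⟩
  simp only at hx1
  rw [Psi_eq_psiQuot (Phi_lt_top_of_lt_rho hxr), psiQuot_ofReal hw0 hx.1 hxr, hx1,
    ENNReal.ofReal_one]

theorem existsUnique_isTau {w : ℕ → ℝ≥0} (hw0 : 0 < w 0) (hw2 : ∃ k, 2 ≤ k ∧ 0 < w k) :
    ∃! τ, IsTau w τ := by
  rcases lt_or_ge (nu w) 1 with h | h
  · exact ⟨rho w, ⟨fun h' => absurd h' (not_le.2 h), fun _ => rfl⟩, fun τ hτ => hτ.2 h⟩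
  · obtain ⟨τ, hτ, hτ1⟩ := exists_Psi_eq_one hw0 hw2 h
    refine ⟨τ, ⟨fun _ => ⟨hτ, hτ1⟩, fun h' => absurd h (not_le.2 h')⟩, fun s hs => ?_⟩
    obtain ⟨hs, hs1⟩ := hs.1 h
    rcases lt_trichotomy s τ with hlt | heq | hlt
    · exact absurd (Psi_lt_Psi hw0 hw2 hlt hτ) (by rw [hs1, hτ1]; exact lt_irrefl _)
    · exact heq
    · exact absurd (Psi_lt_Psi hw0 hw2 hlt hs) (by rw [hs1, hτ1]; exact lt_irrefl _)

theorem IsTau.le_rho {w : ℕ → ℝ≥0} {τ : ℝ≥0∞} (h : IsTau w τ) : τ ≤ rho w := by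
  rcases lt_or_ge (nu w) 1 with h1 | h1
  · exact (h.2 h1).le
  · exact (h.1 h1).1

theorem IsTau.Psi_eq {w : ℕ → ℝ≥0} {τ : ℝ≥0∞} (h : IsTau w τ) : Psi w τ = min (nu w) 1 := by
  rcases lt_or_ge (nu w) 1 with h1 | h1
  · rw [h.2 h1, min_eq_left h1.le, nu]
  · rw [(h.1 h1).2, min_eq_right h1]

theorem IsTau.lt_top {w : ℕ → ℝ≥0} (hw0 : 0 < w 0) (hw2 : ∃ k, 2 ≤ k ∧ 0 < w k) {τ : ℝ≥0∞}
    (h : IsTau w τ) : τ < ∞ ∧ Phi w τ < ∞ := by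
  rcases h.le_rho.lt_or_eq with h1 | h1
  · exact ⟨h1.trans_le le_top, Phi_lt_top_of_lt_rho h1⟩
  · have h2 := h.Psi_eq
    rw [h1]
    refine rho_lt_top_and_Phi_lt_top hw0 hw2 ?_
    rw [h1] at h2
    exact h2.trans_le (min_le_right _ _)

/-- Since Ψ(0) = 0, the value τ = 0 cannot come from Ψ(τ) = 1, so it must be τ = ρ. -/
theorem IsTau.rho_eq_zero {w : ℕ → ℝ≥0} {τ : ℝ≥0∞}
    (h : IsTau w τ) (h0 : τ = 0) : rho w = 0 := by
  have h1 : Psi w τ = 0 := by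
    rw [h0, Psi_eq_psiQuot (by rw [Phi_zero]; exact ENNReal.coe_lt_top), psiQuot_zero]
  rcases lt_or_ge (nu w) 1 with h2 | h2
  · rw [← h.2 h2, h0]
  · exact absurd (h1.symm.trans (h.1 h2).2) zero_ne_one

/-! ### The tilted distribution -/

/-- The distribution `π_k = t ^ k w_k / Φ(t)`. -/
def tilted (w : ℕ → ℝ≥0) (t : ℝ≥0∞) (h0 : Phi w t ≠ 0) (h : Phi w t ≠ ∞) : PMF ℕ :=
  ⟨fun k => t ^ k * w k / Phi w t, by
    have h1 : ∑' k, t ^ k * (w k : ℝ≥0∞) / Phi w t = 1 := by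
      simp_rw [div_eq_mul_inv]
      rw [ENNReal.tsum_mul_right, ← ENNReal.mul_inv_cancel h0 h]
      congr 1
      exact tsum_congr fun k => mul_comm _ _
    exact h1 ▸ ENNReal.summable.hasSum⟩

theorem tilted_apply {w : ℕ → ℝ≥0} {t : ℝ≥0∞} (h0 : Phi w t ≠ 0) (h : Phi w t ≠ ∞) (k : ℕ) :
    tilted w t h0 h k = t ^ k * w k / Phi w t := rfl

theorem tsum_pow_mul_tilted {w : ℕ → ℝ≥0} {t : ℝ≥0∞} (h0 : Phi w t ≠ 0) (h : Phi w t ≠ ∞) (j : ℕ) :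
    ∑' k : ℕ, (k : ℝ≥0∞) ^ j * tilted w t h0 h k = powMoment w j t / powMoment w 0 t := by
  simp_rw [tilted_apply, ← Phi_eq_powMoment, powMoment, div_eq_mul_inv]
  rw [← ENNReal.tsum_mul_right]
  exact tsum_congr fun k => by ring

theorem mean_tilted {w : ℕ → ℝ≥0} {t : ℝ≥0∞} (h0 : Phi w t ≠ 0) (h : Phi w t ≠ ∞) :
    mean (tilted w t h0 h) = Psi w t := by
  rw [Psi_eq_psiQuot h.lt_top, psiQuot_eq_powMoment_div, ← tsum_pow_mul_tilted h0 h 1, mean]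
  simp

theorem variance_add_mean_sq (p : PMF ℕ) (hp : mean p ≠ ∞) :
    variance p + mean p ^ 2 = ∑' k : ℕ, (k : ℝ≥0∞) ^ 2 * p k := by
  have hterm : ∀ k : ℕ, ENNReal.ofReal (((k : ℝ) - (mean p).toReal) ^ 2) * p k
      + 2 * mean p * (k * p k) = (k : ℝ≥0∞) ^ 2 * p k + mean p ^ 2 * p k := by
    intro k
    lift mean p to ℝ≥0 using hp with m
    have h1 : ENNReal.ofReal (((k : ℝ) - m) ^ 2) + 2 * m * k = (k : ℝ≥0∞) ^ 2 + (m : ℝ≥0∞) ^ 2 := by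
      have h2 : (2 * m * k : ℝ≥0∞) = ENNReal.ofReal (2 * m * k) := by
        rw [ENNReal.ofReal_mul (by positivity), ENNReal.ofReal_mul (by positivity),
          ENNReal.ofReal_coe_nnreal, ENNReal.ofReal_natCast, ENNReal.ofReal_ofNat]
      have h3 : (k : ℝ≥0∞) ^ 2 + (m : ℝ≥0∞) ^ 2 = ENNReal.ofReal ((k : ℝ) ^ 2 + (m : ℝ) ^ 2) := by
        rw [ENNReal.ofReal_add (by positivity) (by positivity), ENNReal.ofReal_pow (by positivity),
          ENNReal.ofReal_pow (by positivity), ENNReal.ofReal_coe_nnreal, ENNReal.ofReal_natCast]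
      rw [h2, h3, ← ENNReal.ofReal_add (by positivity) (by positivity)]
      congr 1
      ring
    rw [ENNReal.coe_toReal, ← mul_assoc, ← add_mul, h1, add_mul]
  have hsum := tsum_congr (L := SummationFilter.unconditional ℕ) hterm
  rw [ENNReal.tsum_add, ENNReal.tsum_add, ENNReal.tsum_mul_left, ENNReal.tsum_mul_left,
    p.tsum_coe, mul_one] at hsum
  change variance p + 2 * mean p * mean p = _ at hsum
  have h2 : 2 * mean p * mean p = mean p ^ 2 + mean p ^ 2 := by ring
  rw [h2, ← add_assoc] at hsum
  exact (ENNReal.add_left_inj (ENNReal.pow_ne_top hp)).1 hsum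

theorem variance_tilted {w : ℕ → ℝ≥0} {t : ℝ≥0∞} (h0 : Phi w t ≠ 0) (h : Phi w t ≠ ∞)
    (hP : Psi w t ≠ ∞) : variance (tilted w t h0 h) =
      powMoment w 2 t / powMoment w 0 t - (powMoment w 1 t / powMoment w 0 t) ^ 2 := by
  have h1 := variance_add_mean_sq (tilted w t h0 h) (by rwa [mean_tilted])
  rw [tsum_pow_mul_tilted, mean_tilted, Psi_eq_psiQuot h.lt_top, psiQuot_eq_powMoment_div] at h1
  refine ENNReal.eq_sub_of_add_eq (ENNReal.pow_ne_top ?_) h1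
  rwa [← psiQuot_eq_powMoment_div, ← Psi_eq_psiQuot h.lt_top]

/-! ### The derivative of `Ψ` and the variance -/

theorem ofReal_derivWithin_psiReal {w : ℕ → ℝ≥0} (hw0 : 0 < w 0) {s : ℝ≥0∞} (hs0 : 0 < s)
    (hs : s < rho w) : ENNReal.ofReal (derivWithin (psiReal w) (Ici 0) s.toReal) =
      (powMoment w 2 s / powMoment w 0 s - (powMoment w 1 s / powMoment w 0 s) ^ 2) / s := by
  lift s to ℝ≥0 using hs.ne_top
  have hs0' : (0 : ℝ) < s := by exact_mod_cast hs0
  rw [← ENNReal.ofReal_coe_nnreal] at hs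
  obtain ⟨G, hG, e⟩ := exists_hasDerivWithinAt_psiReal hw0 s.coe_nonneg hs
  have h0 := realMoment_zero_pos hw0 s.coe_nonneg hs
  rw [ENNReal.coe_toReal, hG.derivWithin (uniqueDiffOn_Ici 0 _ s.coe_nonneg),
    ← ENNReal.ofReal_coe_nnreal,
    powMoment_ofReal s.coe_nonneg (summable_moment_of_lt_rho s.coe_nonneg hs 0),
    powMoment_ofReal s.coe_nonneg (summable_moment_of_lt_rho s.coe_nonneg hs 1),
    powMoment_ofReal s.coe_nonneg (summable_moment_of_lt_rho s.coe_nonneg hs 2),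
    ← ENNReal.ofReal_div_of_pos h0, ← ENNReal.ofReal_div_of_pos h0,
    ← ENNReal.ofReal_pow (div_nonneg (realMoment_nonneg w 1 s.coe_nonneg) h0.le),
    ← ENNReal.ofReal_sub _ (by positivity), ← ENNReal.ofReal_div_of_pos hs0', ← e]
  congr 1
  field_simp

/-- For τ > 0 the witness is variance/τ. At τ = ρ the formula for Ψ' in terms of moments passes to
the limit: the second moment may become infinite, but the subtracted squared mean stays finite, so
the difference is continuous. -/
theorem exists_isPsiDeriv {w : ℕ → ℝ≥0} (hw0 : 0 < w 0) (hw2 : ∃ k, 2 ≤ k ∧ 0 < w k) {τ : ℝ≥0∞}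
    (hτ : IsTau w τ) (h0 : Phi w τ ≠ 0) (h : Phi w τ ≠ ∞) :
    ∃ D, IsPsiDeriv w τ D ∧ variance (tilted w τ h0 h) = τ * D := by
  have hP : Psi w τ ≠ ∞ := ((hτ.Psi_eq.trans_le (min_le_right _ _)).trans_lt ENNReal.one_lt_top).ne
  have hdiff : ∀ s < rho w, DifferentiableWithinAt ℝ (psiReal w) (Ici 0) s.toReal := by
    intro s hs
    obtain ⟨G, hG, -⟩ := exists_hasDerivWithinAt_psiReal hw0 (x := s.toReal)
      ENNReal.toReal_nonneg (by rwa [ENNReal.ofReal_toReal hs.ne_top])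
    exact hG.differentiableWithinAt
  rcases eq_zero_or_pos τ with rfl | hpos
  · have hr := hτ.rho_eq_zero rfl
    -- Here ρ = 0: nothing lies to the left of 0, so the limit condition is vacuous, and the tilted
    -- law is concentrated at 0.
    refine ⟨0, ⟨fun h' => ?_, fun _ => ⟨fun s hs => ?_, ?_⟩⟩, ?_⟩
    · rw [hr] at h'; exact absurd h' (lt_irrefl _)
    · exact absurd hs not_lt_zero
    · have : Iio (0 : ℝ≥0∞) = ∅ := by ext; simp
      rw [this, nhdsWithin_empty]
      exact tendsto_bot
    · rw [variance_tilted h0 h hP, zero_mul]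
      have : powMoment w 2 0 = 0 := by
        rw [powMoment, ENNReal.tsum_eq_zero]
        rintro (_ | k) <;> simp
      rw [this, ENNReal.zero_div, zero_tsub]
  have hτtop : τ ≠ ∞ := (hτ.lt_top hw0 hw2).1.ne
  have hmul : variance (tilted w τ h0 h) = τ * (variance (tilted w τ h0 h) / τ) :=
    (ENNReal.mul_div_cancel hpos.ne' hτtop).symm
  refine ⟨variance (tilted w τ h0 h) / τ, ⟨fun hlt => ?_, fun heq => ⟨fun s hs =>
    hdiff s (heq ▸ hs), ?_⟩⟩, hmul⟩
  · have hG := (hdiff τ hlt).hasDerivWithinAt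
    have hD := ofReal_derivWithin_psiReal hw0 hpos hlt
    rw [variance_tilted h0 h hP, ← hD]
    refine ⟨ENNReal.ofReal_lt_top, ?_⟩
    rw [ENNReal.toReal_ofReal]
    · exact hG
    · obtain ⟨G, hG', e⟩ := exists_hasDerivWithinAt_psiReal hw0 (x := τ.toReal)
        ENNReal.toReal_nonneg (by rwa [ENNReal.ofReal_toReal hτtop])
      have hpos' := ENNReal.toReal_pos hpos.ne' hτtop
      rw [hG'.derivWithin (uniqueDiffOn_Ici 0 _ ENNReal.toReal_nonneg)]
      have h1 := sq_realMoment_div_lt hw0 hw2 hpos' (by rwa [ENNReal.ofReal_toReal hτtop])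
      exact (pos_of_mul_pos_right (a := τ.toReal) (by linarith) hpos'.le).le
  · subst heq
    rw [variance_tilted h0 h hP]
    have h0' : powMoment w 0 (rho w) ≠ 0 := powMoment_zero_ne_zero hw0 _
    have ht' : powMoment w 0 (rho w) ≠ ∞ := by rwa [← Phi_eq_powMoment]
    have hq : powMoment w 1 (rho w) / powMoment w 0 (rho w) ≠ ∞ := by
      rwa [← psiQuot_eq_powMoment_div, ← Psi_eq_psiQuot h.lt_top]
    have hlim : ∀ j, Tendsto (fun s => powMoment w j s / powMoment w 0 s) (𝓝[<] (rho w))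
        (𝓝 (powMoment w j (rho w) / powMoment w 0 (rho w))) := fun j =>
      ENNReal.Tendsto.div (tendsto_powMoment w j _) (Or.inr h0') (tendsto_powMoment w 0 _)
        (Or.inl ht')
    have h2 := ENNReal.Tendsto.div (ENNReal.Tendsto.sub (hlim 2) (ENNReal.Tendsto.pow (n := 2) (hlim 1))
      (Or.inr (ENNReal.pow_ne_top hq))) (Or.inr hpos.ne')
      (tendsto_id.mono_left (nhdsWithin_le_nhds (s := Iio (rho w)))) (Or.inl hτtop)
    refine h2.congr' ?_
    filter_upwards [Ioo_mem_nhdsLT hpos] with s hs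
    exact (ofReal_derivWithin_psiReal hw0 hs.1 hs.2).symm

/-- For τ > 0 the point is that τ minimizes Φ(z)/z. The tangent bound Φ(z) ≥ Φ(τ)(1 + μ(z/τ - 1))
gives Φ(z) ≥ Φ(τ)z/τ, directly if μ = 1. -/
theorem isLimitOffspring_tilted {w : ℕ → ℝ≥0} (hw0 : 0 < w 0) (hw2 : ∃ k, 2 ≤ k ∧ 0 < w k)
    {τ : ℝ≥0∞} (hτ : IsTau w τ) (h0 : Phi w τ ≠ 0) (h : Phi w τ ≠ ∞) :
    IsLimitOffspring (fun k => (w k : ℝ)) fun k => (tilted w τ h0 h k).toReal := by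
  have hτtop : τ ≠ ∞ := (hτ.lt_top hw0 hw2).1.ne
  rcases eq_zero_or_pos τ with rfl | hpos
  · refine Or.inr ⟨frequently_pow_le_of_rho_eq_zero (hτ.rho_eq_zero rfl), fun k => ?_⟩
    beta_reduce
    rw [tilted_apply, Phi_zero]
    rcases k with _ | k
    · simp [hw0.ne']
    · simp
  left
  lift τ to ℝ≥0 using hτtop
  have ht : (0 : ℝ) < τ := by exact_mod_cast hpos
  have hsum : Summable fun k => (w k : ℝ) * (τ : ℝ) ^ k :=
    summable_of_Phi_lt_top ht.le (by rw [ENNReal.ofReal_coe_nnreal]; exact h.lt_top)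
  have hP : (Phi w τ).toReal = ∑' k, (w k : ℝ) * (τ : ℝ) ^ k := by
    rw [Phi, ENNReal.tsum_toReal_eq fun k => by finiteness]
    simp
  have hPpos : 0 < ∑' k, (w k : ℝ) * (τ : ℝ) ^ k := by
    rw [← hP]; exact ENNReal.toReal_pos h0 h
  have hp : ∀ k, (tilted w τ h0 h k).toReal =
      w k * (τ : ℝ) ^ k / ∑' k, (w k : ℝ) * (τ : ℝ) ^ k := by
    intro k
    rw [tilted_apply, ENNReal.toReal_div, hP]
    simp [mul_comm]
  have hmean : mean (tilted w τ h0 h) ≤ 1 := by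
    rw [mean_tilted, hτ.Psi_eq]; exact min_le_right _ _
  have hms := hasSum_toReal_mean _ (hmean.trans_lt ENNReal.one_lt_top).ne
  refine ⟨τ, ht, hsum, hp, fun z hz hzs => ?_⟩
  have h1 : HasSum (fun k : ℕ => (k : ℝ) * (w k * (τ : ℝ) ^ k))
      ((mean (tilted w τ h0 h)).toReal * ∑' k, (w k : ℝ) * (τ : ℝ) ^ k) := by
    refine (hms.mul_right (∑' k, (w k : ℝ) * (τ : ℝ) ^ k)).congr_fun fun k => ?_
    rw [hp k, mul_assoc, div_mul_cancel₀ _ hPpos.ne']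
  have h2 := realMoment_zero_add_le ht hz.le hsum h1.summable hzs
  rw [h1.tsum_eq] at h2
  set F := ∑' k, (w k : ℝ) * (τ : ℝ) ^ k
  -- If ν < 1, then convergence at z forces z ≤ ρ = τ, so the factor z/τ - 1 is not positive and μ ≤
  -- 1 works in the right direction.
  have h3 : z / τ - 1 ≤ (mean (tilted w τ h0 h)).toReal * (z / τ - 1) := by
    rcases lt_or_ge (nu w) 1 with hn | hn
    · have hzr := le_rho_of_summable hz.le hzs
      rw [← hτ.2 hn, ← ENNReal.ofReal_coe_nnreal, ENNReal.ofReal_le_ofReal_iff ht.le] at hzr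
      have h4 : z / (τ : ℝ) - 1 ≤ 0 := by rw [sub_nonpos, div_le_one ht]; exact hzr
      have h5 : (mean (tilted w τ h0 h)).toReal ≤ 1 := by
        simpa using ENNReal.toReal_mono ENNReal.one_ne_top hmean
      nlinarith
    · rw [mean_tilted, (hτ.1 hn).2]; simp
  have h4 : F * (z / τ) ≤ ∑' k, (w k : ℝ) * z ^ k := by nlinarith
  calc z * F = τ * (F * (z / τ)) := by field_simp
    _ ≤ _ := mul_le_mul_of_nonneg_left h4 ht.le

end

end SimplyGenerated

/-! ### The main theorem -/

theorem mainTheorem1 (w : ℕ → ℝ≥0) (hw0 : 0 < w 0) (hw2 : ∃ k, 2 ≤ k ∧ 0 < w k) :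
    (∃! τ : ℝ≥0∞, SimplyGenerated.IsTau w τ) ∧
    ∀ τ : ℝ≥0∞, SimplyGenerated.IsTau w τ →
      τ < ∞ ∧ 0 < SimplyGenerated.Phi w τ ∧ SimplyGenerated.Phi w τ < ∞ ∧
      ∃ p : PMF ℕ,
        (∀ k : ℕ, p k = τ ^ k * (w k : ℝ≥0∞) / SimplyGenerated.Phi w τ) ∧
        SimplyGenerated.mean p = SimplyGenerated.Psi w τ ∧
        SimplyGenerated.mean p = min (SimplyGenerated.nu w) 1 ∧
        (∃ D : ℝ≥0∞, SimplyGenerated.IsPsiDeriv w τ D ∧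
          SimplyGenerated.variance p = τ * D) ∧
        ∃ hp : SimplyGenerated.mean p ≤ 1,
          TendstoInDistribution
            (fun (n : {n : ℕ // SimplyGenerated.partitionFn w n ≠ 0})
              (T : SimplyGenerated.TreeOfSize n) => (T : SimplyGenerated.Tree))
            atTop
            SimplyGenerated.modifiedGW
            (fun n => (SimplyGenerated.simplyGeneratedTree w n).toMeasure)
            (SimplyGenerated.choiceMeasure p hp) ∧
          (1 ≤ SimplyGenerated.nu w →
            SimplyGenerated.mean p = 1 ∧
            ∀ᵐ ω ∂(SimplyGenerated.choiceMeasure p hp),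
              (∀ v, (SimplyGenerated.modifiedGW ω).deg v < ⊤) ∧
              ∃ x : ℕ → ℕ,
                SimplyGenerated.spine ω = Set.range fun m : ℕ => (List.range m).map x) ∧
          (SimplyGenerated.nu w < 1 →
            SimplyGenerated.mean p = SimplyGenerated.nu w ∧
            SimplyGenerated.mean p < 1 ∧
            ∀ᵐ ω ∂(SimplyGenerated.choiceMeasure p hp),
              ∃ v : List ℕ,
                SimplyGenerated.spine ω = {u | u <+: v} ∧
                (SimplyGenerated.modifiedGW ω).deg v = ⊤ ∧
                ∀ u, u ≠ v → (SimplyGenerated.modifiedGW ω).deg u < ⊤) := by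
  refine ⟨SimplyGenerated.existsUnique_isTau hw0 hw2, fun τ hτ => ?_⟩
  obtain ⟨hτtop, hP⟩ := hτ.lt_top hw0 hw2
  have hP0 : 0 < SimplyGenerated.Phi w τ :=
    (ENNReal.coe_pos.2 hw0).trans_le (SimplyGenerated.coe_le_Phi w τ)
  have hmean := SimplyGenerated.mean_tilted hP0.ne' hP.ne
  have hmin := hmean.trans hτ.Psi_eq
  have hle : SimplyGenerated.mean (SimplyGenerated.tilted w τ hP0.ne' hP.ne) ≤ 1 :=
    hmin.trans_le (min_le_right _ _)
  refine ⟨hτtop, hP0, hP, SimplyGenerated.tilted w τ hP0.ne' hP.ne,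
    SimplyGenerated.tilted_apply hP0.ne' hP.ne, hmean, hmin,
    SimplyGenerated.exists_isPsiDeriv hw0 hw2 hτ hP0.ne' hP.ne, hle,
    SimplyGenerated.tendstoInDistribution_simplyGeneratedTree hw0 hw2 hle
      (SimplyGenerated.isLimitOffspring_tilted hw0 hw2 hτ hP0.ne' hP.ne),
    fun hnu => ?_, fun hnu => ?_⟩
  · have h1 := hmin.trans (min_eq_right hnu)
    exact ⟨h1, SimplyGenerated.ae_spine_of_mean_eq_one _ hle h1⟩
  · have h1 := hmin.trans (min_eq_left hnu.le)
    exact ⟨h1, h1.trans_lt hnu, SimplyGenerated.ae_spine_of_mean_lt_one _ hle (h1.trans_lt hnu)⟩
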